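/- Let $K$ be a field, $L$ a first-order language, and $T$ a model-complete $L$-theory, i.e. every embedding between models of $T$ is elementary. Let $\Omega$ be a family of parameter-free $L$-formulas that define, in every model $\mathcal M\models T$, a nontrivial $K$-vector space $\mathbb V=\mathbb V(\mathcal M)$ whose elements are $d$-tuples from $M$ (domain, zero, graph of addition, graph of multiplication by each $q\in K$). **Kernel configurations.** Let $K[X]_{\mathrm{irr}}$ be the set of monic irreducible polynomials in $K[X]$. A *kernel configuration* $C$ consists of a function $K[X]_{\mathrm{irr}}\to\mathbb N\cup\{\infty\}$, $f\mapsto C(f)$, and a degree $\deg C\in\mathbb N_{>0}\cup\{\infty\}$ such that $\deg C=\infty$ or $\deg C=\sum_f \deg(f)\,C(f)$. It is *algebraic* if $\deg C<\infty$, in which case $\mathrm{MiPo}(C):=\prod_f f^{C(f)}$, and *transcendental* otherwise. For $P=\sum_i p_iX^i\in K[X]$ and an endomorphism $\theta$ of $\mathbb V$ write $P[\theta]=\sum_i p_i\theta^i$. The endomorphism $\theta$ is a *$C$-endomorphism* if $\mathrm{MiPo}(C)[\theta]=0$ (when $C$ is algebraic), respectively if $\ker f^{C(f)}[\theta]=\ker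 f^{C(f)+1}[\theta]$ for all $f\in K[X]_{\mathrm{irr}}$ with $C(f)<\infty$ (when $C$ is transcendental). It is *$C$-image-complete* if $\operatorname{Im} f^{C(f)+1}[\theta]=\operatorname{Im} f^{C(f)}[\theta]$ for all $f\in K[X]_{\mathrm{irr}}$ with $C(f)<\infty$. **Models.** Let $L_\theta=L\cup\{\theta\}$, where $\theta$ is a symbol for a function from $d$-tuples to $d$-tuples (that is, $d$ function symbols of arity $d$). A model of $T_\theta^C$ is an $L_\theta$-structure $(\mathcal M,\theta)$ with $\mathcal M\models T$ such that $\theta$ restricts to a $C$-endomorphism of the $K$-vector space $\mathbb V$ and $\theta$ takes the value $0\in\mathbb V$ outside of $\mathbb V$. A model $(\mathcal M,\theta)$ of $T_\theta^C$ is *existentially closed* if every existential $L_\theta$-sentence with parameters in $M$ that holds in some extension $(\mathcal M',\theta')\supseteq(\mathcal M,\theta)$ with $(\mathcal M',\theta')\models T_\theta^C$ also holds in $(\mathcal M,\theta)$. **Sequence-systems.** A *$C$-sequence-system* over $(\mathbb V,\theta)$ is a conjunction $$S(\underline x)=\bigwedge_{k=1}^n\Big(\xi_k[\theta](x_{\mathrm{ld},k})=\sum_{l=1}^m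 P_{k,l}[\theta](x_{\mathrm{li},l})+u_{\mathrm{ld},k}\Big)\wedge\bigwedge_{k=1}^r\big(f_k^{q_k}[\theta](x_{\mathrm{ke},k})=u_{\mathrm{ke},k}\big)$$ in the variables $\underline x=(x_{\mathrm{li},l})_{l\le m}(x_{\mathrm{ld},k})_{k\le n}(x_{\mathrm{ke},k})_{k\le r}$, with $m,n,r\ge 0$, $P_{k,l}\in K[X]$ and $u_{\mathrm{ld},k},u_{\mathrm{ke},k}\in\mathbb V$, such that: (i) $m=n=0$ if $C$ is algebraic; (ii) each $\xi_k\in K[X]$ is monic of positive degree, and every monic irreducible factor $g$ of $\xi_k$ has $C(g)=\infty$; (iii) for each $k\le r$, $f_k\in K[X]_{\mathrm{irr}}$, $0<C(f_k)<\infty$, $0<q_k\le C(f_k)$ and $u_{\mathrm{ke},k}\in\ker f_k^{C(f_k)-q_k}[\theta]$. **Placeholder formulas.** For each variable $x$ in $\underline x$ let $x^i$ ($i\in\mathbb N$) be a new variable for elements of $\mathbb V$, and let $\vec x$ be the tuple of all of these. For an $L(M)$-formula $\psi(\vec x)$ let $\psi_\theta(\underline x)$ be obtained by replacing each $x^i$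 by $\theta^i(x)$. The formula $\psi$ is *bounded* by $S$ if $x_{\mathrm{ld},k}^i$ appears in $\psi$ only for $i<\deg\xi_k$ and $x_{\mathrm{ke},k}^i$ appears in $\psi$ only for $i<\deg(f_k^{q_k})$. The formula $\psi$ *implies a finite disjunction of nontrivial linear dependencies in $\vec x$ over $\mathbb V$* if there are finitely many (possibly no) equations, each of the form $\sum_{x,i}a_{x,i}\,x^i=v$ with $v\in\mathbb V$ and a finitely supported nonzero family of coefficients $a_{x,i}\in K$, such that every assignment of elements of $\mathbb V$ to $\vec x$ that satisfies $\psi$ in $\mathcal M$ satisfies at least one of these equations. **Theorem.** Let $C$ be a kernel configuration. A model $(\mathcal M,\theta)\models T_\theta^C$ is existentially closed if and only if $\theta$ is $C$-image-complete and $$(\mathcal M,\theta)\models\exists\,\underline x\in\mathbb V:\ \psi_\theta(\underline x)\wedge S(\underline x)$$ holds for every $C$-sequence-system $S(\underline x)$ over $(\mathbb V,\theta)$ and every $L(M)$-formula $\psi(\vec x)$ that is bounded by $S$ and does not imply any finite disjunction of nontrivial linear dependencies in $\vec x$ over $\mathbb V$. -/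

import Mathlib

open FirstOrder FirstOrder.Language Polynomial

universe u v w k

namespace GenericEndo

/-! ### Model completeness -/

/-- `T` is model complete: every embedding between models of `T` is elementary. (All models are
nonempty. The models range over a universe that is large enough for Löwenheim-Skolem, so that the
choice of `w` does not matter.) -/
def IsModelComplete {L : FirstOrder.Language.{u, v}} (T : L.Theory) : Prop :=
  ∀ (M N : Type (max u v w)) [Nonempty M] [Nonempty N] [L.Structure M] [L.Structure N]
    [M ⊨ T] [N ⊨ T] (f : M ↪[L] N) (n : ℕ) (φ : L.Formula (Fin n)) (x : Fin n → M),
    φ.Realize (f ∘ x) ↔ φ.Realize x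

/-! ### Definable vector spaces -/

/-- Parameter-free `L`-formulas meant to define a `K`-vector space whose elements are `d`-tuples:
its domain, its zero, and the graphs of the addition and of the scalar multiplications. -/
structure VSFormulas (L : FirstOrder.Language.{u, v}) (K : Type k) (d : ℕ) where
  dom : L.Formula (Fin d)
  zero : L.Formula (Fin d)
  add : L.Formula (Fin d ⊕ Fin d ⊕ Fin d)
  smul : K → L.Formula (Fin d ⊕ Fin d)

section

variable {L : FirstOrder.Language.{u, v}} {K : Type k} {d : ℕ}

/-- The definable set `𝕍` in the structure `M`. -/
def VSFormulas.carrier (Ω : VSFormulas L K d) (M : Type*) [L.Structure M] : Set (Fin d → M) :=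
  {x | Ω.dom.Realize x}

variable [Field K]

/-- The formulas `Ω` define a nontrivial `K`-vector space in `M`. -/
class VSFormulas.IsVectorSpace (Ω : VSFormulas L K d) (M : Type*) [L.Structure M] : Prop where
  out : ∃ (_ : AddCommGroup (Ω.carrier M)) (_ : Module K (Ω.carrier M)),
    Nontrivial (Ω.carrier M) ∧
    (∀ x : Ω.carrier M, Ω.zero.Realize x.1 ↔ x = 0) ∧
    (∀ x y z : Ω.carrier M, Ω.add.Realize (Sum.elim x.1 (Sum.elim y.1 z.1)) ↔ x + y = z) ∧
    (∀ (a : K) (x y : Ω.carrier M), (Ω.smul a).Realize (Sum.elim x.1 y.1) ↔ a • x = y)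

/-- The vector space `𝕍` of `M`; its operations are determined by the formulas. -/
noncomputable instance VSFormulas.instAddCommGroup (Ω : VSFormulas L K d) (M : Type*)
    [L.Structure M] [h : Ω.IsVectorSpace M] : AddCommGroup (Ω.carrier M) :=
  h.out.choose

noncomputable instance VSFormulas.instModule (Ω : VSFormulas L K d) (M : Type*)
    [L.Structure M] [h : Ω.IsVectorSpace M] : Module K (Ω.carrier M) :=
  h.out.choose_spec.choose

end

/-! ### The symbol `θ` -/

/-- The only symbols are the `d` coordinates of `θ`, each a function symbol of arity `d`. -/
inductive ThetaFunctions (d : ℕ) : ℕ → Type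
  | coord (j : Fin d) : ThetaFunctions d d

/-- The language with a symbol `θ` for a function from `d`-tuples to `d`-tuples. -/
def thetaLang (d : ℕ) : FirstOrder.Language.{0, 0} := ⟨ThetaFunctions d, fun _ => Empty⟩

/-- The language `L_θ = L ∪ {θ}`. -/
abbrev withTheta (L : FirstOrder.Language.{u, v}) (d : ℕ) : FirstOrder.Language := L.sum (thetaLang d)

/-- The interpretation of `θ` in a structure. -/
def thetaMap {d : ℕ} (M : Type*) [(thetaLang d).Structure M] (x : Fin d → M) : Fin d → M :=
  fun j => Structure.funMap (L := thetaLang d) (ThetaFunctions.coord j) x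

section

variable {L : FirstOrder.Language.{u, v}} {K : Type k} {d : ℕ} [Field K]

/-- `θ` restricts to an endomorphism of `𝕍`, and it is the zero of `𝕍` outside of `𝕍`. -/
class VSFormulas.IsEndo (Ω : VSFormulas L K d) (M : Type*) [L.Structure M]
    [(thetaLang d).Structure M] [Ω.IsVectorSpace M] : Prop where
  out : ∃ g : Module.End K (Ω.carrier M),
    (∀ x : Ω.carrier M, thetaMap M x.1 = (g x).1) ∧
    (∀ x : Fin d → M, x ∉ Ω.carrier M → thetaMap M x = (0 : Ω.carrier M).1)

/-- The endomorphism `θ` of `𝕍`. -/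
noncomputable def VSFormulas.endo (Ω : VSFormulas L K d) (M : Type*) [L.Structure M]
    [(thetaLang d).Structure M] [Ω.IsVectorSpace M] [h : Ω.IsEndo M] :
    Module.End K (Ω.carrier M) :=
  h.out.choose

end

/-! ### Kernel configurations -/

/-- The monic irreducible polynomials over `K`. -/
abbrev MonicIrr (K : Type k) [Field K] : Type k := {f : K[X] // f.Monic ∧ Irreducible f}

/-- A kernel configuration. (If infinitely many `c f` are nonzero, then the sum of all
`deg f * c f` is infinite, so that `deg` has to be `⊤`; `finsum` is `0` in that case, which `deg`
is not.) -/
structure KernelConfig (K : Type k) [Field K] where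
  c : MonicIrr K → ℕ∞
  deg : ℕ∞
  deg_ne_zero : deg ≠ 0
  deg_eq : deg = ⊤ ∨ deg = ∑ᶠ f : MonicIrr K, (f.1.natDegree : ℕ∞) * c f

namespace KernelConfig

variable {K : Type k} [Field K] (C : KernelConfig K)

def IsAlgebraic : Prop := C.deg ≠ ⊤

def IsTranscendental : Prop := C.deg = ⊤

/-- The minimal polynomial of an algebraic kernel configuration. -/
noncomputable def miPo : K[X] := ∏ᶠ f : MonicIrr K, f.1 ^ (C.c f).toNat

variable {V : Type*} [AddCommGroup V] [Module K V]

/-- `θ` is a `C`-endomorphism. -/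
def IsCEndo (θ : Module.End K V) : Prop :=
  (C.IsAlgebraic → LinearMap.ker (aeval θ C.miPo) = ⊤) ∧
  (C.IsTranscendental → ∀ f : MonicIrr K, C.c f < ⊤ →
    LinearMap.ker (aeval θ (f.1 ^ (C.c f).toNat)) =
      LinearMap.ker (aeval θ (f.1 ^ ((C.c f).toNat + 1))))

/-- `θ` is `C`-image-complete. -/
def ImageComplete (θ : Module.End K V) : Prop :=
  ∀ f : MonicIrr K, C.c f < ⊤ →
    LinearMap.range (aeval θ (f.1 ^ ((C.c f).toNat + 1))) =
      LinearMap.range (aeval θ (f.1 ^ (C.c f).toNat))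

end KernelConfig

/-- A `C`-sequence-system over `(V, θ)`, given by the data of its equations. It has `m` variables
`x_li`, `n` variables `x_ld` and `r` variables `x_ke`. -/
structure SequenceSystem {K : Type k} [Field K] (C : KernelConfig K) {V : Type*} [AddCommGroup V]
    [Module K V] (θ : Module.End K V) where
  m : ℕ
  n : ℕ
  r : ℕ
  ξ : Fin n → K[X]
  P : Fin n → Fin m → K[X]
  uld : Fin n → V
  f : Fin r → MonicIrr K
  q : Fin r → ℕ
  uke : Fin r → V
  alg : C.IsAlgebraic → m = 0 ∧ n = 0
  ξ_monic : ∀ i, (ξ i).Monic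
  ξ_deg : ∀ i, 0 < (ξ i).natDegree
  ξ_fac : ∀ i, ∀ g : MonicIrr K, g.1 ∣ ξ i → C.c g = ⊤
  f_pos : ∀ i, 0 < C.c (f i)
  f_lt_top : ∀ i, C.c (f i) < ⊤
  q_pos : ∀ i, 0 < q i
  q_le : ∀ i, (q i : ℕ∞) ≤ C.c (f i)
  uke_mem : ∀ i, uke i ∈ LinearMap.ker (aeval θ ((f i).1 ^ ((C.c (f i)).toNat - q i)))

namespace SequenceSystem

variable {K : Type k} [Field K] {C : KernelConfig K} {V : Type*} [AddCommGroup V] [Module K V]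
  {θ : Module.End K V}

/-- The variables of a sequence-system: `x_li`, `x_ld` and `x_ke`. -/
abbrev Var (S : SequenceSystem C θ) : Type := Fin S.m ⊕ Fin S.n ⊕ Fin S.r

abbrev li (S : SequenceSystem C θ) (i : Fin S.m) : S.Var := Sum.inl i

abbrev ld (S : SequenceSystem C θ) (i : Fin S.n) : S.Var := Sum.inr (Sum.inl i)

abbrev ke (S : SequenceSystem C θ) (i : Fin S.r) : S.Var := Sum.inr (Sum.inr i)

/-- The tuple `x` in `V` satisfies all equations of the sequence-system. -/
def Holds (S : SequenceSystem C θ) (x : S.Var → V) : Prop :=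
  (∀ i, aeval θ (S.ξ i) (x (S.ld i)) = ∑ l, aeval θ (S.P i l) (x (S.li l)) + S.uld i) ∧
  (∀ i, aeval θ ((S.f i).1 ^ S.q i) (x (S.ke i)) = S.uke i)

end SequenceSystem

/-! ### Formulas in placeholder variables -/

/-- The `L(M)`-formulas in the placeholder variables `x_s^i` (`s` in `σ`, `i` in `ℕ`) for elements
of `𝕍`. As these elements are `d`-tuples, `x_s^i` consists of the variables `(s, i, j)` for `j` in
`Fin d`. The parameters are the variables in `M`, always evaluated at themselves. -/
abbrev PlaceholderFormula (L : FirstOrder.Language.{u, v}) (M : Type*) (σ : Type) (d : ℕ) :=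
  L.Formula (M ⊕ σ × ℕ × Fin d)

section

variable {L : FirstOrder.Language.{u, v}} {K : Type k} {d : ℕ} {M : Type*} {σ : Type}

open Classical in
/-- The placeholder variable `x_s^i` appears in `ψ`. -/
def Appears (ψ : PlaceholderFormula L M σ d) (s : σ) (i : ℕ) : Prop :=
  ∃ j : Fin d, Sum.inr (s, i, j) ∈ ψ.freeVarFinset

variable [L.Structure M]

/-- `ψ` holds in `M` when `x_s^i` takes the value `y s i`. -/
def PlaceholderFormula.RealizeAt (ψ : PlaceholderFormula L M σ d)
    (y : σ → ℕ → Fin d → M) : Prop :=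
  ψ.Realize (Sum.elim id fun p => y p.1 p.2.1 p.2.2)

variable [Field K]

/-- `ψ` implies (in `M`, for placeholders ranging over `𝕍`) some finite disjunction of nontrivial
linear dependencies in the placeholders over `𝕍`. Such a dependency is an equation
`∑ a_s^i • x_s^i = v` with finitely many, but at least one, nonzero coefficients in `K` and with
`v` in `𝕍`. The empty disjunction is false. -/
def ImpliesDependencies (Ω : VSFormulas L K d) [Ω.IsVectorSpace M]
    (ψ : PlaceholderFormula L M σ d) : Prop :=
  ∃ D : Finset ((σ × ℕ →₀ K) × Ω.carrier M), (∀ e ∈ D, e.1 ≠ 0) ∧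
    ∀ y : σ → ℕ → Ω.carrier M, ψ.RealizeAt (fun s i => (y s i).1) →
      ∃ e ∈ D, (e.1.sum fun p a => a • y p.1 p.2) = e.2

/-- `ψ_θ(x)`: the formula `ψ` with each placeholder `x_s^i` replaced by `θ^i(x_s)`. -/
def RealizeTheta (Ω : VSFormulas L K d) [(thetaLang d).Structure M] [Ω.IsVectorSpace M]
    [Ω.IsEndo M] (ψ : PlaceholderFormula L M σ d) (x : σ → Ω.carrier M) : Prop :=
  ψ.RealizeAt fun s i => ((Ω.endo M ^ i) (x s)).1

/-- `ψ` is bounded by the sequence-system `S`. -/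
def SequenceSystem.Bounds {C : KernelConfig K} {V : Type*} [AddCommGroup V] [Module K V]
    {θ : Module.End K V} (S : SequenceSystem C θ) (ψ : PlaceholderFormula L M S.Var d) : Prop :=
  (∀ k i, Appears ψ (S.ld k) i → i < (S.ξ k).natDegree) ∧
  (∀ k i, Appears ψ (S.ke k) i → i < ((S.f k).1 ^ S.q k).natDegree)

end

/-! ### Models of `T_θ^C` and existential closedness -/

section

variable {L : FirstOrder.Language.{u, v}} {K : Type k} {d : ℕ} [Field K]

/-- The `L_θ`-structure `M` is a model of `T_θ^C`. -/
structure IsModel (T : L.Theory) (Ω : VSFormulas L K d) (C : KernelConfig K) (M : Type*)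
    [L.Structure M] [(thetaLang d).Structure M] : Prop where
  model : M ⊨ T
  isVectorSpace : Ω.IsVectorSpace M
  isEndo : Ω.IsEndo M
  isCEndo : C.IsCEndo (Ω.endo M)

/-- The model `M` of `T_θ^C` is existentially closed: an existential `L_θ`-formula with parameters
in `M` that holds in some `L_θ`-extension of `M` to a model of `T_θ^C` holds in `M`. -/
def IsExistentiallyClosed (T : L.Theory) (Ω : VSFormulas L K d) (C : KernelConfig K)
    (M : Type w) [L.Structure M] [(thetaLang d).Structure M] : Prop :=
  ∀ (N : Type w) [L.Structure N] [(thetaLang d).Structure N], IsModel T Ω C N →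
    ∀ (e : M ↪[withTheta L d] N) (n : ℕ) (φ : (withTheta L d).Formula (Fin n)) (a : Fin n → M),
      φ.IsExistential → φ.Realize (e ∘ a) → φ.Realize a

end

end GenericEndo

namespace GenericEndo

/-! ### Free variables and existential quantification -/

section Formulas

variable {L : FirstOrder.Language.{u, v}}

/-! View `𝕍` as a `K[X]`-module on which `X` acts as `θ`. Being a `C`-endomorphism becomes the
module condition `IsCModule`, which passes to submodules and direct sums. Both directions go through
`HasTransfer`: an arbitrary `L`-formula over `M`, together with finitely many equations `θ(z) = w`,
is solvable in `M` as soon as it is solvable in an extension that is a model. For existentially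
closed models this follows from model completeness, which replaces the `L`-formula by a
quantifier-free one (`IsModelComplete.exists_isQF`). Conversely, naming the values of all terms
flattens an existential `L_θ`-formula into this shape (`exists_flatten_formula`).

From transfer to the axioms: if `ψ` implies no dependencies, an ultrapower `N` of `M` contains
vectors that satisfy `ψ` and are linearly independent over `𝕍(M)` (`exists_elementary_independent`).
On the algebraic side, the generic solution of `S` generates the module `Adjoin`, which is again a
`C`-module (`SequenceSystem.isCModule_adjoin`). Over `𝕍(M)` the powers of `X` allowed by the bounds
are `K`-independent in it, so `Adjoin` embeds into `𝕍(N)` with these powers sent to the chosen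
vectors (`exists_adjoin_embedding`). A complement of the image is large enough to be made a direct
sum of copies of `𝕍(M)`, hence the action of `X` extends to a `C`-endomorphism of `𝕍(N)`
(`exists_isCEndo_extension`). Now `S` and `ψ_θ` are solvable in `N`, and transfer brings a solution
back to `M`. Image-completeness is obtained by adjoining a solution of `f[θ](x) = w` in the same
way.

From the axioms to transfer: the finitely many vectors of a solution in `N` to which a `θ`-equation
applies, and their images, generate a finitely generated module over `𝕍(M)`. The structure theorem
over the principal ideal domain `K[X]` supplies generators of the quotient whose only relations are
`p s • g s = 0`, with `p s` zero or a power of an irreducible. Image-completeness allows their lifts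
to be corrected by elements of `𝕍(M)` until they satisfy a sequence-system
(`exists_generators_imageComplete`). All relations follow from that system, and the bounded powers
are independent over `𝕍(M)`. Everything else is one `L`-formula about these powers, which therefore
implies no dependencies, and the axiom yields a solution in `M`. Only systems with `P = 0` are
needed here. -/

theorem realize_congr_of_freeVarFinset {α : Type*} [DecidableEq α] {A : Type*} [L.Structure A]
    (φ : L.Formula α) {x y : α → A} (h : ∀ a ∈ φ.freeVarFinset, x a = y a) :
    φ.Realize x ↔ φ.Realize y := by
  unfold Formula.Realize
  rw [← BoundedFormula.realize_restrictFreeVar (f := id) (v := fun a => x a.1) x (fun _ => rfl),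
    ← BoundedFormula.realize_restrictFreeVar (f := id) (v := fun a => x a.1) y
      (fun a => h a.1 a.2)]

theorem exists_of_mem_varFinsetLeft_relabel {α β : Type*} [DecidableEq α] [DecidableEq β] {n k : ℕ}
    (g : α → β ⊕ Fin n) (t : L.Term (α ⊕ Fin k)) {b : β}
    (hb : b ∈ (t.relabel (BoundedFormula.relabelAux g k)).varFinsetLeft) :
    ∃ a ∈ t.varFinsetLeft, g a = Sum.inl b := by
  induction t with
  | var i =>
    cases i with
    | inl a =>
      refine ⟨a, by simp, ?_⟩
      revert hb
      simp only [Term.relabel, BoundedFormula.relabelAux, Function.comp_apply, Sum.map_inl]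
      cases g a <;> simp [eq_comm]
    | inr i => simp [Term.relabel, BoundedFormula.relabelAux] at hb
  | func f ts ih =>
    simp only [Term.relabel, Term.varFinsetLeft, Finset.mem_biUnion, Finset.mem_univ,
      true_and] at hb ⊢
    obtain ⟨i, hi⟩ := hb
    obtain ⟨a, ha, h⟩ := ih i hi
    exact ⟨a, ⟨i, ha⟩, h⟩

/-- Renaming creates no new free variables; this is what keeps a formula in bounded placeholders
bounded after it is rewritten as a `PlaceholderFormula`. -/
theorem exists_of_mem_freeVarFinset_relabel {α β : Type*} [DecidableEq α] [DecidableEq β]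
    {n k : ℕ} (g : α → β ⊕ Fin n) (φ : L.BoundedFormula α k) {b : β}
    (hb : b ∈ (φ.relabel g).freeVarFinset) : ∃ a ∈ φ.freeVarFinset, g a = Sum.inl b := by
  induction φ with
  | falsum => simp at hb
  | equal t₁ t₂ =>
    simp only [BoundedFormula.relabel, BoundedFormula.mapTermRel, BoundedFormula.freeVarFinset,
      Finset.mem_union] at hb ⊢
    rcases hb with hb | hb <;> obtain ⟨a, ha, h⟩ := exists_of_mem_varFinsetLeft_relabel g _ hb
    · exact ⟨a, Or.inl ha, h⟩
    · exact ⟨a, Or.inr ha, h⟩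
  | rel R ts =>
    simp only [BoundedFormula.relabel, BoundedFormula.mapTermRel, BoundedFormula.freeVarFinset,
      Finset.mem_biUnion, Finset.mem_univ, true_and] at hb ⊢
    obtain ⟨i, hi⟩ := hb
    obtain ⟨a, ha, h⟩ := exists_of_mem_varFinsetLeft_relabel g _ hi
    exact ⟨a, ⟨i, ha⟩, h⟩
  | imp φ₁ φ₂ ih1 ih2 =>
    simp only [BoundedFormula.relabel_imp, BoundedFormula.freeVarFinset, Finset.mem_union] at hb ⊢
    rcases hb with hb | hb
    · obtain ⟨a, ha, h⟩ := ih1 hb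
      exact ⟨a, Or.inl ha, h⟩
    · obtain ⟨a, ha, h⟩ := ih2 hb
      exact ⟨a, Or.inr ha, h⟩
  | all φ ih =>
    rw [BoundedFormula.relabel_all] at hb
    exact ih hb

theorem isQF_iInf {α β : Type*} [Finite β] {n : ℕ} {f : β → L.BoundedFormula α n}
    (h : ∀ b, (f b).IsQF) : (BoundedFormula.iInf f).IsQF := by
  have key : ∀ l : List (L.BoundedFormula α n), (∀ φ ∈ l, φ.IsQF) → (l.foldr (· ⊓ ·) ⊤).IsQF := by
    intro l hl
    induction l with
    | nil => exact BoundedFormula.IsQF.top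
    | cons a l ih =>
      exact (hl a (by simp)).inf (ih fun φ hφ => hl φ (by simp [hφ]))
  refine key _ fun φ hφ => ?_
  obtain ⟨b, -, rfl⟩ := List.mem_map.1 hφ
  exact h b

theorem isExistential_exs {α : Type*} : ∀ {n : ℕ} {φ : L.BoundedFormula α n}, φ.IsExistential →
    BoundedFormula.IsExistential φ.exs
  | 0, _, h => h
  | _ + 1, φ, h => isExistential_exs (φ := φ.ex) h.ex

/-- Existential quantification over an arbitrary set of variables. -/
theorem exists_formula_realize_iff_exists {α J : Type*} (φ : L.Formula (α ⊕ J)) :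
    ∃ φ' : L.Formula α, (φ.IsQF → φ'.IsExistential) ∧
      ∀ (A : Type w) [Nonempty A] [L.Structure A] (x : α → A),
        φ'.Realize x ↔ ∃ y : J → A, φ.Realize (Sum.elim x y) := by
  classical
  let F : Finset J := φ.freeVarFinset.toRight
  -- Only the finitely many variables in `F` matter, so all others collapse to the single dummy
  -- variable `none` and the quantifier ranges over a finite type.
  let r : J → Option F := fun j => if h : j ∈ F then some ⟨j, h⟩ else none
  refine ⟨Formula.iExs (Option F) (φ.relabel (Sum.map id r)), fun h => ?_, ?_⟩
  · exact isExistential_exs (((h.relabel _).relabel _).isExistential)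
  · intro A _ _ x
    rw [Formula.realize_iExs]
    constructor
    · rintro ⟨y, hy⟩
      refine ⟨y ∘ r, ?_⟩
      rw [Formula.realize_relabel] at hy
      convert hy using 1
      ext (a | j) <;> rfl
    · rintro ⟨y, hy⟩
      refine ⟨fun o => o.elim (Classical.arbitrary A) fun j => y j.1, ?_⟩
      rw [Formula.realize_relabel]
      refine (realize_congr_of_freeVarFinset φ ?_).1 hy
      rintro (a | j) hj
      · rfl
      · have : j ∈ F := by simpa [F] using hj
        simp [r, this]

/-- A formula uses only finitely many variables. -/
theorem exists_fin_relabel {α J : Type*} (φ : L.Formula (α ⊕ J)) :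
    ∃ (n : ℕ) (φ' : L.Formula (Fin n ⊕ J)) (s : Fin n → α), (φ.IsQF → φ'.IsQF) ∧
      ∀ (A : Type w) [Nonempty A] [L.Structure A] (x : α → A) (y : J → A),
        φ'.Realize (Sum.elim (x ∘ s) y) ↔ φ.Realize (Sum.elim x y) := by
  classical
  rcases isEmpty_or_nonempty α with hα | ⟨⟨a₀⟩⟩
  · refine ⟨0, φ.relabel (Sum.map isEmptyElim id), finZeroElim, fun h => h.relabel _, ?_⟩
    intro A _ _ x y
    rw [Formula.realize_relabel]
    refine iff_of_eq (congrArg _ ?_)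
    ext (a | j)
    · exact isEmptyElim a
    · rfl
  -- Adding `a₀` makes `F` nonempty, so that variables that do not occur have somewhere to go.
  let F : Finset α := insert a₀ φ.freeVarFinset.toLeft
  let e := F.equivFin
  let r : α → Fin F.card := fun a => if h : a ∈ F then e ⟨a, h⟩ else
    e ⟨a₀, Finset.mem_insert_self _ _⟩
  refine ⟨F.card, φ.relabel (Sum.map r id), fun i => (e.symm i).1, fun h => h.relabel _, ?_⟩
  intro A _ _ x y
  rw [Formula.realize_relabel]
  refine realize_congr_of_freeVarFinset φ ?_
  rintro (a | j) hj
  · have : a ∈ F := Finset.mem_insert_of_mem (by simpa using hj)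
    simp [r, this]
  · rfl

/-- The existential formula in finitely many parameters that asserts the solvability of a
quantifier-free formula. -/
theorem exists_isExistential_realize_iff {α J : Type*} {q : L.Formula (α ⊕ J)} (hq : q.IsQF) :
    ∃ (n : ℕ) (φ : L.Formula (Fin n)) (s : Fin n → α), φ.IsExistential ∧
      ∀ (A : Type w) [Nonempty A] [L.Structure A] (x : α → A),
        φ.Realize (x ∘ s) ↔ ∃ y : J → A, q.Realize (Sum.elim x y) := by
  obtain ⟨n, q', s, h1, h2⟩ := exists_fin_relabel.{u, v, w} q
  obtain ⟨φ, h3, h4⟩ := exists_formula_realize_iff_exists.{u, v, w} q'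
  refine ⟨n, φ, s, h3 (h1 hq), fun A _ _ x => ?_⟩
  rw [h4]
  exact exists_congr fun y => h2 A x y

theorem isQF_toFormula {α : Type*} {n : ℕ} {φ : L.BoundedFormula α n} (h : φ.IsQF) :
    φ.toFormula.IsQF := by
  induction h with
  | falsum => exact BoundedFormula.isQF_bot
  | of_isAtomic h =>
    cases h with
    | equal t₁ t₂ => exact (BoundedFormula.IsAtomic.equal _ _).isQF
    | rel R ts => exact (BoundedFormula.IsAtomic.rel _ _).isQF
  | imp _ _ ih1 ih2 => exact ih1.imp ih2

/-- An existential formula asserts the solvability of a quantifier-free formula. -/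
theorem exists_isQF_of_isExistential {α : Type*} {l : ℕ} {φ : L.BoundedFormula α l}
    (h : φ.IsExistential) :
    ∃ q : L.Formula ((α ⊕ Fin l) ⊕ ℕ), q.IsQF ∧
      ∀ (A : Type w) [Nonempty A] [L.Structure A] (x : α → A) (xs : Fin l → A),
        φ.Realize x xs ↔ ∃ y : ℕ → A, q.Realize (Sum.elim (Sum.elim x xs) y) := by
  induction h with
  | of_isQF h =>
    rename_i φ
    refine ⟨φ.toFormula.relabel Sum.inl, (isQF_toFormula h).relabel _, fun A _ _ x xs => ?_⟩
    simp [Formula.realize_relabel, BoundedFormula.realize_toFormula]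
  | @ex n φ _ ih =>
    obtain ⟨q, hq, h⟩ := ih
    -- The newly quantified variable becomes witness `0`, and the earlier witnesses are shifted by
    -- one.
    let r : (α ⊕ Fin (n + 1)) ⊕ ℕ → (α ⊕ Fin n) ⊕ ℕ :=
      Sum.elim (Sum.elim (fun a => Sum.inl (Sum.inl a))
        (Fin.snoc (α := fun _ => (α ⊕ Fin n) ⊕ ℕ) (fun i => Sum.inl (Sum.inr i)) (Sum.inr 0)))
        fun i => Sum.inr (i + 1)
    refine ⟨q.relabel r, hq.relabel _, fun A _ _ x xs => ?_⟩
    have key : ∀ y : ℕ → A, Sum.elim (Sum.elim x xs) y ∘ r =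
        Sum.elim (Sum.elim x (Fin.snoc xs (y 0))) fun i => y (i + 1) := by
      intro y
      ext ((a | i) | i)
      · rfl
      · refine Fin.lastCases ?_ (fun i => ?_) i <;> simp [r]
      · rfl
    rw [BoundedFormula.realize_ex]
    simp only [h, Formula.realize_relabel, key]
    constructor
    · rintro ⟨a, y, hy⟩
      exact ⟨fun i => Nat.casesOn i a y, hy⟩
    · rintro ⟨y, hy⟩
      exact ⟨y 0, fun i => y (i + 1), hy⟩

end Formulas

/-! ### Ultrapowers and model completeness -/

section Ultrapower

variable {L : FirstOrder.Language.{u, v}}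

/-- The diagonal embedding into an ultrapower. -/
noncomputable def diagonal {M : Type*} [L.Structure M] [Nonempty M] {ι : Type*}
    (U : Ultrafilter ι) : M ↪ₑ[L] (U : Filter ι).Product fun _ => M where
  toFun m := ((fun _ => m : ι → M) : (U : Filter ι).Product fun _ => M)
  map_formula' _ φ x :=
    (Ultraproduct.realize_formula_cast φ fun i _ => x i).trans Filter.eventually_const

/-- An ultrafilter that contains the given sets. -/
theorem exists_ultrafilter {ι κ : Type*} (s : κ → Set ι)
    (h : ∀ F : Finset κ, ∃ i, ∀ k ∈ F, i ∈ s k) : ∃ U : Ultrafilter ι, ∀ k, s k ∈ U := by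
  classical
  have : (⨅ k, Filter.principal (s k)).NeBot := by
    rw [Filter.neBot_iff]
    intro hb
    have he : (∅ : Set ι) ∈ ⨅ k, Filter.principal (s k) := by simp [hb]
    rw [Filter.mem_iInf_finite'] at he
    obtain ⟨F, hF⟩ := he
    obtain ⟨i, hi⟩ := h (F.image PLift.down)
    rw [Filter.iInf_principal_finset, Filter.mem_principal] at hF
    refine hF (a := i) ?_
    simp only [Set.mem_iInter]
    exact fun k hk => hi k.down (Finset.mem_image_of_mem _ hk)
  obtain ⟨U, hU⟩ := Ultrafilter.exists_le (⨅ k, Filter.principal (s k))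
  exact ⟨U, fun k => Filter.le_principal_iff.1 (hU.trans (iInf_le _ k))⟩

/-- A map that preserves quantifier-free formulas is an embedding. -/
def embeddingOfQF {N A : Type*} [L.Structure N] [L.Structure A] (f : N → A)
    (h : ∀ δ : L.Formula N, δ.IsQF → δ.Realize id → δ.Realize f) : N ↪[L] A where
  toFun := f
  inj' x y hxy := by
    by_contra hne
    have := h (Term.equal (.var x) (.var y)).not (BoundedFormula.IsAtomic.equal _ _).isQF.not
      (by simpa using hne)
    simp [hxy] at this
  map_fun' {n} g xs := by
    have := h (Term.equal (.var (Structure.funMap g xs)) (.func g fun i => .var (xs i)))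
      (BoundedFormula.IsAtomic.equal _ _).isQF (by simp)
    rw [Formula.realize_equal] at this
    exact this
  map_rel' {n} R xs := by
    by_cases hR : Structure.RelMap R xs
    · have := h (R.formula fun i => .var (xs i)) (BoundedFormula.IsAtomic.rel _ _).isQF
        (by simpa [Formula.realize_rel] using hR)
      rw [Formula.realize_rel] at this
      exact ⟨fun _ => hR, fun _ => this⟩
    · have := h (R.formula fun i => .var (xs i)).not (BoundedFormula.IsAtomic.rel _ _).isQF.not
        (by simpa [Formula.realize_rel] using hR)
      rw [Formula.realize_not, Formula.realize_rel] at this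
      exact ⟨fun h => absurd h this, fun h => absurd h hR⟩

variable {T : L.Theory}

/-- Embeddings between models of a model complete theory are elementary. -/
def IsModelComplete.elementary (hT : IsModelComplete.{u, v, w} T) {M N : Type (max u v w)}
    [Nonempty M] [L.Structure M] [L.Structure N] [M ⊨ T] [N ⊨ T] (f : M ↪[L] N) : M ↪ₑ[L] N where
  toFun := f
  map_formula' n φ x := by
    have : Nonempty N := ‹Nonempty M›.map f
    exact hT M N f n φ x

/-- In a model complete theory, a formula that holds at a tuple is implied by a quantifier-free
formula that holds at an extended tuple. -/
theorem IsModelComplete.exists_isQF (hT : IsModelComplete.{u, v, w} T) {M N : Type (max u v w)}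
    [Nonempty M] [Nonempty N] [L.Structure M] [L.Structure N] [M ⊨ T] [N ⊨ T]
    (φ : L.Formula N) (hφ : φ.Realize id) :
    ∃ δ : L.Formula N, δ.IsQF ∧ δ.Realize id ∧ ∀ n : N → M, δ.Realize n → φ.Realize n := by
  classical
  by_contra! hcon
  let κ := {δ : L.Formula N // δ.IsQF ∧ δ.Realize (M := N) id}
  -- By `hcon`, any finite part of the quantifier-free diagram of `N` has an assignment in `M` at
  -- which `φ` fails. In the resulting ultrapower of `M` the generic assignment `f` embeds `N`, and
  -- this embedding is elementary by model completeness, so `φ` would have to hold at `f`.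
  obtain ⟨U, hU⟩ := exists_ultrafilter (ι := N → M) (κ := κ)
    (fun δ => {n | δ.1.Realize n ∧ ¬ φ.Realize n}) (fun F => by
      let δ : L.Formula N := BoundedFormula.iInf fun k : F => k.1.1
      obtain ⟨n, h1, h2⟩ := hcon δ (isQF_iInf fun k => k.1.2.1)
        (BoundedFormula.realize_iInf.2 fun k => k.1.2.2)
      have := BoundedFormula.realize_iInf.1 h1
      exact ⟨n, fun k hk => ⟨this ⟨k, hk⟩, h2⟩⟩)
  let A := (U : Filter (N → M)).Product fun _ => M
  let f : N → A := fun x => ((fun n => n x : (N → M) → M) : A)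
  have los : ∀ χ : L.Formula N, χ.Realize f ↔ ∀ᶠ n : N → M in U, χ.Realize n := fun χ =>
    Ultraproduct.realize_formula_cast χ fun (x : N) (n : N → M) => n x
  let f' : N ↪[L] A := embeddingOfQF f fun δ h1 h2 =>
    (los δ).2 (Filter.mem_of_superset (hU ⟨δ, h1, h2⟩) fun n hn => hn.1)
  have : A ⊨ T := ((diagonal U : M ↪ₑ[L] A).theory_model_iff T).1 inferInstance
  have h1 : φ.Realize f := ((hT.elementary f').map_formula φ id).2 hφ
  have h2 := (los φ).1 h1
  -- The trivial formula `⊤` is used only to extract that `φ` fails on a set in `U`.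
  have h3 := hU ⟨⊤, BoundedFormula.IsQF.top, by simp⟩
  obtain ⟨n, h4, h5⟩ := (h2.and h3).exists
  exact h5.2 h4

end Ultrapower

/-! ### Transfer of formulas with side conditions on `θ` -/

section Transfer

universe x

variable {L : FirstOrder.Language.{u, v}} {K : Type k} {d : ℕ}

theorem isQF_onFormula {L' : FirstOrder.Language} (g : L →ᴸ L') {α : Type*} {n : ℕ}
    {φ : L.BoundedFormula α n} (h : φ.IsQF) : (g.onBoundedFormula φ).IsQF := by
  induction h with
  | falsum => exact BoundedFormula.isQF_bot
  | of_isAtomic h =>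
    cases h with
    | equal t₁ t₂ => exact (BoundedFormula.IsAtomic.equal _ _).isQF
    | rel R ts => exact (BoundedFormula.IsAtomic.rel _ _).isQF
  | imp _ _ ih1 ih2 => exact ih1.imp ih2

/-- The reduct of an `L_θ`-embedding to `L`. -/
def embeddingReduct {M N : Type*} [L.Structure M] [(thetaLang d).Structure M] [L.Structure N]
    [(thetaLang d).Structure N] (e : M ↪[withTheta L d] N) : M ↪[L] N where
  toFun := e
  inj' := e.injective
  map_fun' f x := e.map_fun (Sum.inl f : (withTheta L d).Functions _) x
  map_rel' R x := e.map_rel (Sum.inl R : (withTheta L d).Relations _) x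

theorem thetaMap_comp {M N : Type*} [L.Structure M] [(thetaLang d).Structure M]
    [L.Structure N] [(thetaLang d).Structure N] (e : M ↪[withTheta L d] N) (x : Fin d → M) :
    thetaMap N (e ∘ x) = e ∘ thetaMap M x := by
  ext j
  exact (e.map_fun (Sum.inr (ThetaFunctions.coord j) : (withTheta L d).Functions _) x).symm

variable [Field K]

/-- An `L`-formula together with finitely many equations `θ(z) = w` between tuples of variables
can be solved in `M` if it can be solved in an extension that is a model of `T_θ^C`. -/
def HasTransfer (T : L.Theory) (Ω : VSFormulas L K d) (C : KernelConfig K)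
    (M : Type w) [L.Structure M] [(thetaLang d).Structure M] : Prop :=
  ∀ (N : Type w) [L.Structure N] [(thetaLang d).Structure N], IsModel T Ω C N →
    ∀ (e : M ↪[withTheta L d] N) (J : Type x) (Φ : L.Formula (M ⊕ J))
      (E : Finset ((Fin d → M ⊕ J) × (Fin d → M ⊕ J))) (y : J → N),
      Φ.Realize (Sum.elim e y) →
      (∀ p ∈ E, thetaMap N (Sum.elim e y ∘ p.1) = Sum.elim e y ∘ p.2) →
      ∃ y' : J → M, Φ.Realize (Sum.elim id y') ∧
        ∀ p ∈ E, thetaMap M (Sum.elim id y' ∘ p.1) = Sum.elim id y' ∘ p.2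

/-- Although `Φ` is arbitrary, model completeness yields a quantifier-free `δ`, true in `N`, that
implies `Φ` in `M`. Solvability of `δ` together with the `θ`-equations is existential. -/
theorem IsExistentiallyClosed.hasTransfer {T : L.Theory} (hT : IsModelComplete.{u, v, w} T)
    {Ω : VSFormulas L K d} {C : KernelConfig K} {M : Type (max u v w)} [Nonempty M]
    [L.Structure M] [(thetaLang d).Structure M] (hM : M ⊨ T)
    (h : IsExistentiallyClosed T Ω C M) : HasTransfer.{u, v, max u v w, k, x} T Ω C M := by
  classical
  intro N _ _ hN e J Φ E y hΦ hE
  have := hN.model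
  have : Nonempty N := ‹Nonempty M›.map e
  obtain ⟨δ, hδ, hδN, hδM⟩ := hT.exists_isQF (M := M) (N := N) (Φ.relabel (Sum.elim e y))
    (by rwa [Formula.realize_relabel])
  let r : M ⊕ J → M ⊕ N := Sum.map id y
  let q₁ : (withTheta L d).Formula (M ⊕ N) := (LHom.sumInl.onFormula δ).relabel Sum.inr
  let q₂ : (withTheta L d).Formula (M ⊕ N) :=
    -- In `δ` the parameters from `M` are variables like all other elements of `N`. This conjunct
    -- pins the finitely many that occur in `Φ` to their actual values.
    BoundedFormula.iInf fun m : Φ.freeVarFinset.toLeft =>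
      Term.equal (.var (Sum.inr (e m.1))) (.var (Sum.inl m.1))
  let q₃ : (withTheta L d).Formula (M ⊕ N) :=
    BoundedFormula.iInf fun p : E × Fin d =>
      Term.equal (.func (Sum.inr (ThetaFunctions.coord p.2) : (withTheta L d).Functions _)
        fun i => .var (r (p.1.1.1 i))) (.var (r (p.1.1.2 p.2)))
  have hq : (q₁ ⊓ q₂ ⊓ q₃).IsQF := by
    refine (((isQF_onFormula _ hδ).relabel _).inf (isQF_iInf fun _ => ?_)).inf
      (isQF_iInf fun _ => ?_)
    · exact (BoundedFormula.IsAtomic.equal _ _).isQF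
    · exact (BoundedFormula.IsAtomic.equal _ _).isQF
  have key : ∀ (A : Type (max u v w)) [L.Structure A] [(thetaLang d).Structure A] (f : M → A)
      (n : N → A), Formula.Realize (q₁ ⊓ q₂ ⊓ q₃) (Sum.elim f n) ↔
        (δ.Realize n ∧ ∀ m ∈ Φ.freeVarFinset.toLeft, n (e m) = f m) ∧
        ∀ p ∈ E, thetaMap A (Sum.elim f n ∘ r ∘ p.1) = Sum.elim f n ∘ r ∘ p.2 := by
    intro A _ _ f n
    rw [Formula.realize_inf, Formula.realize_inf]
    refine and_congr (and_congr ?_ ?_) ?_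
    · simp only [q₁, Formula.realize_relabel, Sum.elim_comp_inr]
      exact LHom.realize_onFormula _ δ
    · refine BoundedFormula.realize_iInf.trans ?_
      simp only [Subtype.forall]
      refine forall₂_congr fun m _ => ?_
      exact Formula.realize_equal
    · refine BoundedFormula.realize_iInf.trans ?_
      simp only [Prod.forall, Subtype.forall, funext_iff]
      refine forall₃_congr fun z w _ => forall_congr' fun j => ?_
      exact Formula.realize_equal
  obtain ⟨n, φ, s, hφ, hφA⟩ := exists_isExistential_realize_iff.{u, v, max u v w} hq
  have hN' : φ.Realize (e ∘ s) := by
    refine (hφA N e).2 ⟨id, (key N e id).2 ⟨⟨hδN, fun _ _ => rfl⟩, fun p hp => ?_⟩⟩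
    have : Sum.elim (⇑e) id ∘ r = Sum.elim e y := by ext (a | a) <;> rfl
    rw [← Function.comp_assoc, ← Function.comp_assoc, this]
    exact hE p hp
  obtain ⟨f, hf⟩ := (hφA M id).1 (h N hN e n φ s hφ hN')
  obtain ⟨⟨h1, h2⟩, h3⟩ := (key M id f).1 hf
  refine ⟨f ∘ y, ?_, fun p hp => ?_⟩
  · have h4 := hδM f h1
    rw [Formula.realize_relabel] at h4
    refine (realize_congr_of_freeVarFinset Φ ?_).1 h4
    rintro (m | j) hm
    · exact h2 m (by simpa using hm)
    · rfl
  · have : Sum.elim id f ∘ r = Sum.elim id (f ∘ y) := by ext (a | a) <;> rfl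
    have h4 := h3 p hp
    rwa [← Function.comp_assoc, ← Function.comp_assoc, this] at h4

/-- `y` satisfies the equations `θ(z) = w` in `E`. -/
def SatisfiesTheta {A : Type*} [(thetaLang d).Structure A] {J : Type*}
    (E : Finset ((Fin d → J) × (Fin d → J))) (y : J → A) : Prop :=
  ∀ p ∈ E, thetaMap A (y ∘ p.1) = y ∘ p.2

theorem SatisfiesTheta.mono {A : Type*} [(thetaLang d).Structure A] {J : Type*}
    {E E' : Finset ((Fin d → J) × (Fin d → J))} {y : J → A} (h : SatisfiesTheta E y)
    (hE : E' ⊆ E) : SatisfiesTheta E' y :=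
  fun p hp => h p (hE hp)

/-- Finitely many conditions, valid for the values of all terms, that force the value of `t`. -/
theorem exists_flatten_term {β : Type*} (t : (withTheta L d).Term β) :
    ∃ (Φ : L.Formula ((withTheta L d).Term β))
      (E : Finset ((Fin d → (withTheta L d).Term β) × (Fin d → (withTheta L d).Term β))),
      (∀ (A : Type w) [L.Structure A] [(thetaLang d).Structure A] (x : β → A),
        Φ.Realize (fun t => t.realize x) ∧
          SatisfiesTheta E fun t : (withTheta L d).Term β => t.realize x) ∧
      ∀ (A : Type w) [L.Structure A] [(thetaLang d).Structure A]
        (y : (withTheta L d).Term β → A), Φ.Realize y → SatisfiesTheta E y →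
          y t = t.realize (y ∘ Term.var) := by
  classical
  induction t with
  | var b => exact ⟨⊤, ∅, fun A _ _ x => ⟨by simp, by simp [SatisfiesTheta]⟩, fun A _ _ y _ _ => rfl⟩
  | @func n f ts ih =>
    choose Φ E h1 h2 using ih
    cases f with
    | inl f =>
      refine ⟨BoundedFormula.iInf Φ ⊓ Term.equal (.var (.func (Sum.inl f) ts))
        (.func f fun i => .var (ts i)), Finset.univ.biUnion E, fun A _ _ x => ⟨?_, ?_⟩,
        fun A _ _ y hy hE => ?_⟩
      · rw [Formula.realize_inf, Formula.realize_equal]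
        exact ⟨BoundedFormula.realize_iInf.2 fun i => (h1 i A x).1, rfl⟩
      · intro p hp
        obtain ⟨i, -, hi⟩ := Finset.mem_biUnion.1 hp
        exact (h1 i A x).2 p hi
      · rw [Formula.realize_inf, Formula.realize_equal] at hy
        obtain ⟨hy1, hy2⟩ := hy
        have hy3 := BoundedFormula.realize_iInf.1 hy1
        have h4 : ∀ i, y (ts i) = (ts i).realize (y ∘ Term.var) := fun i =>
          h2 i A y (hy3 i) (hE.mono (Finset.subset_biUnion_of_mem E (Finset.mem_univ i)))
        refine hy2.trans ?_
        change Structure.funMap f (fun i => y (ts i)) = Structure.funMap f _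
        simp only [h4]
    | inr f =>
      cases f with
      | coord j =>
        -- Conditions on `θ` are equations between whole `d`-tuples, so all coordinates of `θ(ts)`
        -- are named, although only coordinate `j` is needed.
        refine ⟨BoundedFormula.iInf Φ, insert (ts, fun k =>
          .func (Sum.inr (ThetaFunctions.coord k) : (withTheta L d).Functions _) ts)
          (Finset.univ.biUnion E), fun A _ _ x => ⟨?_, ?_⟩, fun A _ _ y hy hE => ?_⟩
        · exact BoundedFormula.realize_iInf.2 fun i => (h1 i A x).1
        · intro p hp
          rcases Finset.mem_insert.1 hp with rfl | hp
          · rfl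
          · obtain ⟨i, -, hi⟩ := Finset.mem_biUnion.1 hp
            exact (h1 i A x).2 p hi
        · have hy3 := BoundedFormula.realize_iInf.1 hy
          have h4 : ∀ i, y (ts i) = (ts i).realize (y ∘ Term.var) := fun i =>
            h2 i A y (hy3 i) (hE.mono ((Finset.subset_biUnion_of_mem E (Finset.mem_univ i)).trans
              (Finset.subset_insert _ _)))
          have h5 := congrFun (hE _ (Finset.mem_insert_self _ _)) j
          refine h5.symm.trans ?_
          change thetaMap A (fun i => y (ts i)) j = thetaMap A _ j
          simp only [h4]

/-- A quantifier-free `L_θ`-formula is equivalent to an `L`-formula in the values of all terms,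
subject to finitely many conditions. -/
theorem exists_flatten_formula {β : Type*} {n : ℕ} {q : (withTheta L d).BoundedFormula β n}
    (hq : q.IsQF) :
    ∃ (Φ Ψ : L.Formula ((withTheta L d).Term (β ⊕ Fin n)))
      (E : Finset ((Fin d → (withTheta L d).Term (β ⊕ Fin n)) ×
        (Fin d → (withTheta L d).Term (β ⊕ Fin n)))),
      (∀ (A : Type w) [L.Structure A] [(thetaLang d).Structure A] (x : β ⊕ Fin n → A),
        Φ.Realize (fun t => t.realize x) ∧
          SatisfiesTheta E fun t : (withTheta L d).Term (β ⊕ Fin n) => t.realize x) ∧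
      ∀ (A : Type w) [L.Structure A] [(thetaLang d).Structure A]
        (y : (withTheta L d).Term (β ⊕ Fin n) → A), Φ.Realize y → SatisfiesTheta E y →
          (q.Realize (fun b => y (.var (Sum.inl b))) (fun i => y (.var (Sum.inr i))) ↔
            Ψ.Realize y) := by
  classical
  have hvar : ∀ (A : Type w) (y : (withTheta L d).Term (β ⊕ Fin n) → A),
      Sum.elim (fun b => y (.var (Sum.inl b))) (fun i => y (.var (Sum.inr i))) =
        y ∘ Term.var := by
    intro A y
    ext (b | i) <;> rfl
  induction hq with
  | falsum => exact ⟨⊤, ⊥, ∅, fun A _ _ x => ⟨by simp, by simp [SatisfiesTheta]⟩,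
      fun A _ _ y _ _ => Iff.rfl⟩
  | of_isAtomic h =>
    cases h with
    | equal t₁ t₂ =>
      obtain ⟨Φ₁, E₁, h1, h2⟩ := exists_flatten_term t₁
      obtain ⟨Φ₂, E₂, h3, h4⟩ := exists_flatten_term t₂
      refine ⟨Φ₁ ⊓ Φ₂, Term.equal (.var t₁) (.var t₂), E₁ ∪ E₂, fun A _ _ x => ⟨?_, ?_⟩,
        fun A _ _ y hy hE => ?_⟩
      · exact Formula.realize_inf.2 ⟨(h1 A x).1, (h3 A x).1⟩
      · intro p hp
        rcases Finset.mem_union.1 hp with hp | hp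
        exacts [(h1 A x).2 p hp, (h3 A x).2 p hp]
      · have hy' := Formula.realize_inf.1 hy
        rw [BoundedFormula.realize_bdEqual, hvar,
          ← h2 A y hy'.1 (hE.mono Finset.subset_union_left),
          ← h4 A y hy'.2 (hE.mono Finset.subset_union_right), Formula.realize_equal]
        rfl
    | rel R ts =>
      cases R with
      | inr R => exact R.elim
      | inl R =>
        choose Φ E h1 h2 using fun i => exists_flatten_term (ts i)
        refine ⟨BoundedFormula.iInf Φ, R.formula fun i => .var (ts i), Finset.univ.biUnion E,
          fun A _ _ x => ⟨?_, ?_⟩, fun A _ _ y hy hE => ?_⟩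
        · exact BoundedFormula.realize_iInf.2 fun i => (h1 i A x).1
        · intro p hp
          obtain ⟨i, -, hi⟩ := Finset.mem_biUnion.1 hp
          exact (h1 i A x).2 p hi
        · have hy3 := BoundedFormula.realize_iInf.1 hy
          have h4 : ∀ i, y (ts i) = (ts i).realize (y ∘ Term.var) := fun i =>
            h2 i A y (hy3 i) (hE.mono (Finset.subset_biUnion_of_mem E (Finset.mem_univ i)))
          refine (BoundedFormula.realize_rel (L := withTheta L d)).trans ?_
          rw [hvar, Formula.realize_rel]
          simp only [Term.realize_var, h4]
          rfl
  | imp _ _ ih1 ih2 =>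
    obtain ⟨Φ₁, Ψ₁, E₁, h1, h2⟩ := ih1
    obtain ⟨Φ₂, Ψ₂, E₂, h3, h4⟩ := ih2
    refine ⟨Φ₁ ⊓ Φ₂, Ψ₁.imp Ψ₂, E₁ ∪ E₂, fun A _ _ x => ⟨?_, ?_⟩,
      fun A _ _ y hy hE => ?_⟩
    · exact Formula.realize_inf.2 ⟨(h1 A x).1, (h3 A x).1⟩
    · intro p hp
      rcases Finset.mem_union.1 hp with hp | hp
      exacts [(h1 A x).2 p hp, (h3 A x).2 p hp]
    · have hy' := Formula.realize_inf.1 hy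
      rw [BoundedFormula.realize_imp, h2 A y hy'.1 (hE.mono Finset.subset_union_left),
        h4 A y hy'.2 (hE.mono Finset.subset_union_right)]
      exact Formula.realize_imp.symm

/-- The unknowns are the values of all `L_θ`-terms, which is why the index type lives in universe
`u`. Transfer returns values that obey the flattening conditions, so they agree with the true terms
where it matters. -/
theorem HasTransfer.isExistentiallyClosed {T : L.Theory} {Ω : VSFormulas L K d}
    {C : KernelConfig K} {M : Type w} [Nonempty M] [L.Structure M]
    [(thetaLang d).Structure M] (h : HasTransfer.{u, v, w, k, u} T Ω C M) :
    IsExistentiallyClosed T Ω C M := by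
  classical
  intro N _ _ hN e n φ a hφ hN'
  have : Nonempty N := ‹Nonempty M›.map e
  obtain ⟨q, hq, hqA⟩ := exists_isQF_of_isExistential.{u, v, w} hφ
  obtain ⟨Φ, Ψ, E, h1, h2⟩ := exists_flatten_formula.{u, v, w} hq
  obtain ⟨y, hy⟩ := (hqA N _ _).1 hN'
  let Tm := (withTheta L d).Term (((Fin n ⊕ Fin 0) ⊕ ℕ) ⊕ Fin 0)
  let x : ((Fin n ⊕ Fin 0) ⊕ ℕ) ⊕ Fin 0 → N :=
    Sum.elim (Sum.elim (Sum.elim (e ∘ a) default) y) default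
  -- The variables of the original formula are replaced by the parameters `a`; every other term
  -- remains an unknown.
  let r : Tm → M ⊕ Tm := fun t => match t with
    | .var (Sum.inl (Sum.inl (Sum.inl i))) => Sum.inl (a i)
    | t => Sum.inr t
  have hr : Sum.elim e (fun t : Tm => t.realize x) ∘ r = fun t : Tm => t.realize x := by
    ext t
    rcases t with ((((i | i) | i) | i) | f) <;> rfl
  obtain ⟨y', hy1, hy2⟩ := h N hN e Tm ((Φ ⊓ Ψ).relabel r)
    (E.image fun p => (r ∘ p.1, r ∘ p.2)) (fun t => t.realize x) (by
      rw [Formula.realize_relabel, hr]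
      exact Formula.realize_inf.2 ⟨(h1 N x).1,
        (h2 N _ (h1 N x).1 (h1 N x).2).1 hy⟩) (by
      intro p hp
      obtain ⟨p, hp', rfl⟩ := Finset.mem_image.1 hp
      simp only [← Function.comp_assoc, hr]
      exact (h1 N x).2 p hp')
  rw [Formula.realize_relabel] at hy1
  have hy3 := Formula.realize_inf.1 hy1
  have hE : SatisfiesTheta E (Sum.elim id y' ∘ r) := fun p hp =>
    hy2 _ (Finset.mem_image_of_mem _ hp)
  have h5 := (h2 M _ hy3.1 hE).2 hy3.2
  refine (hqA M a default).2 ⟨fun i => y' (.var (Sum.inl (Sum.inr i))), ?_⟩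
  have : (fun b => (Sum.elim id y' ∘ r) (Term.var (Sum.inl b))) =
      Sum.elim (Sum.elim a default) fun i => y' (.var (Sum.inl (Sum.inr i))) := by
    ext ((i | i) | i)
    · rfl
    · exact i.elim0
    · rfl
  rw [this] at h5
  have hd : (fun i : Fin 0 => (Sum.elim id y' ∘ r) (Term.var (Sum.inr i))) = default :=
    Subsingleton.elim _ _
  rw [hd] at h5
  exact h5

end Transfer

/-! ### Definable vector spaces and elementary embeddings -/

section VectorSpace

universe x

variable {L : FirstOrder.Language.{u, v}} {K : Type k} {d : ℕ} [Field K] (Ω : VSFormulas L K d)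

namespace VSFormulas

section

variable (A : Type*) [L.Structure A] [h : Ω.IsVectorSpace A]

theorem nontrivial_carrier : Nontrivial (Ω.carrier A) :=
  h.out.choose_spec.choose_spec.1

variable {A}

theorem realize_zero_iff (x : Ω.carrier A) : Ω.zero.Realize x.1 ↔ x = 0 :=
  h.out.choose_spec.choose_spec.2.1 x

theorem realize_add_iff (x y z : Ω.carrier A) :
    Ω.add.Realize (Sum.elim x.1 (Sum.elim y.1 z.1)) ↔ x + y = z :=
  h.out.choose_spec.choose_spec.2.2.1 x y z

theorem realize_smul_iff (a : K) (x y : Ω.carrier A) :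
    (Ω.smul a).Realize (Sum.elim x.1 y.1) ↔ a • x = y :=
  h.out.choose_spec.choose_spec.2.2.2 a x y

end

/-- The coordinates of a family of vectors. -/
def coords {A : Type*} [L.Structure A] {I : Type*} (b : I → Ω.carrier A) (p : I × Fin d) : A :=
  (b p.1).1 p.2

/-- Equality of a linear combination of vectors with a given vector is definable. -/
theorem exists_formula_sum_smul_eq {I : Type*} (s : Finset I) (a : I → K) :
    ∃ χ : L.Formula ((I ⊕ Unit) × Fin d), ∀ (A : Type w) [L.Structure A] [Ω.IsVectorSpace A]
      (b : I → Ω.carrier A) (t : Ω.carrier A),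
      χ.Realize (Ω.coords (Sum.elim b fun _ => t)) ↔ ∑ i ∈ s, a i • b i = t := by
  classical
  induction s using Finset.induction_on with
  | empty =>
    refine ⟨Ω.zero.relabel fun j => (Sum.inr (), j), fun A _ _ b t => ?_⟩
    rw [Formula.realize_relabel, Finset.sum_empty, eq_comm, ← Ω.realize_zero_iff]
    rfl
  | insert i s hi ih =>
    obtain ⟨χ, hχ⟩ := ih
    let ρ : (I ⊕ Unit) × Fin d → ((I ⊕ Unit) × Fin d) ⊕ (Bool × Fin d) := fun p =>
      Sum.elim (fun i => Sum.inl (Sum.inl i, p.2)) (fun _ => Sum.inr (false, p.2)) p.1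
    -- The auxiliary vector `true` stands for `a i • b i`, and `false` for the sum over `s`.
    let Φ : L.Formula (((I ⊕ Unit) × Fin d) ⊕ (Bool × Fin d)) :=
      (Ω.dom.relabel fun j => Sum.inr (true, j)) ⊓ (Ω.dom.relabel fun j => Sum.inr (false, j)) ⊓
      ((Ω.smul (a i)).relabel
        (Sum.elim (fun j => Sum.inl (Sum.inl i, j)) fun j => Sum.inr (true, j))) ⊓
      χ.relabel ρ ⊓
      Ω.add.relabel (Sum.elim (fun j => Sum.inr (true, j))
        (Sum.elim (fun j => Sum.inr (false, j)) fun j => Sum.inl (Sum.inr (), j)))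
    have key : ∀ (A : Type w) [L.Structure A] [Ω.IsVectorSpace A] (b : I → Ω.carrier A)
        (t u w : Ω.carrier A), Φ.Realize (Sum.elim (Ω.coords (Sum.elim b fun _ => t))
          fun p => bif p.1 then u.1 p.2 else w.1 p.2) ↔
          a i • b i = u ∧ ∑ i ∈ s, a i • b i = w ∧ u + w = t := by
      intro A _ _ b t u w
      simp only [Φ, Formula.realize_inf, Formula.realize_relabel]
      rw [← Ω.realize_smul_iff, ← hχ, ← Ω.realize_add_iff]
      have h1 : ∀ f : ((I ⊕ Unit) × Fin d) ⊕ (Bool × Fin d) → A,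
          f ∘ ρ = fun p => Sum.elim (fun i => f (Sum.inl (Sum.inl i, p.2)))
            (fun _ => f (Sum.inr (false, p.2))) p.1 := by
        intro f; ext ⟨(i | _), j⟩ <;> rfl
      have h2 : ∀ v : Ω.carrier A, Ω.dom.Realize v.1 := fun v => v.2
      simp only [h1, Sum.comp_elim]
      have h3 : (fun p : (I ⊕ Unit) × Fin d => Sum.elim (fun i => (b i).1 p.2)
            (fun _ => w.1 p.2) p.1) = Ω.coords (Sum.elim b fun _ => w) := by
        ext ⟨(i | _), j⟩ <;> rfl
      constructor
      · rintro ⟨⟨⟨-, h4⟩, h5⟩, h6⟩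
        exact ⟨h4, h3 ▸ h5, h6⟩
      · rintro ⟨h4, h5, h6⟩
        exact ⟨⟨⟨⟨h2 u, h2 w⟩, h4⟩, h3.symm ▸ h5⟩, h6⟩
    refine ⟨Φ.iExs (Bool × Fin d), fun A _ _ b t => ?_⟩
    rw [Formula.realize_iExs, Finset.sum_insert hi]
    constructor
    · rintro ⟨y, hy⟩
      have hy' := hy
      simp only [Φ, Formula.realize_inf, Formula.realize_relabel] at hy'
      let u : Ω.carrier A := ⟨fun j => y (true, j), hy'.1.1.1.1⟩
      let w : Ω.carrier A := ⟨fun j => y (false, j), hy'.1.1.1.2⟩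
      have : y = fun p => bif p.1 then u.1 p.2 else w.1 p.2 := by
        ext ⟨(_ | _), j⟩ <;> rfl
      rw [this, key] at hy
      rw [hy.1, hy.2.1, hy.2.2]
    · intro h
      exact ⟨_, (key A b t _ _).2 ⟨rfl, rfl, h⟩⟩

variable {M N : Type*} [L.Structure M] [L.Structure N]

omit [Field K] in
theorem comp_mem_carrier_iff (e : M ↪ₑ[L] N) {x : Fin d → M} :
    e ∘ x ∈ Ω.carrier N ↔ x ∈ Ω.carrier M :=
  e.map_formula Ω.dom x

variable [Ω.IsVectorSpace M] [Ω.IsVectorSpace N]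

/-- The linear map between the definable vector spaces induced by an elementary embedding. -/
noncomputable def map (e : M ↪ₑ[L] N) : Ω.carrier M →ₗ[K] Ω.carrier N where
  toFun x := ⟨e ∘ x.1, (Ω.comp_mem_carrier_iff e).2 x.2⟩
  map_add' x y := by
    rw [eq_comm, ← Ω.realize_add_iff]
    have := (e.map_formula Ω.add _).2 ((Ω.realize_add_iff x y _).2 rfl)
    simpa only [Sum.comp_elim] using this
  map_smul' a x := by
    rw [eq_comm, RingHom.id_apply, ← Ω.realize_smul_iff]
    have := (e.map_formula (Ω.smul a) _).2 ((Ω.realize_smul_iff a x _).2 rfl)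
    simpa only [Sum.comp_elim] using this

@[simp]
theorem coe_map (e : M ↪ₑ[L] N) (x : Ω.carrier M) : (Ω.map e x).1 = e ∘ x.1 := rfl

theorem map_injective (e : M ↪ₑ[L] N) : Function.Injective (Ω.map e) := by
  intro x y h
  have : e ∘ x.1 = e ∘ y.1 := congrArg Subtype.val h
  exact Subtype.ext (e.injective.comp_left this)

end VSFormulas

section Endo

variable {A : Type*} [L.Structure A] [(thetaLang d).Structure A] [Ω.IsVectorSpace A]

section

variable [h : Ω.IsEndo A]

theorem thetaMap_coe (x : Ω.carrier A) : thetaMap A x.1 = (Ω.endo A x).1 :=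
  h.out.choose_spec.1 x

theorem thetaMap_of_notMem {x : Fin d → A} (hx : x ∉ Ω.carrier A) :
    thetaMap A x = (0 : Ω.carrier A).1 :=
  h.out.choose_spec.2 x hx

end

theorem endo_map {M N : Type*} [L.Structure M] [L.Structure N] [(thetaLang d).Structure M]
    [(thetaLang d).Structure N] [Ω.IsVectorSpace M] [Ω.IsVectorSpace N] [Ω.IsEndo M] [Ω.IsEndo N]
    (e : M ↪[withTheta L d] N) (e' : M ↪ₑ[L] N) (he : ⇑e' = e) (x : Ω.carrier M) :
    Ω.endo N (Ω.map e' x) = Ω.map e' (Ω.endo M x) := by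
  apply Subtype.ext
  rw [← thetaMap_coe, VSFormulas.coe_map, VSFormulas.coe_map, ← thetaMap_coe, he, thetaMap_comp]

end Endo

/-- Coordinates of vectors, obtained from tuples by replacing those outside of the space. -/
theorem exists_vectors {A : Type*} [L.Structure A] [Ω.IsVectorSpace A] {I : Type*}
    (y : I × Fin d → A) : ∃ b : I → Ω.carrier A, ∀ i, (fun j => y (i, j)) ∈ Ω.carrier A →
      ∀ j, (b i).1 j = y (i, j) := by
  classical
  refine ⟨fun i => if h : (fun j => y (i, j)) ∈ Ω.carrier A then ⟨_, h⟩ else 0, fun i hi j => ?_⟩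
  simp [hi]

/-- The formula that says that certain variables are coordinates of vectors. -/
noncomputable def domFormula (M : Type*) {I : Type*} (F : Finset I) : L.Formula (M ⊕ I × Fin d) :=
  BoundedFormula.iInf fun i : F => Ω.dom.relabel fun j => Sum.inr (i.1, j)

omit [Field K] in
theorem realize_domFormula {M : Type*} {A : Type*} [L.Structure A] {I : Type*} (F : Finset I)
    (x : M → A) (y : I × Fin d → A) :
    (domFormula Ω M F).Realize (Sum.elim x y) ↔
      ∀ i ∈ F, (fun j => y (i, j)) ∈ Ω.carrier A := by
  refine BoundedFormula.realize_iInf.trans ?_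
  simp only [Subtype.forall]
  refine forall₂_congr fun i _ => ?_
  exact Formula.realize_relabel

/-- The indices of the vectors that occur in a formula. -/
noncomputable def occurring {M : Type*} {I : Type*} (Φ : L.Formula (M ⊕ I × Fin d)) : Finset I := by
  classical
  exact Φ.freeVarFinset.toRight.image Prod.fst

theorem realize_congr_of_occurring {M : Type*} {A : Type*} [L.Structure A] {I : Type*}
    (Φ : L.Formula (M ⊕ I × Fin d)) (x : M → A) {y y' : I × Fin d → A}
    (h : ∀ i ∈ occurring Φ, ∀ j, y (i, j) = y' (i, j)) :
    Φ.Realize (Sum.elim x y) ↔ Φ.Realize (Sum.elim x y') := by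
  classical
  refine realize_congr_of_freeVarFinset Φ ?_
  rintro (m | ⟨i, j⟩) hp
  · rfl
  · exact h i (Finset.mem_image_of_mem _ (a := (i, j)) (by simpa using hp)) j

/-- A formula about vectors that can be solved in an elementary extension can be solved. -/
theorem exists_vectors_of_elementary {M N : Type w} [Nonempty M] [L.Structure M] [L.Structure N]
    [Ω.IsVectorSpace M] [Ω.IsVectorSpace N] (e : M ↪ₑ[L] N) {I : Type x}
    (Φ : L.Formula (M ⊕ I × Fin d)) (b : I → Ω.carrier N)
    (h : Φ.Realize (Sum.elim e (Ω.coords b))) :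
    ∃ b' : I → Ω.carrier M, Φ.Realize (Sum.elim id (Ω.coords b')) := by
  have : Nonempty N := ‹Nonempty M›.map e
  obtain ⟨Φ', -, hΦ'⟩ := exists_formula_realize_iff_exists.{u, v, w}
    (Φ ⊓ domFormula Ω M (occurring Φ))
  have h1 : Φ'.Realize (e ∘ id) := by
    refine (hΦ' N _).2 ⟨_, Formula.realize_inf.2 ⟨h, ?_⟩⟩
    exact (realize_domFormula Ω _ _ _).2 fun i _ => (b i).2
  obtain ⟨y, hy⟩ := (hΦ' M _).1 ((e.map_formula Φ' id).1 h1)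
  obtain ⟨hy1, hy2⟩ := Formula.realize_inf.1 hy
  rw [realize_domFormula] at hy2
  obtain ⟨b', hb'⟩ := exists_vectors Ω y
  exact ⟨b', (realize_congr_of_occurring Φ id fun i hi j => hb' i (hy2 i hi) j).2 hy1⟩

/-- The transfer property, for vectors. -/
theorem HasTransfer.exists_vectors {T : L.Theory} {Ω : VSFormulas L K d} {C : KernelConfig K}
    {M : Type w} [L.Structure M] [(thetaLang d).Structure M] [Ω.IsVectorSpace M] [Ω.IsEndo M]
    (hM : HasTransfer.{u, v, w, k, x} T Ω C M) {N : Type w} [L.Structure N]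
    [(thetaLang d).Structure N] [Ω.IsVectorSpace N] [Ω.IsEndo N] (hN : IsModel T Ω C N)
    (e : M ↪[withTheta L d] N) {I : Type x} (Φ : L.Formula (M ⊕ I × Fin d))
    (E : Finset (I × I)) (b : I → Ω.carrier N) (h : Φ.Realize (Sum.elim e (Ω.coords b)))
    (hE : ∀ p ∈ E, Ω.endo N (b p.1) = b p.2) :
    ∃ b' : I → Ω.carrier M, Φ.Realize (Sum.elim id (Ω.coords b')) ∧
      ∀ p ∈ E, Ω.endo M (b' p.1) = b' p.2 := by
  classical
  -- A formula can force only finitely many tuples to be vectors; those occurring in `Φ` or `E`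
  -- suffice.
  let F : Finset I := occurring Φ ∪ (E.image Prod.fst ∪ E.image Prod.snd)
  obtain ⟨y, hy, hyE⟩ := hM N hN e (I × Fin d) (Φ ⊓ domFormula Ω M F)
    (E.image fun p => (fun j => Sum.inr (p.1, j), fun j => Sum.inr (p.2, j))) (Ω.coords b)
    (Formula.realize_inf.2 ⟨h, (realize_domFormula Ω _ _ _).2 fun i _ => (b i).2⟩) (by
      intro p hp
      obtain ⟨p, hp', rfl⟩ := Finset.mem_image.1 hp
      exact (thetaMap_coe Ω (b p.1)).trans (congrArg Subtype.val (hE p hp')))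
  obtain ⟨hy1, hy2⟩ := Formula.realize_inf.1 hy
  rw [realize_domFormula] at hy2
  obtain ⟨b', hb'⟩ := GenericEndo.exists_vectors Ω y
  refine ⟨b', (realize_congr_of_occurring Φ id fun i hi j =>
    hb' i (hy2 i (Finset.mem_union_left _ hi)) j).2 hy1, fun p hp => Subtype.ext ?_⟩
  have h1 : p.1 ∈ F := Finset.mem_union_right _ (Finset.mem_union_left _
    (Finset.mem_image_of_mem _ hp))
  have h2 : p.2 ∈ F := Finset.mem_union_right _ (Finset.mem_union_right _
    (Finset.mem_image_of_mem _ hp))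
  have h3 : ∀ i ∈ F, (b' i).1 = fun j => y (i, j) := fun i hi => funext (hb' i (hy2 i hi))
  rw [← thetaMap_coe, h3 _ h1, h3 _ h2]
  exact hyE _ (Finset.mem_image_of_mem _ hp)

end VectorSpace

/-! ### Avoiding linear equations -/

section Avoid

variable {K : Type k} [Field K] {V : Type*} [AddCommGroup V] [Module K V] [Infinite V]

/-- Finitely many nontrivial linear equations do not cover the space of all families of vectors. -/
theorem exists_forall_sum_ne {I : Type*} (D : Finset ((I →₀ K) × V)) (hD : ∀ e ∈ D, e.1 ≠ 0) :
    ∃ b : I → V, ∀ e ∈ D, (e.1.sum fun i a => a • b i) ≠ e.2 := by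
  classical
  by_contra! hcon
  let ℓ : (I →₀ K) → (I → V) →ₗ[K] V := fun a =>
    a.sum fun i c => c • (LinearMap.proj i : (I → V) →ₗ[K] V)
  have hℓ : ∀ a b, ℓ a b = a.sum fun i c => c • b i := by
    intro a b
    simp [ℓ, Finsupp.sum, LinearMap.sum_apply]
  have hsurj : ∀ a, a ≠ 0 → Function.Surjective (ℓ a) := by
    intro a ha v
    obtain ⟨i, hi⟩ := Finsupp.ne_iff.1 ha
    refine ⟨Pi.single i ((a i)⁻¹ • v), ?_⟩
    rw [hℓ, Finsupp.sum, Finset.sum_eq_single i]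
    · simpa using smul_inv_smul₀ hi v
    · intro j _ hj
      simp [hj]
    · intro h
      simp [Finsupp.notMem_support_iff.1 h]
  have hex : ∀ e : (I →₀ K) × V, ∃ g : I → V, e.1 ≠ 0 → ℓ e.1 g = e.2 := by
    intro e
    by_cases he : e.1 = 0
    · exact ⟨0, fun h => absurd he h⟩
    · exact (hsurj _ he e.2).imp fun g hg _ => hg
  choose g hg using hex
  -- B. H. Neumann's lemma: if finitely many cosets cover a group, one of the subgroups has finite
  -- index. The solution set of each equation is a coset of `ker ℓ`, whose quotient is the infinite
  -- group `V`.
  obtain ⟨e, he, hfin⟩ := AddSubgroup.exists_finiteIndex_of_leftCoset_cover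
    (H := fun e : (I →₀ K) × V => (ℓ e.1).toAddMonoidHom.ker) (g := g) (s := D) (by
      rw [Set.eq_univ_iff_forall]
      intro b
      obtain ⟨e, he, hb⟩ := hcon b
      simp only [Set.mem_iUnion]
      refine ⟨e, he, ?_⟩
      rw [Set.mem_vadd_set_iff_neg_vadd_mem, vadd_eq_add]
      simp only [SetLike.mem_coe, AddMonoidHom.mem_ker, LinearMap.toAddMonoidHom_coe, map_add,
        map_neg]
      rw [hg e (hD e he), hℓ, hb, neg_add_cancel])
  have h1 : Finite ((I → V) ⧸ (ℓ e.1).toAddMonoidHom.ker) :=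
    AddSubgroup.finite_quotient_of_finiteIndex
  have h2 := QuotientAddGroup.quotientKerEquivOfSurjective (ℓ e.1).toAddMonoidHom
    (hsurj _ (hD e he))
  have : Finite V := Finite.of_equiv _ h2.toEquiv
  exact not_finite V

/-- A family of vectors that violates the given linear equations in the indices in `B` can be
changed outside of `B` to violate all of the given nontrivial linear equations. -/
theorem exists_eqOn_forall_sum_ne {I : Type*} (B : Set I) (D : Finset ((I →₀ K) × V))
    (b₀ : I → V)
    (h₀ : ∀ e ∈ D, (∀ i ∈ e.1.support, i ∈ B) → (e.1.sum fun i a => a • b₀ i) ≠ e.2) :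
    ∃ b : I → V, (∀ i ∈ B, b i = b₀ i) ∧ ∀ e ∈ D, (e.1.sum fun i a => a • b i) ≠ e.2 := by
  classical
  let out : (I →₀ K) → (I →₀ K) := fun a => a.filter (· ∉ B)
  -- Substituting `b₀` on `B` leaves equations in the indices outside `B`. Those that become trivial
  -- are excluded by `h₀`; the others are avoided simultaneously.
  let D' : Finset ((I →₀ K) × V) := (D.image fun e =>
    (out e.1, e.2 - (e.1.filter (· ∈ B)).sum fun i a => a • b₀ i)).filter fun e => e.1 ≠ 0
  obtain ⟨c, hc⟩ := exists_forall_sum_ne D' fun e he => (Finset.mem_filter.1 he).2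
  let b : I → V := fun i => if i ∈ B then b₀ i else c i
  refine ⟨b, fun i hi => by simp [b, hi], fun e he heq => ?_⟩
  have hb1 : ((e.1.filter (· ∈ B)).sum fun i a => a • b i) =
      (e.1.filter (· ∈ B)).sum fun i a => a • b₀ i := by
    refine Finset.sum_congr rfl fun i hi => ?_
    have : i ∈ B := by
      rw [Finsupp.support_filter] at hi
      exact (Finset.mem_filter.1 hi).2
    simp [b, this]
  have hb2 : ((out e.1).sum fun i a => a • b i) = (out e.1).sum fun i a => a • c i := by
    refine Finset.sum_congr rfl fun i hi => ?_
    have : i ∉ B := by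
      rw [Finsupp.support_filter] at hi
      exact (Finset.mem_filter.1 hi).2
    simp [b, this]
  have hsplit : (e.1.sum fun i a => a • b i) =
      ((e.1.filter (· ∈ B)).sum fun i a => a • b i) + (out e.1).sum fun i a => a • b i := by
    conv_lhs => rw [← Finsupp.filter_add_filter_not e.1 (· ∈ B)]
    exact Finsupp.sum_add_index' (by simp) (by simp [add_smul])
  by_cases h0 : out e.1 = 0
  · have hB : ∀ i ∈ e.1.support, i ∈ B := by
      intro i hi
      by_contra hiB
      have := DFunLike.congr_fun h0 i
      exact Finsupp.mem_support_iff.1 hi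
        ((Finsupp.filter_apply_pos (· ∉ B) e.1 hiB).symm.trans this)
    have h1 : e.1.filter (· ∈ B) = e.1 := (Finsupp.filter_eq_self_iff _ _).2 fun i hi =>
      hB i (Finsupp.mem_support_iff.2 hi)
    refine h₀ e he hB ?_
    rw [← heq, hsplit, h0, hb1, h1]
    simp
  · refine hc (out e.1, _) (Finset.mem_filter.2 ⟨Finset.mem_image_of_mem _ he, h0⟩) ?_
    change ((out e.1).sum fun i a => a • c i) = _
    rw [← hb2, ← hb1, ← heq, hsplit, add_sub_cancel_left]

end Avoid

/-! ### Kernel configurations and modules over `K[X]` -/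

section KernelConfig

variable {K : Type k} [Field K]

theorem MonicIrr.isCoprime {f g : MonicIrr K} (h : f ≠ g) : IsCoprime f.1 g.1 := by
  by_cases h1 : f.1 ∣ g.1
  · exact absurd (Subtype.ext (eq_of_monic_of_associated f.2.1 g.2.1
      (f.2.2.associated_of_dvd g.2.2 h1))) h
  · exact (f.2.2.coprime_iff_not_dvd).2 h1

theorem MonicIrr.natDegree_pos (f : MonicIrr K) : 0 < f.1.natDegree :=
  f.2.2.natDegree_pos

namespace KernelConfig

variable {C : KernelConfig K}

/-- An infinite support would give the default value `0` to the `finsum`, which `deg_ne_zero` rules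
out. -/
theorem IsAlgebraic.finite_support (h : C.IsAlgebraic) :
    (Function.support fun f : MonicIrr K => (f.1.natDegree : ℕ∞) * C.c f).Finite := by
  by_contra hfin
  rcases C.deg_eq with h1 | h1
  · exact h h1
  · exact C.deg_ne_zero (h1.trans (finsum_of_infinite_support hfin))

theorem IsAlgebraic.c_lt_top (h : C.IsAlgebraic) (f : MonicIrr K) : C.c f < ⊤ := by
  by_contra hf
  have hf : C.c f = ⊤ := not_lt_top_iff.1 hf
  have hd : (f.1.natDegree : ℕ∞) ≠ 0 := by exact_mod_cast f.natDegree_pos.ne'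
  rcases C.deg_eq with h1 | h1
  · exact h h1
  · refine h (h1.trans ?_)
    rw [finsum_eq_sum _ h.finite_support]
    have hmem : f ∈ h.finite_support.toFinset := by
      simp [hf, f.natDegree_pos.ne']
    refine top_le_iff.1 (le_trans ?_ (Finset.single_le_sum
      (f := fun f : MonicIrr K => (f.1.natDegree : ℕ∞) * C.c f) (fun _ _ => zero_le) hmem))
    simp [hf, ENat.mul_top hd]

theorem IsAlgebraic.finite_mulSupport (h : C.IsAlgebraic) :
    (Function.mulSupport fun f : MonicIrr K => f.1 ^ (C.c f).toNat).Finite := by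
  refine h.finite_support.subset fun f hf => ?_
  rw [Function.mem_support]
  intro h0
  rcases mul_eq_zero.1 h0 with h0 | h0
  · exact f.natDegree_pos.ne' (by exact_mod_cast h0)
  · exact hf (by simp [h0])

theorem miPo_monic : C.miPo.Monic :=
  finprod_induction (p := fun q : K[X] => q.Monic) monic_one (fun _ _ => Monic.mul)
    fun f => f.2.1.pow _

theorem IsAlgebraic.miPo_eq (h : C.IsAlgebraic) (f : MonicIrr K) :
    ∃ q : K[X], C.miPo = f.1 ^ (C.c f).toNat * q ∧ IsCoprime f.1 q := by
  refine ⟨_, (mul_finprod_cond_ne f h.finite_mulSupport).symm, ?_⟩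
  refine finprod_induction (p := fun q : K[X] => IsCoprime f.1 q) isCoprime_one_right
    (fun _ _ => IsCoprime.mul_right) fun g => ?_
  refine finprod_induction (p := fun q : K[X] => IsCoprime f.1 q) isCoprime_one_right
    (fun _ _ => IsCoprime.mul_right) fun hg => ?_
  exact (MonicIrr.isCoprime (Ne.symm hg)).pow_right

theorem isAlgebraic_or_isTranscendental (C : KernelConfig K) :
    C.IsAlgebraic ∨ C.IsTranscendental :=
  (em C.IsTranscendental).symm

variable (C)

/-- Multiplication by `X` is a `C`-endomorphism. -/
def IsCModule (U : Type*) [AddCommGroup U] [Module K[X] U] : Prop :=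
  (C.IsAlgebraic → ∀ u : U, C.miPo • u = 0) ∧
  (C.IsTranscendental → ∀ f : MonicIrr K, C.c f < ⊤ → ∀ u : U,
    f.1 ^ ((C.c f).toNat + 1) • u = 0 → f.1 ^ (C.c f).toNat • u = 0)

theorem isCEndo_iff_isCModule {V : Type*} [AddCommGroup V] [Module K V] [Module K[X] V]
    {θ : Module.End K V} (hθ : ∀ (p : K[X]) (v : V), p • v = aeval θ p v) :
    C.IsCEndo θ ↔ C.IsCModule V := by
  refine and_congr (imp_congr_right fun _ => ?_)
    (imp_congr_right fun _ => forall₂_congr fun f _ => ?_)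
  · simp only [LinearMap.ext_iff, LinearMap.ker_eq_top, hθ, LinearMap.zero_apply]
  · simp only [hθ]
    constructor
    · intro h u hu
      have : u ∈ LinearMap.ker (aeval θ (f.1 ^ ((C.c f).toNat + 1))) := hu
      rwa [← h] at this
    · intro h
      refine le_antisymm (fun u hu => ?_) fun u hu => h u hu
      rw [LinearMap.mem_ker] at hu ⊢
      rw [pow_succ', map_mul, Module.End.mul_apply, hu, map_zero]

variable {C}

/-- In the algebraic case `f ^ C(f)` is the exact power of `f` in `miPo`, hence by Bézout a
combination of `f ^ (C(f) + 1)` and `miPo`. So the kernel condition of the transcendental case is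
available in both. -/
theorem IsCModule.smul_eq_zero {U : Type*} [AddCommGroup U] [Module K[X] U]
    (h : C.IsCModule U) {f : MonicIrr K} (hf : C.c f < ⊤) {u : U}
    (hu : f.1 ^ ((C.c f).toNat + 1) • u = 0) : f.1 ^ (C.c f).toNat • u = 0 := by
  rcases C.isAlgebraic_or_isTranscendental with hC | hC
  · obtain ⟨q, hq, hco⟩ := hC.miPo_eq f
    have h1 := h.1 hC u
    obtain ⟨a, b, hab⟩ := hco
    calc f.1 ^ (C.c f).toNat • u = (a * f.1 ^ ((C.c f).toNat + 1) + b * C.miPo) • u := by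
          congr 1
          rw [hq]
          linear_combination (-f.1 ^ (C.c f).toNat) * hab
      _ = 0 := by rw [add_smul, mul_smul, mul_smul, hu, h1, smul_zero, smul_zero, add_zero]
  · exact h.2 hC f hf u hu

theorem IsCModule.smul_eq_zero_of_add {U : Type*} [AddCommGroup U] [Module K[X] U]
    (h : C.IsCModule U) {f : MonicIrr K} (hf : C.c f < ⊤) {u : U} (n : ℕ)
    (hu : f.1 ^ ((C.c f).toNat + n) • u = 0) : f.1 ^ (C.c f).toNat • u = 0 := by
  induction n with
  | zero => exact hu
  | succ n ih =>
    refine ih ?_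
    have : f.1 ^ ((C.c f).toNat + 1) • (f.1 ^ n • u) = 0 := by
      rw [← mul_smul, ← pow_add, ← hu]
      congr 2
      ring
    have := h.smul_eq_zero hf this
    rwa [← mul_smul, ← pow_add] at this

theorem IsCModule.of_injective {U W : Type*} [AddCommGroup U] [Module K[X] U] [AddCommGroup W]
    [Module K[X] W] (h : C.IsCModule W) (g : U →ₗ[K[X]] W) (hg : Function.Injective g) :
    C.IsCModule U := by
  refine ⟨fun hC u => hg ?_, fun hC f hf u hu => hg ?_⟩
  · rw [map_smul, h.1 hC, map_zero]
  · rw [map_smul, map_zero]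
    refine h.2 hC f hf _ ?_
    rw [← map_smul, hu, map_zero]

theorem IsCModule.prod {U W : Type*} [AddCommGroup U] [Module K[X] U] [AddCommGroup W]
    [Module K[X] W] (h : C.IsCModule U) (h' : C.IsCModule W) : C.IsCModule (U × W) :=
  ⟨fun hC _ => Prod.ext (h.1 hC _) (h'.1 hC _), fun hC f hf _ hu =>
    Prod.ext (h.2 hC f hf _ (congrArg Prod.fst hu)) (h'.2 hC f hf _ (congrArg Prod.snd hu))⟩

theorem IsCModule.finsupp {U : Type*} [AddCommGroup U] [Module K[X] U] (h : C.IsCModule U)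
    (ι : Type*) : C.IsCModule (ι →₀ U) :=
  ⟨fun hC _ => Finsupp.ext fun _ => h.1 hC _, fun hC f hf _ hu =>
    Finsupp.ext fun i => h.2 hC f hf _ (DFunLike.congr_fun hu i)⟩

theorem IsTranscendental.isCModule_pi (hC : C.IsTranscendental) (ι : Type*) :
    C.IsCModule (ι → K[X]) := by
  refine ⟨fun h => absurd hC h, fun _ f _ u hu => ?_⟩
  have : u = 0 := (smul_eq_zero.1 hu).resolve_left (pow_ne_zero _ f.2.2.ne_zero)
  rw [this, smul_zero]

theorem isCModule_of_subsingleton (U : Type*) [AddCommGroup U] [Module K[X] U]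
    [Subsingleton U] : C.IsCModule U :=
  ⟨fun _ _ => Subsingleton.elim _ _, fun _ _ _ _ _ => Subsingleton.elim _ _⟩

end KernelConfig

end KernelConfig

/-! ### Adjoining solutions of equations `p • x = w` to a module over `K[X]` -/

section Adjoin

variable {K : Type k} [Field K] {V : Type*} [AddCommGroup V] [Module K[X] V] {τ : Type*}
  [Fintype τ]

/-- The relations `p k • x k = w k` between new elements `x k`. -/
noncomputable def adjoinRel (w : τ → V) (p : τ → K[X]) : (τ → K[X]) →ₗ[K[X]] V × (τ → K[X]) :=
  LinearMap.prod (-∑ k, (LinearMap.proj k : (τ → K[X]) →ₗ[K[X]] K[X]).smulRight (w k))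
    (LinearMap.pi fun k => p k • LinearMap.proj k)

theorem mem_range_adjoinRel {w : τ → V} {p : τ → K[X]} {a : V × (τ → K[X])} :
    a ∈ LinearMap.range (adjoinRel w p) ↔
      ∃ c : τ → K[X], a.1 = -∑ k, c k • w k ∧ ∀ k, a.2 k = c k * p k := by
  refine exists_congr fun c => ?_
  rw [Prod.ext_iff, eq_comm, eq_comm (b := a.2), funext_iff]
  simp [adjoinRel, mul_comm]

/-- The module obtained from `V` by adjoining elements `x k` with `p k • x k = w k`. -/
abbrev Adjoin (w : τ → V) (p : τ → K[X]) := (V × (τ → K[X])) ⧸ LinearMap.range (adjoinRel w p)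

/-- The class of `(v, d)` vanishes iff there are multipliers `c` with `d k = c k * p k` and `v = -∑
c k • w k`. In the algebraic case `d k * q k` are multipliers for `miPo • (v, d)`. In the
transcendental case let `n = C(g)` and let `h` be multipliers for `g ^ (n+1) • (v, d)`. Writing `h k
• w k = g ^ (n+1) • z k` gives `g ^ (n+1) • (v + ∑ z k) = 0`; hence `g ^ n` already kills this
element of `V`, and the `e k` are multipliers for `g ^ n • (v, d)`. -/
theorem isCModule_adjoin {C : KernelConfig K} (hV : C.IsCModule V) (w : τ → V) (p : τ → K[X])
    (halg : C.IsAlgebraic → ∀ k, ∃ q, C.miPo = q * p k ∧ q • w k = 0)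
    (htr : C.IsTranscendental → ∀ g : MonicIrr K, C.c g < ⊤ → ∀ (d h : τ → K[X]) (v : V),
      (∀ k, g.1 ^ ((C.c g).toNat + 1) * d k = h k * p k) →
      g.1 ^ ((C.c g).toNat + 1) • v + ∑ k, h k • w k = 0 →
      ∀ k, ∃ (z : V) (e : K[X]), h k • w k = g.1 ^ ((C.c g).toNat + 1) • z ∧
        g.1 ^ (C.c g).toNat * d k = e * p k ∧ g.1 ^ (C.c g).toNat • z = e • w k) :
    C.IsCModule (Adjoin w p) := by
  refine ⟨fun hC u => ?_, fun hC g hg u hu => ?_⟩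
  · obtain ⟨a, rfl⟩ := Submodule.Quotient.mk_surjective _ u
    choose q hq1 hq2 using halg hC
    rw [← Submodule.Quotient.mk_smul, Submodule.Quotient.mk_eq_zero, mem_range_adjoinRel]
    refine ⟨fun k => a.2 k * q k, ?_, fun k => ?_⟩
    · simp only [Prod.smul_fst, hV.1 hC, mul_smul, hq2, smul_zero, Finset.sum_const_zero, neg_zero]
    · simp only [Prod.smul_snd, Pi.smul_apply, smul_eq_mul]
      rw [hq1 k]
      ring
  · obtain ⟨a, rfl⟩ := Submodule.Quotient.mk_surjective _ u
    rw [← Submodule.Quotient.mk_smul, Submodule.Quotient.mk_eq_zero, mem_range_adjoinRel] at hu ⊢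
    obtain ⟨h, h1, h2⟩ := hu
    have h3 : g.1 ^ ((C.c g).toNat + 1) • a.1 + ∑ k, h k • w k = 0 := by
      rw [← Prod.smul_fst, h1, neg_add_cancel]
    choose z e hz he hze using htr hC g hg a.2 h a.1 h2 h3
    have h4 : g.1 ^ (C.c g).toNat • (a.1 + ∑ k, z k) = 0 := by
      refine hV.2 hC g hg _ ?_
      rw [smul_add, Finset.smul_sum, ← h3]
      simp only [hz]
    refine ⟨e, ?_, he⟩
    rw [smul_add, Finset.smul_sum] at h4
    simp only [hze] at h4
    exact eq_neg_of_add_eq_zero_left h4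

/-- Coprimality forces `g ^ (n+1) ∣ h`; with `h = g ^ (n+1) * h'` take `z = h' • w` and `e = g ^ n *
h'`. -/
theorem adjoin_condition_of_isCoprime {g p h d : K[X]} {n : ℕ} {w : V} (hg : g ≠ 0) (hco : IsCoprime g p)
    (hd : g ^ (n + 1) * d = h * p) :
    ∃ (z : V) (e : K[X]), h • w = g ^ (n + 1) • z ∧ g ^ n * d = e * p ∧ g ^ n • z = e • w := by
  obtain ⟨h', rfl⟩ : g ^ (n + 1) ∣ h :=
    (hco.pow_left (m := n + 1)).dvd_of_dvd_mul_right (Dvd.intro _ hd)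
  refine ⟨h' • w, g ^ n * h', by rw [mul_smul], ?_, by rw [mul_smul]⟩
  have : d = h' * p := mul_left_cancel₀ (pow_ne_zero (n + 1) hg) (by rw [hd]; ring)
  rw [this]
  ring

/-- Cancelling `g ^ q` shows that `h` is a multiple of `g ^ (n - q)`, which annihilates `w`; so `z =
0` works. -/
theorem adjoin_condition_of_pow {g h d : K[X]} {n q : ℕ} {w : V} (hq : q ≤ n) (hg : g ≠ 0)
    (hw : g ^ (n - q) • w = 0) (hd : g ^ (n + 1) * d = h * g ^ q) :
    ∃ (z : V) (e : K[X]), h • w = g ^ (n + 1) • z ∧ g ^ n * d = e * g ^ q ∧ g ^ n • z = e • w := by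
  have hn : g ^ n = g ^ (n - q) * g ^ q := by rw [← pow_add, Nat.sub_add_cancel hq]
  have h1 : h = g * d * g ^ (n - q) := by
    refine mul_right_cancel₀ (pow_ne_zero q hg) ?_
    rw [← hd, pow_succ, hn]
    ring
  refine ⟨0, d * g ^ (n - q), ?_, ?_, ?_⟩
  · rw [h1, mul_smul, hw, smul_zero, smul_zero]
  · rw [hn]
    ring
  · rw [mul_smul, hw, smul_zero, smul_zero]

/-- Elements of small degree are not affected by the relations. -/
theorem eq_zero_of_mem_range_adjoinRel {w : τ → V} {p : τ → K[X]} {a : V × (τ → K[X])}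
    (ha : a ∈ LinearMap.range (adjoinRel w p)) (hdeg : ∀ k, (a.2 k).degree < (p k).degree) :
    a = 0 := by
  obtain ⟨c, h1, h2⟩ := mem_range_adjoinRel.1 ha
  have hc : ∀ k, c k = 0 := by
    intro k
    by_contra hc
    have := hdeg k
    rw [h2 k, degree_mul] at this
    have h0 : 0 ≤ (c k).degree := zero_le_degree_iff.2 hc
    exact absurd this (not_lt.2 (le_add_of_nonneg_left h0))
  refine Prod.ext ?_ (funext fun k => ?_)
  · simp [h1, hc]
  · simp [h2, hc]

end Adjoin

/-! ### Independent solutions in elementary extensions -/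

section Independent

variable {L : FirstOrder.Language.{u, v}} {K : Type k} {d : ℕ} [Field K] (Ω : VSFormulas L K d)

/-- Equality of a linear combination of vectors with a given vector of the base model is
definable. -/
theorem exists_formula_sum_smul_eq_const {M : Type*} [L.Structure M] {I : Type*} (s : Finset I)
    (a : I → K) (c : Ω.carrier M) :
    ∃ χ : L.Formula (M ⊕ I × Fin d), ∀ (A : Type w) [L.Structure A] [Ω.IsVectorSpace A]
      (f : M → A) (t : Ω.carrier A) (b : I → Ω.carrier A), t.1 = f ∘ c.1 →
      (χ.Realize (Sum.elim f (Ω.coords b)) ↔ ∑ i ∈ s, a i • b i = t) := by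
  obtain ⟨χ, hχ⟩ := Ω.exists_formula_sum_smul_eq.{u, v, w} s a
  refine ⟨χ.relabel fun p => Sum.elim (fun i => Sum.inr (i, p.2)) (fun _ => Sum.inl (c.1 p.2)) p.1,
    fun A _ _ f t b ht => ?_⟩
  rw [Formula.realize_relabel, ← hχ]
  refine iff_of_eq (congrArg _ ?_)
  ext ⟨(i | _), j⟩
  · rfl
  · exact (congrFun ht j).symm

/-- If a formula about vectors does not imply any finite disjunction of nontrivial linear
dependencies, then it has an independent solution in an elementary extension. -/
theorem exists_elementary_independent {M : Type w} [Nonempty M] [L.Structure M]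
    [Ω.IsVectorSpace M] {I : Type w} (Φ : L.Formula (M ⊕ I × Fin d))
    (h : ∀ D : Finset ((I →₀ K) × Ω.carrier M), (∀ e ∈ D, e.1 ≠ 0) →
      ∃ b : I → Ω.carrier M, Φ.Realize (Sum.elim id (Ω.coords b)) ∧
        ∀ e ∈ D, (e.1.sum fun i a => a • b i) ≠ e.2) :
    ∃ (N : Type w) (_ : Nonempty N) (_ : L.Structure N) (e : M ↪ₑ[L] N), ∀ [Ω.IsVectorSpace N],
      ∃ b : I → Ω.carrier N, Φ.Realize (Sum.elim e (Ω.coords b)) ∧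
        ∀ (a : I →₀ K) (c : Ω.carrier M), a ≠ 0 → (a.sum fun i a => a • b i) ≠ Ω.map e c := by
  classical
  let κ := Option {e : (I →₀ K) × Ω.carrier M // e.1 ≠ 0}
  let s : κ → Set (I → Ω.carrier M) := fun o => o.elim
    {b | Φ.Realize (Sum.elim id (Ω.coords b))} fun e => {b | (e.1.1.sum fun i a => a • b i) ≠ e.1.2}
  -- The ultrafilter lives on the families of vectors of `M` themselves; by Łoś, the identity family
  -- becomes the independent solution in the ultrapower.
  obtain ⟨U, hU⟩ := exists_ultrafilter s (fun F => by
    obtain ⟨b, hb1, hb2⟩ := h (F.eraseNone.image Subtype.val) (fun e he => by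
      obtain ⟨e, -, rfl⟩ := Finset.mem_image.1 he
      exact e.2)
    refine ⟨b, fun k hk => ?_⟩
    rcases k with _ | e
    · exact hb1
    · exact hb2 e.1 (Finset.mem_image_of_mem _ (Finset.mem_eraseNone.2 hk)))
  let N := (U : Filter (I → Ω.carrier M)).Product fun _ => M
  let y : I × Fin d → N := fun p => ((fun b => Ω.coords b p : (I → Ω.carrier M) → M) : N)
  let e : M ↪ₑ[L] N := diagonal U
  have los : ∀ χ : L.Formula (M ⊕ I × Fin d), χ.Realize (Sum.elim e y) ↔
      ∀ᶠ b : I → Ω.carrier M in U, χ.Realize (Sum.elim id (Ω.coords b)) := by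
    intro χ
    let g : M ⊕ I × Fin d → (I → Ω.carrier M) → M := fun p b => Sum.elim id (Ω.coords b) p
    have : Sum.elim e y = fun p => ((g p : (I → Ω.carrier M) → M) : N) := by
      ext (m | p) <;> rfl
    rw [this]
    exact Ultraproduct.realize_formula_cast χ g
  have hy : ∀ i, (fun j => y (i, j)) ∈ Ω.carrier N := by
    intro i
    have h1 := (los (Ω.dom.relabel fun j => Sum.inr (i, j))).2 (Filter.Eventually.of_forall
      fun b => Formula.realize_relabel.2 (b i).2)
    exact (Formula.realize_relabel (v := Sum.elim e y)).1 h1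
  refine ⟨N, inferInstance, inferInstance, e, fun {_} => ⟨fun i => ⟨_, hy i⟩,
    (los Φ).2 (hU none), fun a c ha heq => ?_⟩⟩
  obtain ⟨χ, hχ⟩ := exists_formula_sum_smul_eq_const.{u, v, w} Ω a.support a c
  have h1 := (los χ).1 ((hχ N e (Ω.map e c) (fun i => ⟨_, hy i⟩) rfl).2 heq)
  obtain ⟨b, hb1, hb2⟩ := (h1.and (hU (some ⟨(a, c), ha⟩))).exists
  exact hb2 ((hχ M id c b rfl).1 hb1)

end Independent

/-! ### Extending endomorphisms -/

section Extension

variable {K : Type k} [Field K]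

/-- The `K[X]`-module given by an endomorphism. -/
noncomputable abbrev endoModule {V : Type*} [AddCommGroup V] [Module K V] (θ : Module.End K V) :
    Module K[X] V :=
  Module.compHom V (aeval θ).toRingHom

theorem isScalarTower_endoModule {V : Type*} [AddCommGroup V] [Module K V]
    (θ : Module.End K V) : letI := endoModule θ; IsScalarTower K K[X] V := by
  let _ := endoModule θ
  refine ⟨fun a p v => ?_⟩
  change aeval θ (a • p) v = a • aeval θ p v
  rw [map_smul, LinearMap.smul_apply]

theorem map_aeval_eq_smul {W U : Type*} [AddCommGroup W] [Module K W] [AddCommGroup U]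
    [Module K U] [Module K[X] U] [IsScalarTower K K[X] U] {g : Module.End K W} (φ : W →ₗ[K] U)
    (h : ∀ x, φ (g x) = (X : K[X]) • φ x) (p : K[X]) (x : W) : φ (aeval g p x) = p • φ x := by
  induction p using Polynomial.induction_on' with
  | add p q hp hq => rw [map_add, LinearMap.add_apply, map_add, hp, hq, add_smul]
  | monomial n a =>
    have hpow : ∀ n : ℕ, φ ((g ^ n) x) = (X ^ n : K[X]) • φ x := by
      intro n
      induction n with
      | zero => simp
      | succ n ih => rw [pow_succ', Module.End.mul_apply, h, ih, pow_succ', mul_smul]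
    rw [aeval_monomial, ← C_mul_X_pow_eq_monomial, mul_smul, ← hpow, Module.End.mul_apply,
      Module.algebraMap_end_apply, map_smul]
    exact (algebraMap_smul K[X] a _).symm

theorem smul_eq_map_aeval {W U : Type*} [AddCommGroup W] [Module K W] [AddCommGroup U]
    [Module K U] [Module K[X] U] [IsScalarTower K K[X] U] {g : Module.End K W} (φ : U →ₗ[K] W)
    (h : ∀ x, g (φ x) = φ ((X : K[X]) • x)) (p : K[X]) (x : U) : φ (p • x) = aeval g p (φ x) := by
  induction p using Polynomial.induction_on' with
  | add p q hp hq => rw [map_add, LinearMap.add_apply, ← hp, ← hq, add_smul, map_add]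
  | monomial n a =>
    have hpow : ∀ n : ℕ, (g ^ n) (φ x) = φ ((X ^ n : K[X]) • x) := by
      intro n
      induction n with
      | zero => simp
      | succ n ih => rw [pow_succ', Module.End.mul_apply, ih, h, pow_succ', mul_smul]
    rw [aeval_monomial, ← C_mul_X_pow_eq_monomial, mul_smul, Module.End.mul_apply, hpow,
      Module.algebraMap_end_apply, ← map_smul]
    exact congrArg φ (algebraMap_smul K[X] a _)

/-- A `C`-endomorphism on a subspace of large codimension extends to a `C`-endomorphism. -/
theorem exists_isCEndo_extension {C : KernelConfig K} {V W : Type w} {U : Type*} [AddCommGroup V]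
    [Module K V] [Module K[X] V] [IsScalarTower K K[X] V] [Infinite V] (hV : C.IsCModule V)
    [AddCommGroup U] [Module K U] [Module K[X] U] [IsScalarTower K K[X] U] (hU : C.IsCModule U)
    [AddCommGroup W] [Module K W] (j : U →ₗ[K] W) (hj : Function.Injective j) (c : V → W)
    (hc : LinearIndependent K ((LinearMap.range j).mkQ ∘ c)) :
    ∃ g : Module.End K W, (∀ u, g (j u) = j ((X : K[X]) • u)) ∧ C.IsCEndo g := by
  let Q := W ⧸ LinearMap.range j
  let ι := (Module.rank K Q).out
  have hι : Cardinal.mk ι = Module.rank K Q := Cardinal.mk_out _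
  have h1 : Cardinal.mk V ≤ Module.rank K Q := hc.cardinal_le_rank
  have h2 : Module.rank K V ≤ Module.rank K Q := (rank_le_card K V).trans h1
  have h3 : Cardinal.aleph0 ≤ Module.rank K Q := (Cardinal.aleph0_le_mk V).trans h1
  have hnt : Nontrivial V := Infinite.instNontrivial V
  -- The dimension of `Q` is infinite and at least `|V| ≥ dim V > 0`, so `dim Q · dim V = dim Q`.
  -- Thus `Q` is a direct sum of copies of `V`, and `X` can act there as it does on the `C`-module
  -- `V`.
  obtain ⟨φ⟩ : Nonempty (Q ≃ₗ[K] (ι →₀ V)) := by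
    refine nonempty_linearEquiv_of_lift_rank_eq ?_
    simp only [rank_finsupp, hι, Cardinal.lift_id]
    rw [Cardinal.mul_eq_left h3 h2 rank_pos.ne']
  obtain ⟨Q', hQ'⟩ := Submodule.exists_isCompl (LinearMap.range j)
  let Θ : (U × (ι →₀ V)) ≃ₗ[K] W :=
    ((LinearEquiv.ofInjective j hj).prodCongr
      (φ.symm.trans (Submodule.quotientEquivOfIsCompl _ _ hQ'))).trans
      (Submodule.prodEquivOfIsCompl _ _ hQ')
  have hΘ : ∀ u, Θ (u, 0) = j u := by
    intro u
    simp [Θ]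
  let g : Module.End K W :=
    Θ.toLinearMap ∘ₗ (Algebra.lsmul K K (U × (ι →₀ V)) (X : K[X])) ∘ₗ Θ.symm.toLinearMap
  have hg : ∀ x, Θ.symm (g x) = (X : K[X]) • Θ.symm x := by
    intro x
    simp [g]
  refine ⟨g, fun u => ?_, ?_⟩
  · apply Θ.symm.injective
    rw [hg, ← hΘ, ← hΘ, Θ.symm_apply_apply, Θ.symm_apply_apply, Prod.smul_mk, smul_zero]
  · let _ := endoModule g
    refine (C.isCEndo_iff_isCModule (θ := g) fun p v => rfl).2 ?_
    exact (hU.prod (hV.finsupp ι)).of_injective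
      { Θ.symm.toLinearMap with
        map_smul' := fun p x => map_aeval_eq_smul Θ.symm.toLinearMap hg p x }
      Θ.symm.injective

end Extension

/-! ### Expanding a structure by a given endomorphism -/

section ExtendTheta

variable {L : FirstOrder.Language.{u, v}} {K : Type k} {d : ℕ} [Field K] (Ω : VSFormulas L K d)

open Classical in
/-- The interpretation of `θ` by an endomorphism of `𝕍`. -/
noncomputable abbrev thetaStructure {N : Type*} [L.Structure N] [Ω.IsVectorSpace N]
    (g : Module.End K (Ω.carrier N)) : (thetaLang d).Structure N where
  funMap f x := match f with
    | .coord j => if h : x ∈ Ω.carrier N then (g ⟨x, h⟩).1 j else (0 : Ω.carrier N).1 j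
  RelMap r := r.elim

variable {N : Type*} [L.Structure N] [Ω.IsVectorSpace N] (g : Module.End K (Ω.carrier N))

theorem thetaMap_thetaStructure (x : Ω.carrier N) :
    letI := thetaStructure Ω g; thetaMap N x.1 = (g x).1 := by
  ext j
  classical
  change dite _ _ _ = _
  rw [dif_pos x.2]

theorem thetaMap_thetaStructure_of_notMem {x : Fin d → N} (hx : x ∉ Ω.carrier N) :
    letI := thetaStructure Ω g; thetaMap N x = (0 : Ω.carrier N).1 := by
  ext j
  classical
  change dite _ _ _ = _
  rw [dif_neg hx]

theorem isEndo_thetaStructure : letI := thetaStructure Ω g; Ω.IsEndo N :=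
  let _ := thetaStructure Ω g
  ⟨g, thetaMap_thetaStructure Ω g, fun _ => thetaMap_thetaStructure_of_notMem Ω g⟩

theorem endo_thetaStructure :
    letI := thetaStructure Ω g; letI := isEndo_thetaStructure Ω g; Ω.endo N = g := by
  let _ := thetaStructure Ω g
  have := isEndo_thetaStructure Ω g
  ext x : 1
  apply Subtype.ext
  rw [← thetaMap_coe]
  exact thetaMap_thetaStructure Ω g x

/-- An elementary embedding that is compatible with the endomorphisms is an `L_θ`-embedding. -/
theorem exists_embedding_thetaStructure {M : Type*} [L.Structure M] [(thetaLang d).Structure M]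
    [Ω.IsVectorSpace M] [Ω.IsEndo M] (e : M ↪ₑ[L] N)
    (h : ∀ x, g (Ω.map e x) = Ω.map e (Ω.endo M x)) :
    letI := thetaStructure Ω g; ∃ e' : M ↪[withTheta L d] N, ⇑e' = e := by
  let _ := thetaStructure Ω g
  have hθ : ∀ x : Fin d → M, thetaMap N (e ∘ x) = e ∘ thetaMap M x := by
    intro x
    by_cases hx : x ∈ Ω.carrier M
    · have h1 := thetaMap_thetaStructure Ω g (Ω.map e ⟨x, hx⟩)
      rw [h, VSFormulas.coe_map, VSFormulas.coe_map, ← thetaMap_coe] at h1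
      exact h1
    · rw [thetaMap_of_notMem Ω hx,
        thetaMap_thetaStructure_of_notMem Ω g (fun h => hx ((Ω.comp_mem_carrier_iff e).1 h)),
        ← VSFormulas.coe_map, map_zero]
  refine ⟨{ toFun := e, inj' := e.injective, map_fun' := ?_, map_rel' := ?_ }, rfl⟩
  · rintro n (f | f) x
    · exact e.map_fun f x
    · cases f with
      | coord j => exact (congrFun (hθ x) j).symm
  · rintro n (R | R) x
    · exact e.map_rel R x
    · exact R.elim

end ExtendTheta

/-! ### Realizing adjoined elements by independent vectors -/

section Realize

variable {K : Type k} [Field K] {V W : Type*} [AddCommGroup V] [Module K V] [Module K[X] V]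
  [IsScalarTower K K[X] V] [AddCommGroup W] [Module K W] {σ τ : Type*} [Fintype σ] [Fintype τ]

/-- The new generators. -/
noncomputable def adjoinGen [DecidableEq σ] [DecidableEq τ] (V : Type*) [AddCommGroup V] :
    σ ⊕ τ → (V × (σ → K[X])) × (τ → K[X]) :=
  Sum.elim (fun l => ((0, Pi.single l 1), 0)) fun k => ((0, 0), Pi.single k 1)

omit [Module K V] [IsScalarTower K K[X] V] [Fintype τ] in
theorem sum_smul_adjoinGen_inl [DecidableEq σ] [DecidableEq τ] (Q : σ → K[X]) :
    ∑ l, Q l • (adjoinGen V (Sum.inl l) : (V × (σ → K[X])) × (τ → K[X])) = ((0, Q), 0) := by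
  refine Prod.ext (Prod.ext ?_ (funext fun l => ?_)) ?_
  · simp [adjoinGen, Prod.fst_sum]
  · simp [adjoinGen, Prod.fst_sum, Prod.snd_sum, Finset.sum_apply, Pi.single_apply]
  · simp [adjoinGen, Prod.snd_sum]

omit [Module K V] [IsScalarTower K K[X] V] in
theorem smul_mk_adjoinGen_inr [DecidableEq σ] [DecidableEq τ] (w : τ → V × (σ → K[X]))
    (p : τ → K[X]) (k : τ) :
    p k • (Submodule.Quotient.mk (adjoinGen V (Sum.inr k)) : Adjoin w p) =
      ∑ l, (w k).2 l • (Submodule.Quotient.mk (adjoinGen V (Sum.inl l)) : Adjoin w p) +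
        Submodule.Quotient.mk (((w k).1, 0), 0) := by
  have h : ∑ l, (w k).2 l • (Submodule.Quotient.mk (adjoinGen V (Sum.inl l)) : Adjoin w p) =
      Submodule.Quotient.mk ((0, (w k).2), 0) := by
    rw [← sum_smul_adjoinGen_inl]
    exact (map_sum (LinearMap.range (adjoinRel w p)).mkQ _ _).symm
  rw [h, ← Submodule.Quotient.mk_smul, ← Submodule.Quotient.mk_add, Submodule.Quotient.eq,
    mem_range_adjoinRel]
  refine ⟨Pi.single k 1, ?_, fun k' => ?_⟩
  · rw [Finset.sum_eq_single k (fun k' _ hk' => by simp [hk']) (by simp)]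
    simp [adjoinGen]
  · rcases eq_or_ne k' k with rfl | hk
    · simp [adjoinGen]
    · simp [adjoinGen, hk]

/-- Independent vectors give an embedding of the module obtained by adjoining new elements. -/
theorem exists_adjoin_embedding [DecidableEq σ] [DecidableEq τ] {E : Type*} (f : V →ₗ[K] W)
    (hf : Function.Injective f) (b : (σ ⊕ τ) × ℕ ⊕ E → W)
    (hb : ∀ (a : (σ ⊕ τ) × ℕ ⊕ E →₀ K) (c : V), a ≠ 0 → (a.sum fun i a => a • b i) ≠ f c)
    (w : τ → V × (σ → K[X])) (p : τ → K[X]) (hp : ∀ k, p k ≠ 0) :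
    ∃ j : Adjoin w p →ₗ[K] W, Function.Injective j ∧
      (∀ v, j (Submodule.Quotient.mk ((v, 0), 0)) = f v) ∧
      (∀ s i, (∀ k, s = Sum.inr k → i < (p k).natDegree) →
        j (Submodule.Quotient.mk ((X : K[X]) ^ i • adjoinGen V s)) = b (Sum.inl (s, i))) ∧
      LinearIndependent K ((LinearMap.range j).mkQ ∘ b ∘ Sum.inr) := by
  have hind : ∀ (a : (σ ⊕ τ) × ℕ ⊕ E →₀ K) (c : V),
      Finsupp.linearCombination K b a = f c → a = 0 := by
    intro a c h
    by_contra ha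
    exact hb a c ha h
  let Bs : Module.Basis ((σ ⊕ τ) × ℕ) K ((σ ⊕ τ) → K[X]) :=
    (Pi.basis fun _ => basisMonomials K).reindex (Equiv.sigmaEquivProd _ _)
  have hBs : ∀ s i, Bs (s, i) = Pi.single s (X ^ i) := by
    intro s i
    simp [Bs, Pi.basis_apply, X_pow_eq_monomial]
  let D : ((V × (σ → K[X])) × (τ → K[X])) →ₗ[K] ((σ ⊕ τ) × ℕ ⊕ E →₀ K) :=
    Finsupp.lmapDomain K K Sum.inl ∘ₗ Bs.repr.toLinearMap ∘ₗ
      (LinearEquiv.sumArrowLequivProdArrow σ τ K K[X]).symm.toLinearMap ∘ₗ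
      LinearMap.prodMap (LinearMap.snd K V (σ → K[X])) LinearMap.id
  have hD : ∀ x, D x = Finsupp.mapDomain Sum.inl (Bs.repr (Sum.elim x.1.2 x.2)) := fun x => rfl
  -- `J` sends `X ^ i` in component `s` to `b (s, i)`. It is injective by independence, but it
  -- ignores the relations and does not factor through `Adjoin`.
  let J : ((V × (σ → K[X])) × (τ → K[X])) →ₗ[K] W :=
    f ∘ₗ LinearMap.fst K _ _ ∘ₗ LinearMap.fst K _ _ + Finsupp.linearCombination K b ∘ₗ D
  have hJ : ∀ x, J x = f x.1.1 + Finsupp.linearCombination K b (D x) := fun x => rfl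
  have hJinj : Function.Injective J := by
    rw [← LinearMap.ker_eq_bot, LinearMap.ker_eq_bot']
    intro x hx
    rw [hJ] at hx
    have h1 := hind (D x) (-x.1.1) (by
      rw [map_neg]
      exact eq_neg_of_add_eq_zero_right hx)
    have h2 : x.1.1 = 0 := by
      rw [h1, map_zero, add_zero] at hx
      exact hf (hx.trans (map_zero f).symm)
    have h3 : Sum.elim x.1.2 x.2 = 0 := by
      rw [hD] at h1
      have := Finsupp.mapDomain_injective Sum.inl_injective (h1.trans Finsupp.mapDomain_zero.symm)
      exact Bs.repr.injective (this.trans (map_zero _).symm)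
    refine Prod.ext (Prod.ext h2 (funext fun l => ?_)) (funext fun k => ?_)
    · exact congrFun h3 (Sum.inl l)
    · exact congrFun h3 (Sum.inr k)
  let R := (LinearMap.range (adjoinRel w p)).restrictScalars K
  let Bd : Submodule K ((V × (σ → K[X])) × (τ → K[X])) :=
    (⊤ : Submodule K (V × (σ → K[X]))).prod
      (Submodule.pi Set.univ fun k => degreeLT K (p k).natDegree)
  have hBd : ∀ x, x ∈ Bd ↔ ∀ k, (x.2 k).degree < (p k).natDegree := by
    intro x
    simp [Bd, Submodule.mem_prod, Submodule.mem_pi, mem_degreeLT]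
  have hdisj : Disjoint Bd R := by
    rw [Submodule.disjoint_def]
    intro x hx1 hx2
    have hx1 := (hBd x).1 hx1
    refine eq_zero_of_mem_range_adjoinRel hx2 fun k => ?_
    rw [degree_eq_natDegree (hp k)]
    exact hx1 k
  -- The tuples of bounded degree meet the relations trivially, so they extend to a complement `B'`
  -- of the relations. Restricting `J` to `B' ≃ Adjoin` keeps the prescribed values on bounded
  -- powers; the values elsewhere are immaterial.
  obtain ⟨B', hB', hc⟩ := hdisj.exists_isCompl
  let φ : Adjoin w p ≃ₗ[K] B' :=
    (Submodule.Quotient.restrictScalarsEquiv K (LinearMap.range (adjoinRel w p))).symm.trans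
      (Submodule.quotientEquivOfIsCompl R B' hc.symm)
  have hφ : ∀ x (hx : x ∈ B'), φ (Submodule.Quotient.mk x) = ⟨x, hx⟩ := by
    intro x hx
    exact Submodule.quotientEquivOfIsCompl_apply_mk_right hc.symm (⟨x, hx⟩ : B')
  let j : Adjoin w p →ₗ[K] W := J ∘ₗ B'.subtype ∘ₗ φ.toLinearMap
  have hj : ∀ x ∈ Bd, j (Submodule.Quotient.mk x) = J x := by
    intro x hx
    change J (φ (Submodule.Quotient.mk x)).1 = J x
    rw [hφ x (hB' hx)]
  refine ⟨j, hJinj.comp (Subtype.val_injective.comp φ.injective), fun v => ?_, fun s i hs => ?_, ?_⟩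
  · rw [hj _ ((hBd _).2 fun k => by simp), hJ, hD]
    simp
  · have hgen : J ((X : K[X]) ^ i • adjoinGen V s) = b (Sum.inl (s, i)) := by
      have h1 : Sum.elim ((X : K[X]) ^ i • adjoinGen V s : (V × (σ → K[X])) × (τ → K[X])).1.2
          ((X : K[X]) ^ i • adjoinGen V s : (V × (σ → K[X])) × (τ → K[X])).2 = Bs (s, i) := by
        rw [hBs]
        rcases s with l | k
        · simp [adjoinGen, ← Pi.single_smul]
        · simp [adjoinGen, ← Pi.single_smul]
      have h2 : ((X : K[X]) ^ i • adjoinGen V s : (V × (σ → K[X])) × (τ → K[X])).1.1 = 0 := by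
        rcases s with l | k <;> simp [adjoinGen]
      rw [hJ, hD, h1, h2, map_zero, zero_add, Module.Basis.repr_self, Finsupp.mapDomain_single,
        Finsupp.linearCombination_single, one_smul]
    rw [hj _ ((hBd _).2 fun k => ?_), hgen]
    rcases s with l | k'
    · simp [adjoinGen]
    · rcases eq_or_ne k k' with rfl | hk
      · simpa [adjoinGen] using hs k rfl
      · simp [adjoinGen, hk]
  · rw [linearIndependent_iff]
    intro l hl
    rw [Finsupp.linearCombination_apply] at hl
    have h1 : (l.sum fun i a => a • b (Sum.inr i)) ∈ LinearMap.range j := by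
      rw [← Submodule.ker_mkQ (LinearMap.range j), LinearMap.mem_ker, ← hl, Finsupp.sum, map_sum]
      simp [Finsupp.sum]
    obtain ⟨u, hu⟩ := h1
    set x := (φ u).1 with hx
    have hu' : J x = l.sum fun i a => a • b (Sum.inr i) := hu
    -- The image of `j` involves only `V` and the vectors with left indices, so comparing
    -- coefficients at the right indices gives `l = 0`.
    have h2 : Finsupp.linearCombination K b (Finsupp.mapDomain Sum.inr l - D x) = f x.1.1 := by
      rw [map_sub, Finsupp.linearCombination_mapDomain, Finsupp.linearCombination_apply, sub_eq_iff_eq_add,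
        ← hJ, hu']
      rfl
    have h3 := sub_eq_zero.1 (hind _ _ h2)
    ext i
    have h4 := DFunLike.congr_fun h3 (Sum.inr i)
    rw [Finsupp.mapDomain_apply Sum.inr_injective, hD, Finsupp.mapDomain_of_notMem_range] at h4
    · exact h4
    · simp

end Realize

/-! ### Solving sequence-systems in existentially closed models -/

section Solve

variable {L : FirstOrder.Language.{u, v}} {K : Type k} {d : ℕ} [Field K]

theorem aeval_apply_eq_sum {V : Type*} [AddCommGroup V] [Module K V] (θ : Module.End K V)
    (p : K[X]) {n : ℕ} (hn : p.natDegree < n) (x : V) :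
    aeval θ p x = ∑ i ∈ Finset.range n, p.coeff i • (θ ^ i) x := by
  rw [aeval_eq_sum_range' hn, LinearMap.sum_apply]
  rfl

/-- A placeholder formula as a formula about vectors. -/
noncomputable def vectorFormula {M : Type*} {σ : Type} (ψ : PlaceholderFormula L M σ d) :
    L.Formula (M ⊕ (σ × ℕ) × Fin d) :=
  ψ.relabel (Sum.map id fun p => ((p.1, p.2.1), p.2.2))

omit [Field K] in
theorem realize_vectorFormula {M : Type*} {σ : Type} (ψ : PlaceholderFormula L M σ d)
    (Ω : VSFormulas L K d) {A : Type*} [L.Structure A] (f : M → A) (b : σ × ℕ → Ω.carrier A) :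
    (vectorFormula ψ).Realize (Sum.elim f (Ω.coords b)) ↔
      ψ.Realize (Sum.elim f fun p => (b (p.1, p.2.1)).1 p.2.2) := by
  rw [vectorFormula, Formula.realize_relabel]
  refine iff_of_eq (congrArg _ ?_)
  ext (m | p) <;> rfl

theorem realize_congr_of_appears {M : Type*} {σ : Type} (ψ : PlaceholderFormula L M σ d)
    {A : Type*} [L.Structure A] (f : M → A) {y y' : σ → ℕ → Fin d → A}
    (h : ∀ s i, Appears ψ s i → y s i = y' s i) :
    ψ.Realize (Sum.elim f fun p => y p.1 p.2.1 p.2.2) ↔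
      ψ.Realize (Sum.elim f fun p => y' p.1 p.2.1 p.2.2) := by
  classical
  refine realize_congr_of_freeVarFinset ψ ?_
  rintro (m | ⟨s, i, j⟩) hp
  · rfl
  · refine congrFun (h s i ⟨j, ?_⟩) j
    convert hp

theorem exists_forall_appears_lt {M : Type*} {σ : Type} (ψ : PlaceholderFormula L M σ d) :
    ∃ n, ∀ s i, Appears ψ s i → i < n := by
  classical
  refine ⟨(ψ.freeVarFinset.toRight.sup fun p => p.2.1) + 1, fun s i ⟨j, hj⟩ => ?_⟩
  have hj' : (s, i, j) ∈ ψ.freeVarFinset.toRight := by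
    rw [Finset.mem_toRight]
    convert hj
  exact Nat.lt_succ_of_le (Finset.le_sup (f := fun p : σ × ℕ × Fin d => p.2.1) hj')

/-- A formula that does not imply dependencies can be satisfied by vectors, with further vectors,
that violate given nontrivial dependencies. -/
theorem exists_violating {Ω : VSFormulas L K d} {M : Type*} [L.Structure M] [Ω.IsVectorSpace M]
    [Infinite (Ω.carrier M)] {σ : Type} {E : Type*} (ψ : PlaceholderFormula L M σ d)
    (h : ¬ ImpliesDependencies Ω ψ) (D : Finset (((σ × ℕ) ⊕ E →₀ K) × Ω.carrier M))
    (hD : ∀ e ∈ D, e.1 ≠ 0) :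
    ∃ b : (σ × ℕ) ⊕ E → Ω.carrier M,
      ψ.Realize (Sum.elim id fun p => (b (Sum.inl (p.1, p.2.1))).1 p.2.2) ∧
        ∀ e ∈ D, (e.1.sum fun i a => a • b i) ≠ e.2 := by
  classical
  -- The equations in placeholders alone are violated because `ψ` implies no dependencies. The
  -- remaining ones are then violated by choosing the further vectors.
  let D₀ := D.filter fun e => ∀ i ∈ e.1.support, i ∈ Set.range (Sum.inl : σ × ℕ → σ × ℕ ⊕ E)
  let red : ((σ × ℕ) ⊕ E →₀ K) → (σ × ℕ →₀ K) := fun a =>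
    a.comapDomain Sum.inl Sum.inl_injective.injOn
  have hred : ∀ e ∈ D₀, e.1 = (red e.1).mapDomain Sum.inl := fun e he =>
    (Finsupp.mapDomain_comapDomain _ Sum.inl_injective e.1 (Finset.mem_filter.1 he).2).symm
  have h1 : ∃ y : σ → ℕ → Ω.carrier M, ψ.RealizeAt (fun s i => (y s i).1) ∧
      ∀ e ∈ D₀, ((red e.1).sum fun p a => a • y p.1 p.2) ≠ e.2 := by
    by_contra! hcon
    refine h ⟨D₀.image fun e => (red e.1, e.2), fun e he => ?_, fun y hy => ?_⟩
    · obtain ⟨e', he', rfl⟩ := Finset.mem_image.1 he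
      intro h0
      refine hD e' (Finset.mem_filter.1 he').1 ?_
      rw [hred e' he', show red e'.1 = 0 from h0, Finsupp.mapDomain_zero]
    · obtain ⟨e, he, h2⟩ := hcon y hy
      exact ⟨_, Finset.mem_image_of_mem _ he, h2⟩
  obtain ⟨y, hy, hyD⟩ := h1
  obtain ⟨b, hb1, hb2⟩ := exists_eqOn_forall_sum_ne
    (Set.range (Sum.inl : σ × ℕ → σ × ℕ ⊕ E)) D (Sum.elim (fun p => y p.1 p.2) 0) (by
      intro e he hsupp
      have he' : e ∈ D₀ := Finset.mem_filter.2 ⟨he, hsupp⟩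
      rw [hred e he', Finsupp.sum_mapDomain_index (by simp) (by simp [add_smul])]
      exact hyD e he')
  refine ⟨b, ?_, hb2⟩
  refine (iff_of_eq (congrArg _ ?_)).1 hy
  ext (m | p)
  · rfl
  · simp [hb1 _ (Set.mem_range_self _)]

variable {T : L.Theory} {Ω : VSFormulas L K d} {C : KernelConfig K}

/-- Solutions of equations in an extension that is a model can be pulled back. -/
theorem HasTransfer.exists_solution {M : Type w} [L.Structure M] [(thetaLang d).Structure M]
    [Ω.IsVectorSpace M] [Ω.IsEndo M] (hM : HasTransfer.{u, v, w, k, 0} T Ω C M) {N : Type w}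
    [L.Structure N] [(thetaLang d).Structure N] [Ω.IsVectorSpace N] [Ω.IsEndo N]
    (hN : IsModel T Ω C N) (e : M ↪[withTheta L d] N) (e' : M ↪ₑ[L] N) (he : ⇑e' = e)
    {σ τ : Type} [Fintype σ] [Fintype τ] (p : τ → K[X]) (P : τ → σ → K[X])
    (c : τ → Ω.carrier M) (ψ : PlaceholderFormula L M (σ ⊕ τ) d) (x : σ ⊕ τ → Ω.carrier N)
    (hψ : ψ.Realize (Sum.elim e fun p => ((Ω.endo N ^ p.2.1) (x p.1)).1 p.2.2))
    (hx : ∀ k, aeval (Ω.endo N) (p k) (x (Sum.inr k)) =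
      ∑ l, aeval (Ω.endo N) (P k l) (x (Sum.inl l)) + Ω.map e' (c k)) :
    ∃ x : σ ⊕ τ → Ω.carrier M, RealizeTheta Ω ψ x ∧ ∀ k,
      aeval (Ω.endo M) (p k) (x (Sum.inr k)) =
        ∑ l, aeval (Ω.endo M) (P k l) (x (Sum.inl l)) + c k := by
  classical
  obtain ⟨n, hn⟩ := exists_forall_appears_lt ψ
  let m : ℕ := n + (∑ k, (p k).natDegree + ∑ k, ∑ l, (P k l).natDegree) + 1
  have hmp : ∀ k, (p k).natDegree < m := fun k => by
    have := Finset.single_le_sum (f := fun k => (p k).natDegree) (fun _ _ => Nat.zero_le _)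
      (Finset.mem_univ k)
    omega
  have hmP : ∀ k l, (P k l).natDegree < m := fun k l => by
    have h1 := Finset.single_le_sum (f := fun k => ∑ l, (P k l).natDegree)
      (fun _ _ => Nat.zero_le _) (Finset.mem_univ k)
    have h2 := Finset.single_le_sum (f := fun l => (P k l).natDegree) (fun _ _ => Nat.zero_le _)
      (Finset.mem_univ l)
    omega
  -- The `k`-th equation as a `K`-linear equation between the vectors `θ ^ i (x s)`, `i < m`.
  let a : τ → (σ ⊕ τ) × ℕ → K := fun k q =>
    Sum.elim (fun l => -(P k l).coeff q.2) (fun k' => if k' = k then (p k).coeff q.2 else 0) q.1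
  have hlin : ∀ {V : Type w} [AddCommGroup V] [Module K V] (θ : Module.End K V)
      (b : (σ ⊕ τ) × ℕ → V) (y : σ ⊕ τ → V) (t : V) (k : τ),
      (∀ s i, i < m → b (s, i) = (θ ^ i) (y s)) →
      (∑ q ∈ Finset.univ ×ˢ Finset.range m, a k q • b q = t ↔
        aeval θ (p k) (y (Sum.inr k)) = ∑ l, aeval θ (P k l) (y (Sum.inl l)) + t) := by
    intro V _ _ θ b y t k hb
    have h1 : ∑ q ∈ Finset.univ ×ˢ Finset.range m, a k q • b q =
        -∑ l, aeval θ (P k l) (y (Sum.inl l)) + aeval θ (p k) (y (Sum.inr k)) := by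
      rw [Finset.sum_product, Fintype.sum_sum_type]
      congr 1
      · rw [← Finset.sum_neg_distrib]
        refine Finset.sum_congr rfl fun l _ => ?_
        rw [aeval_apply_eq_sum θ _ (hmP k l), ← Finset.sum_neg_distrib]
        refine Finset.sum_congr rfl fun i hi => ?_
        rw [hb _ _ (Finset.mem_range.1 hi)]
        simp [a]
      · rw [Finset.sum_eq_single k]
        · rw [aeval_apply_eq_sum θ _ (hmp k)]
          refine Finset.sum_congr rfl fun i hi => ?_
          rw [hb _ _ (Finset.mem_range.1 hi)]
          simp [a]
        · intro k' _ hk'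
          refine Finset.sum_eq_zero fun i _ => ?_
          simp [a, hk']
        · simp
    rw [h1, neg_add_eq_iff_eq_add]
  choose χ hχ using fun k => exists_formula_sum_smul_eq_const.{u, v, w} Ω
    (Finset.univ ×ˢ Finset.range m) (a k) (c k)
  obtain ⟨b, hb, hbE⟩ := hM.exists_vectors hN e
    (vectorFormula ψ ⊓ BoundedFormula.iInf χ)
    -- These equations `θ (b (s, i)) = b (s, i + 1)` for `i < m` force `b (s, i) = θ ^ i (b (s, 0))`
    -- up to `i = m`.
    ((Finset.univ ×ˢ Finset.range m).image fun q => (q, (q.1, q.2 + 1)))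
    (fun q => (Ω.endo N ^ q.2) (x q.1)) (by
      refine Formula.realize_inf.2 ⟨(realize_vectorFormula ψ Ω _ _).2 hψ,
        BoundedFormula.realize_iInf.2 fun k => ?_⟩
      refine (hχ k N e (Ω.map e' (c k)) _ (by rw [VSFormulas.coe_map, he])).2 ?_
      exact (hlin (Ω.endo N) _ x _ k fun _ _ _ => rfl).2 (hx k)) (by
      intro q hq
      obtain ⟨q, -, rfl⟩ := Finset.mem_image.1 hq
      rw [pow_succ', Module.End.mul_apply])
  obtain ⟨hb1, hb2⟩ := Formula.realize_inf.1 hb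
  have hb3 := BoundedFormula.realize_iInf.1 hb2
  have hpow : ∀ s i, i ≤ m → b (s, i) = (Ω.endo M ^ i) (b (s, 0)) := by
    intro s i
    induction i with
    | zero => simp
    | succ i ih =>
      intro hi
      rw [pow_succ', Module.End.mul_apply, ← ih (by omega)]
      exact (hbE _ (Finset.mem_image_of_mem _ (a := (s, i)) (by simpa using hi))).symm
  refine ⟨fun s => b (s, 0), ?_, fun k => ?_⟩
  · rw [realize_vectorFormula] at hb1
    refine (realize_congr_of_appears ψ id (y := fun s i => (b (s, i)).1)
      (y' := fun s i => ((Ω.endo M ^ i) (b (s, 0))).1) fun s i hsi => ?_).1 hb1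
    have := hn s i hsi
    rw [hpow s i (by omega)]
  · exact (hlin (Ω.endo M) b _ _ k fun s i hi => hpow s i hi.le).1
      ((hχ k M id (c k) b rfl).1 (hb3 k))

/-- In a model with the transfer property, one can solve `p k • x k = ∑ l, P k l • x l + c k`
together with a formula that does not imply dependencies, provided that adjoining a generic
solution gives a `C`-endomorphism. -/
theorem HasTransfer.exists_generic_solution
    {M : Type w} [L.Structure M] [(thetaLang d).Structure M] [Nonempty M] [M ⊨ T]
    [Ω.IsVectorSpace M] [Ω.IsEndo M] [Infinite (Ω.carrier M)]
    (hM : HasTransfer.{u, v, w, k, 0} T Ω C M) (hCM : C.IsCEndo (Ω.endo M))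
    (hΩ : ∀ (N : Type w) [Nonempty N] [L.Structure N] [N ⊨ T], Ω.IsVectorSpace N)
    {σ τ : Type} [Fintype σ] [Fintype τ] (p : τ → K[X]) (P : τ → σ → K[X])
    (c : τ → Ω.carrier M) (hp : ∀ k, p k ≠ 0)
    (hC : letI := endoModule (Ω.endo M); C.IsCModule (Adjoin (fun k => (c k, P k)) p))
    (ψ : PlaceholderFormula L M (σ ⊕ τ) d)
    (hψ : ∀ k i, Appears ψ (Sum.inr k) i → i < (p k).natDegree)
    (hdep : ¬ ImpliesDependencies Ω ψ) :
    ∃ x : σ ⊕ τ → Ω.carrier M, RealizeTheta Ω ψ x ∧ ∀ k,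
      aeval (Ω.endo M) (p k) (x (Sum.inr k)) =
        ∑ l, aeval (Ω.endo M) (P k l) (x (Sum.inl l)) + c k := by
  classical
  let _ := endoModule (Ω.endo M)
  have := isScalarTower_endoModule (Ω.endo M)
  have hV : C.IsCModule (Ω.carrier M) := (C.isCEndo_iff_isCModule fun p v => rfl).1 hCM
  -- The additional vectors, indexed by `𝕍(M)` and unconstrained by `ψ`, guarantee the codimension
  -- needed to extend the endomorphism.
  let Φ : L.Formula (M ⊕ (((σ ⊕ τ) × ℕ) ⊕ Ω.carrier M) × Fin d) :=
    (vectorFormula ψ).relabel (Sum.map id (Prod.map Sum.inl id))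
  have hΦ : ∀ {A : Type w} [L.Structure A] (f : M → A)
      (b : ((σ ⊕ τ) × ℕ) ⊕ Ω.carrier M → Ω.carrier A),
      Φ.Realize (Sum.elim f (Ω.coords b)) ↔
        ψ.Realize (Sum.elim f fun p => (b (Sum.inl (p.1, p.2.1))).1 p.2.2) := by
    intro A _ f b
    rw [Formula.realize_relabel, ← realize_vectorFormula ψ Ω f fun q => b (Sum.inl q)]
    refine iff_of_eq (congrArg _ ?_)
    ext (m | q) <;> rfl
  obtain ⟨N, _, _, e, hN⟩ := exists_elementary_independent Ω Φ fun D hD => by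
    obtain ⟨b, hb1, hb2⟩ := exists_violating ψ hdep D hD
    exact ⟨b, (hΦ id b).2 hb1, hb2⟩
  have : N ⊨ T := (e.theory_model_iff T).1 inferInstance
  have := hΩ N
  obtain ⟨b, hb1, hb2⟩ := hN
  rw [hΦ] at hb1
  obtain ⟨j, hj, hj1, hj2, hj3⟩ := exists_adjoin_embedding (Ω.map e) (Ω.map_injective e) b hb2
    (fun k => (c k, P k)) p hp
  obtain ⟨g, hg, hgC⟩ := exists_isCEndo_extension hV hC j hj _ hj3
  have hge : ∀ v, g (Ω.map e v) = Ω.map e (Ω.endo M v) := by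
    intro v
    have h1 : (X : K[X]) • v = Ω.endo M v := by
      change aeval (Ω.endo M) X v = _
      rw [aeval_X]
    rw [← hj1, hg, ← hj1, ← Submodule.Quotient.mk_smul, Prod.smul_mk, Prod.smul_mk, h1,
      smul_zero, smul_zero]
  let _ := thetaStructure Ω g
  have := isEndo_thetaStructure Ω g
  have hend : Ω.endo N = g := endo_thetaStructure Ω g
  obtain ⟨e', he'⟩ := exists_embedding_thetaStructure Ω g e hge
  have hNmodel : IsModel T Ω C N := ⟨inferInstance, inferInstance, inferInstance, hend ▸ hgC⟩
  have hgj : ∀ (q : K[X]) u, aeval g q (j u) = j (q • u) := fun q u =>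
    (smul_eq_map_aeval j hg q u).symm
  refine hM.exists_solution hNmodel e' e he'.symm p P c ψ
    (fun s => j (Submodule.Quotient.mk (adjoinGen _ s))) ?_ fun k => ?_
  · rw [he']
    refine (realize_congr_of_appears ψ e (y := fun s i => (b (Sum.inl (s, i))).1)
      (y' := fun s i => ((Ω.endo N ^ i) (j (Submodule.Quotient.mk (adjoinGen _ s)))).1)
      fun s i hsi => ?_).1 hb1
    rw [← hj2 s i (fun k hk => hψ k i (hk ▸ hsi)), hend, Submodule.Quotient.mk_smul, ← hgj,
      map_pow, aeval_X]
  · rw [hend, hgj]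
    simp only [hgj]
    rw [← hj1, ← map_sum, ← map_add]
    refine congrArg j ?_
    exact smul_mk_adjoinGen_inr (fun k => (c k, P k)) p k

end Solve

/-! ### Existentially closed models satisfy the axioms -/

section Forward

variable {L : FirstOrder.Language.{u, v}} {K : Type k} {d : ℕ} [Field K]
  {T : L.Theory} {Ω : VSFormulas L K d} {C : KernelConfig K}

/-- By Bézout, `f ^ C(f)` is a multiple of `f ^ (C(f) + 1)` modulo `miPo`, which acts as zero. -/
theorem KernelConfig.IsAlgebraic.imageComplete (hC : C.IsAlgebraic) {V : Type*} [AddCommGroup V]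
    [Module K V] {θ : Module.End K V} (hθ : C.IsCEndo θ) : C.ImageComplete θ := by
  intro f _
  refine le_antisymm ?_ ?_
  · rintro _ ⟨v, rfl⟩
    exact ⟨aeval θ f.1 v, by rw [pow_succ, map_mul, Module.End.mul_apply]⟩
  · rintro _ ⟨v, rfl⟩
    obtain ⟨q, hq, a, b, hab⟩ := hC.miPo_eq f
    have h0 : aeval θ C.miPo v = 0 := by
      rw [LinearMap.ker_eq_top.1 (hθ.1 hC), LinearMap.zero_apply]
    refine ⟨aeval θ a v, ?_⟩
    have h1 : f.1 ^ (C.c f).toNat = f.1 ^ ((C.c f).toNat + 1) * a + b * C.miPo := by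
      rw [hq]
      linear_combination (-f.1 ^ (C.c f).toNat) * hab
    conv_rhs => rw [h1, map_add, map_mul, map_mul, LinearMap.add_apply, Module.End.mul_apply,
      Module.End.mul_apply, h0, map_zero, add_zero]

/-- In finite dimension, equal kernels force equal images by rank-nullity. -/
theorem imageComplete_of_finite {V : Type*} [AddCommGroup V] [Module K V] [Finite V]
    {θ : Module.End K V} (hθ : C.IsCEndo θ) : C.ImageComplete θ := by
  rcases C.isAlgebraic_or_isTranscendental with hC | hC
  · exact hC.imageComplete hθ
  intro f hf
  have : FiniteDimensional K V := Module.Finite.of_finite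
  have hker := hθ.2 hC f hf
  refine Submodule.eq_of_le_of_finrank_eq ?_ ?_
  · rintro _ ⟨v, rfl⟩
    exact ⟨aeval θ f.1 v, by rw [pow_succ, map_mul, Module.End.mul_apply]⟩
  · have h1 := LinearMap.finrank_range_add_finrank_ker (aeval θ (f.1 ^ (C.c f).toNat))
    have h2 := LinearMap.finrank_range_add_finrank_ker (aeval θ (f.1 ^ ((C.c f).toNat + 1)))
    rw [hker] at h1
    omega

variable {M : Type w} [L.Structure M] [(thetaLang d).Structure M] [Nonempty M] [M ⊨ T]
  [Ω.IsVectorSpace M] [Ω.IsEndo M]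

/-- If `f ^ n • w`, with `n = C(f)`, were outside the image of `f ^ (n+1)`, adjoining `x` with `f •
x = w` would preserve the `C`-condition. A solution in `M` would then give `f ^ (n+1) • x = f ^ n •
w`. -/
theorem HasTransfer.imageComplete (hM : HasTransfer.{u, v, w, k, 0} T Ω C M)
    (hCM : C.IsCEndo (Ω.endo M))
    (hΩ : ∀ (N : Type w) [Nonempty N] [L.Structure N] [N ⊨ T], Ω.IsVectorSpace N) :
    C.ImageComplete (Ω.endo M) := by
  classical
  rcases finite_or_infinite (Ω.carrier M) with hfin | hinf
  · exact imageComplete_of_finite hCM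
  rcases C.isAlgebraic_or_isTranscendental with hC | hC
  · exact hC.imageComplete hCM
  intro f hf
  refine le_antisymm ?_ ?_
  · rintro _ ⟨v, rfl⟩
    exact ⟨aeval (Ω.endo M) f.1 v, by rw [pow_succ, map_mul, Module.End.mul_apply]⟩
  rintro _ ⟨w, rfl⟩
  let _ := endoModule (Ω.endo M)
  have hV : C.IsCModule (Ω.carrier M) := (C.isCEndo_iff_isCModule fun p v => rfl).1 hCM
  set n := (C.c f).toNat with hn
  change f.1 ^ n • w ∈ _
  by_contra hw
  have hw' : ∀ z : Ω.carrier M, f.1 ^ (n + 1) • z ≠ f.1 ^ n • w := fun z hz => hw ⟨z, hz⟩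
  have hCU : C.IsCModule (Adjoin (fun _ : Unit => (w, (0 : Fin 0 → K[X]))) fun _ => f.1) := by
    refine isCModule_adjoin (hV.prod (hC.isCModule_pi _)) _ _ (fun h => absurd hC h)
      fun _ g hg d h v hd hv k => ?_
    rcases eq_or_ne g f with rfl | hgf
    · have hg0 := g.2.2.ne_zero
      have h1 : h k = g.1 ^ n * d k := by
        refine mul_right_cancel₀ hg0 ?_
        rw [← hd k, pow_succ]
        ring
      have hdvd : g.1 ∣ d k := by
        -- If `f` did not divide `d k`, then Bézout `a * f + b * d k = 1` would make `a • w - b •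
        -- v.1` a preimage of `f ^ n • w` under `f ^ (n+1)`.
        by_contra hnd
        obtain ⟨a, b, hab⟩ := (g.2.2.coprime_iff_not_dvd).2 hnd
        have h2 : g.1 ^ (n + 1) • v.1 + h k • w = 0 := by
          simpa using congrArg Prod.fst hv
        rw [h1] at h2
        have h3 : d k • g.1 ^ n • w = -g.1 ^ (n + 1) • v.1 := by
          rw [← mul_smul, mul_comm, neg_smul]
          exact eq_neg_of_add_eq_zero_right h2
        refine hw' (a • w - b • v.1) ?_
        calc g.1 ^ (n + 1) • (a • w - b • v.1)
            = (g.1 ^ n * (a * g.1)) • w + b • (-g.1 ^ (n + 1) • v.1) := by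
              module
          _ = (g.1 ^ n * (a * g.1 + b * d k)) • w := by
              rw [← h3, mul_add, add_smul]
              simp only [← mul_smul]
              congr 2
              ring
          _ = g.1 ^ n • w := by rw [hab, mul_one]
      obtain ⟨d', hd'⟩ := hdvd
      refine ⟨d' • (w, 0), g.1 ^ n * d', ?_, ?_, by rw [mul_smul]⟩
      · rw [h1, hd', ← mul_smul]
        congr 1
        ring
      · rw [hd']
        ring
    · exact adjoin_condition_of_isCoprime g.2.2.ne_zero (MonicIrr.isCoprime hgf) (hd k)
  obtain ⟨x, -, hx⟩ := hM.exists_generic_solution hCM hΩ (fun _ : Unit => f.1)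
    (fun _ => (0 : Fin 0 → K[X])) (fun _ => w) (fun _ => f.2.2.ne_zero) hCU ⊤
    (by
      rintro k i ⟨j, hj⟩
      simp at hj) (by
      rintro ⟨D, hD, h⟩
      obtain ⟨b, hb⟩ := exists_forall_sum_ne D hD
      obtain ⟨e, he, h1⟩ := h (fun s i => b (s, i)) (by simp [PlaceholderFormula.RealizeAt])
      exact hb e he h1)
  have h1 := hx ()
  simp only [Finset.univ_eq_empty, Finset.sum_empty, zero_add] at h1
  refine hw' (x (Sum.inr ())) ?_
  rw [pow_succ, mul_smul]
  exact congrArg (f.1 ^ n • ·) h1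

/-- Adjoining a generic solution of a sequence-system gives a `C`-endomorphism. -/
theorem SequenceSystem.isCModule_adjoin {V : Type*} [AddCommGroup V] [Module K V]
    {θ : Module.End K V} (hθ : C.IsCEndo θ) (S : SequenceSystem C θ) :
    letI := endoModule θ
    C.IsCModule (Adjoin (fun k : Fin S.n ⊕ Fin S.r =>
      ((Sum.elim S.uld S.uke k, Sum.elim S.P 0 k) : V × (Fin S.m → K[X])))
      (Sum.elim S.ξ fun k => (S.f k).1 ^ S.q k)) := by
  let _ := endoModule θ
  have hV : C.IsCModule V := (C.isCEndo_iff_isCModule fun p v => rfl).1 hθ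
  have hq : ∀ k, S.q k ≤ (C.c (S.f k)).toNat := fun k => by
    have := S.q_le k
    rwa [← ENat.natCast_toNat (S.f_lt_top k).ne, ENat.natCast_le_natCast] at this
  have hu : ∀ k, (S.f k).1 ^ ((C.c (S.f k)).toNat - S.q k) • S.uke k = 0 := S.uke_mem
  have hu' : ∀ k, (S.f k).1 ^ ((C.c (S.f k)).toNat - S.q k) •
      ((S.uke k, 0) : V × (Fin S.m → K[X])) = 0 := fun k => Prod.ext (hu k) (smul_zero _)
  refine GenericEndo.isCModule_adjoin ?_ _ _ (fun hC k => ?_) fun hC g hg d h v hd hv k => ?_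
  · rcases C.isAlgebraic_or_isTranscendental with hC | hC
    · have : IsEmpty (Fin S.m) := by
        rw [(S.alg hC).1]
        infer_instance
      exact hV.prod (KernelConfig.isCModule_of_subsingleton _)
    · exact hV.prod (hC.isCModule_pi _)
  · rcases k with k | k
    · exact ((Fin.cast (S.alg hC).2 k).elim0)
    · obtain ⟨q, hq', -⟩ := hC.miPo_eq (S.f k)
      -- The quotient of `miPo` by `f ^ q_k` contains the factor `f ^ (C(f) - q_k)`, which
      -- annihilates the right hand side by condition (iii).
      refine ⟨q * (S.f k).1 ^ ((C.c (S.f k)).toNat - S.q k), ?_, ?_⟩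
      · rw [hq', Sum.elim_inr, mul_assoc, ← pow_add, Nat.sub_add_cancel (hq k), mul_comm]
      · rw [mul_smul]
        exact (congrArg (q • ·) (hu' k)).trans (smul_zero q)
  · rcases k with k | k
    · refine adjoin_condition_of_isCoprime g.2.2.ne_zero ?_ (hd (Sum.inl k))
      -- Every irreducible factor of `ξ k` has `C = ∞`, whereas `C(g) < ∞`.
      refine (g.2.2.coprime_iff_not_dvd).2 fun hdvd => ?_
      exact hg.ne (S.ξ_fac k g hdvd)
    · rcases eq_or_ne g (S.f k) with rfl | hgf
      · refine adjoin_condition_of_pow (hq k) (S.f k).2.2.ne_zero ?_ (hd (Sum.inr k))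
        rw [Sum.elim_inr, Sum.elim_inr, Prod.smul_mk, hu k]
        simp
      · exact adjoin_condition_of_isCoprime g.2.2.ne_zero
          (MonicIrr.isCoprime hgf).pow_right (hd (Sum.inr k))

theorem HasTransfer.exists_holds (hM : HasTransfer.{u, v, w, k, 0} T Ω C M)
    (hCM : C.IsCEndo (Ω.endo M))
    (hΩ : ∀ (N : Type w) [Nonempty N] [L.Structure N] [N ⊨ T], Ω.IsVectorSpace N)
    (S : SequenceSystem C (Ω.endo M)) (ψ : PlaceholderFormula L M S.Var d) (hψ : S.Bounds ψ)
    (hdep : ¬ ImpliesDependencies Ω ψ) :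
    ∃ x : S.Var → Ω.carrier M, RealizeTheta Ω ψ x ∧ S.Holds x := by
  classical
  rcases finite_or_infinite (Ω.carrier M) with hfin | hinf
  · rcases isEmpty_or_nonempty S.Var with hemp | ⟨⟨s⟩⟩
    · obtain ⟨y, hy⟩ : ∃ y : S.Var → ℕ → Ω.carrier M, ψ.RealizeAt fun s i => (y s i).1 := by
        by_contra! hcon
        exact hdep ⟨∅, by simp, fun y hy => absurd hy (hcon y)⟩
      refine ⟨isEmptyElim, ?_, fun k => isEmptyElim (S.ld k), fun k => isEmptyElim (S.ke k)⟩
      refine (iff_of_eq (congrArg ψ.RealizeAt ?_)).1 hy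
      ext s
      exact isEmptyElim s
    -- In a finite space, the equations `x_s^0 = v` for all `v` form a finite disjunction that
    -- always holds; so `hdep` leaves only systems without variables.
    · have := Fintype.ofFinite (Ω.carrier M)
      refine absurd ⟨Finset.univ.image fun v => (Finsupp.single (s, 0) 1, v), ?_, ?_⟩ hdep
      · intro e he
        obtain ⟨v, -, rfl⟩ := Finset.mem_image.1 he
        simp
      · intro y _
        exact ⟨_, Finset.mem_image_of_mem _ (Finset.mem_univ (y s 0)), by simp⟩
  obtain ⟨x, hx1, hx2⟩ := hM.exists_generic_solution hCM hΩ
    (Sum.elim S.ξ fun k => (S.f k).1 ^ S.q k) (Sum.elim S.P 0) (Sum.elim S.uld S.uke)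
    (by
      rintro (k | k)
      · exact (S.ξ_monic k).ne_zero
      · exact pow_ne_zero _ (S.f k).2.2.ne_zero)
    (S.isCModule_adjoin hCM) ψ (by
      rintro (k | k) i hi
      · exact hψ.1 k i hi
      · exact hψ.2 k i hi) hdep
  refine ⟨x, hx1, fun k => hx2 (Sum.inl k), fun k => ?_⟩
  have := hx2 (Sum.inr k)
  simpa using this

end Forward

/-! ### Generators of finitely generated extensions -/

section Structure

/-- A finitely generated module over a principal ideal domain is generated by elements whose only
relations are `p s • g s = 0`, where `p s` is zero or a power of an irreducible element. -/
theorem exists_generators {R : Type u} [CommRing R] [IsDomain R] [IsPrincipalIdealRing R]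
    (N : Type v) [AddCommGroup N] [Module R N] [Module.Finite R N] :
    ∃ (κ : Type u) (_ : Fintype κ) (p : κ → R) (g : κ → N),
      (∀ s, p s = 0 ∨ ∃ (π : R) (e : ℕ), Irreducible π ∧ p s = π ^ e) ∧
      (∀ Q : κ → R, ∑ s, Q s • g s = 0 ↔ ∀ s, p s ∣ Q s) ∧
      ∀ x : N, ∃ Q : κ → R, x = ∑ s, Q s • g s := by
  classical
  obtain ⟨n, ι, _, p, hp, e, ⟨φ⟩⟩ := Module.equiv_free_prod_directSum (R := R) (M := N)
  let ψ : N ≃ₗ[R] (Fin n → R) × ((i : ι) → R ⧸ R ∙ p i ^ e i) :=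
    φ.trans ((Finsupp.linearEquivFunOnFinite R R (Fin n)).prodCongr
      (DirectSum.linearEquivFunOnFintype R ι fun i => R ⧸ R ∙ p i ^ e i))
  let g : Fin n ⊕ ι → N := Sum.elim (fun l => ψ.symm (Pi.single l 1, 0))
    fun i => ψ.symm (0, Pi.single i (Submodule.Quotient.mk 1))
  have hg : ∀ Q : Fin n ⊕ ι → R, ψ (∑ s, Q s • g s) =
      (fun l => Q (Sum.inl l), fun i => Submodule.Quotient.mk (Q (Sum.inr i))) := by
    intro Q
    rw [map_sum, Fintype.sum_sum_type]
    refine Prod.ext (funext fun l => ?_) (funext fun i => ?_)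
    · simp [g, Prod.fst_sum, Finset.sum_apply, Pi.single_apply]
    · have h1 : ∀ l : Fin n, (ψ (Q (Sum.inl l) • g (Sum.inl l))).2 i = 0 := fun l => by
        simp [g]
      have h2 : ∀ j : ι, (ψ (Q (Sum.inr j) • g (Sum.inr j))).2 i =
          if i = j then Submodule.Quotient.mk (Q (Sum.inr i)) else 0 := by
        intro j
        have h3 : ψ (g (Sum.inr j)) = (0, Pi.single j (Submodule.Quotient.mk 1)) :=
          ψ.apply_symm_apply _
        rw [map_smul, h3]
        change Q (Sum.inr j) • (Pi.single j (Submodule.Quotient.mk 1) :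
          (i : ι) → R ⧸ R ∙ p i ^ e i) i = _
        rcases eq_or_ne i j with rfl | hx
        · rw [Pi.single_eq_same, if_pos rfl, ← Submodule.Quotient.mk_smul, smul_eq_mul, mul_one]
        · rw [Pi.single_eq_of_ne hx, if_neg hx, smul_zero]
      rw [Prod.snd_add, Pi.add_apply, Prod.snd_sum, Prod.snd_sum, Finset.sum_apply,
        Finset.sum_apply, Finset.sum_eq_zero fun l _ => h1 l, zero_add,
        Finset.sum_congr rfl fun j _ => h2 j, Finset.sum_ite_eq, if_pos (Finset.mem_univ i)]
  -- The free generators get the polynomial `0`; `ULift` only matches the universe of `ι`.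
  refine ⟨ULift (Fin n) ⊕ ι, inferInstance, Sum.elim 0 fun i => p i ^ e i,
    fun s => g (Sum.map ULift.down id s), ?_, fun Q => ?_, fun x => ?_⟩
  · rintro (l | i)
    · exact Or.inl rfl
    · exact Or.inr ⟨p i, e i, hp i, rfl⟩
  · have h1 : ∑ s, Q s • g (Sum.map ULift.down id s) =
        ∑ s, (Q ∘ Sum.map ULift.up id) s • g s := by
      refine Fintype.sum_equiv (Equiv.ulift.sumCongr (Equiv.refl ι)) _ _ ?_
      rintro (l | i) <;> rfl
    rw [h1, ← ψ.map_eq_zero_iff, hg, Prod.ext_iff, funext_iff, funext_iff]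
    constructor
    · rintro ⟨h2, h3⟩ (l | i)
      · exact zero_dvd_iff.2 (h2 l.down)
      · exact Ideal.mem_span_singleton.1 ((Submodule.Quotient.mk_eq_zero _).1 (h3 i))
    · intro h
      refine ⟨fun l => zero_dvd_iff.1 (h (Sum.inl ⟨l⟩)), fun i => ?_⟩
      exact (Submodule.Quotient.mk_eq_zero _).2 (Ideal.mem_span_singleton.2 (h (Sum.inr i)))
  · choose r hr using fun i => Submodule.Quotient.mk_surjective _ ((ψ x).2 i)
    refine ⟨Sum.elim (fun l => (ψ x).1 l.down) r, ψ.injective ?_⟩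
    have h1 : ∑ s, (Sum.elim (fun l : ULift (Fin n) => (ψ x).1 l.down) r) s •
        g (Sum.map ULift.down id s) = ∑ s, (Sum.elim (ψ x).1 r) s • g s := by
      refine Fintype.sum_equiv (Equiv.ulift.sumCongr (Equiv.refl ι)) _ _ ?_
      rintro (l | i) <;> rfl
    rw [h1, hg]
    refine Prod.ext rfl (funext fun i => ?_)
    exact (hr i).symm

variable {K : Type k} [Field K]

/-- The generators can be chosen such that each `p s` is zero or a positive power of a monic
irreducible polynomial. -/
theorem exists_generators_polynomial (N : Type v) [AddCommGroup N] [Module K[X] N]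
    [Module.Finite K[X] N] :
    ∃ (κ : Type k) (_ : Fintype κ) (p : κ → K[X]) (g : κ → N),
      (∀ s, p s = 0 ∨ ∃ (f : MonicIrr K) (q : ℕ), 0 < q ∧ p s = f.1 ^ q) ∧
      (∀ Q : κ → K[X], ∑ s, Q s • g s = 0 ↔ ∀ s, p s ∣ Q s) ∧
      ∀ x : N, ∃ Q : κ → K[X], x = ∑ s, Q s • g s := by
  classical
  obtain ⟨κ, _, p, g, hp, hker, hsurj⟩ := exists_generators (R := K[X]) N
  -- Exponent `0` is possible in the decomposition; such generators vanish and are dropped.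
  have hunit : ∀ s, IsUnit (p s) → g s = 0 := by
    intro s hs
    have := (hker (Pi.single s 1)).2 fun t => by
      rcases eq_or_ne t s with rfl | h
      · exact hs.dvd
      · simp [h]
    rw [Finset.sum_eq_single s (fun t _ ht => by simp [ht]) (by simp)] at this
    simpa using this
  have hsum : ∀ Q : κ → K[X], ∑ s : {s // ¬ IsUnit (p s)}, Q s.1 • g s.1 = ∑ s, Q s • g s := by
    intro Q
    rw [← Finset.sum_subtype (Finset.univ.filter fun s => ¬ IsUnit (p s)) (by simp)
      fun s => Q s • g s]
    refine Finset.sum_subset (Finset.subset_univ _) fun s _ hs => ?_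
    rw [hunit s (by simpa using hs), smul_zero]
  have hassoc : ∀ s : {s // ¬ IsUnit (p s)}, ∃ p' : K[X], Associated (p s.1) p' ∧
      (p' = 0 ∨ ∃ (f : MonicIrr K) (q : ℕ), 0 < q ∧ p' = f.1 ^ q) := by
    rintro ⟨s, hs⟩
    rcases hp s with h0 | ⟨π, e, hπ, he⟩
    · exact ⟨0, by simp [h0], Or.inl rfl⟩
    · have h1 : Associated π (normalize π) := (normalize_associated π).symm
      refine ⟨normalize π ^ e, he ▸ h1.pow_pow, Or.inr
        ⟨⟨normalize π, monic_normalize hπ.ne_zero, h1.irreducible hπ⟩, e, ?_, rfl⟩⟩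
      rcases Nat.eq_zero_or_pos e with rfl | h
      · exact absurd (he ▸ by simp) hs
      · exact h
  choose p' hp'1 hp'2 using hassoc
  refine ⟨{s // ¬ IsUnit (p s)}, inferInstance, p', fun s => g s.1, hp'2, fun Q => ?_, fun x => ?_⟩
  · let Q' : κ → K[X] := fun s => if h : IsUnit (p s) then 0 else Q ⟨s, h⟩
    have hQ' : ∀ s : {s // ¬ IsUnit (p s)}, Q s = Q' s.1 := fun s => by simp [Q', s.2]
    simp only [hQ']
    rw [hsum, hker]
    constructor
    · intro h s
      exact (hp'1 s).dvd_iff_dvd_left.1 (h s.1)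
    · intro h s
      by_cases hs : IsUnit (p s)
      · exact hs.dvd
      · exact (hp'1 ⟨s, hs⟩).dvd_iff_dvd_left.2 (h ⟨s, hs⟩)
  · obtain ⟨Q, hQ⟩ := hsurj x
    exact ⟨fun s => Q s.1, hQ.trans (hsum Q).symm⟩

variable {V : Type*} {W : Type*} [AddCommGroup V] [AddCommGroup W] [Module K[X] V]
  [Module K[X] W]

/-- Generators of a finitely generated extension of modules over `K[X]`. -/
theorem exists_generators_extension (e : V →ₗ[K[X]] W) {ι : Type*} [Finite ι] (z : ι → W) :
    ∃ (κ : Type k) (_ : Fintype κ) (p : κ → K[X]) (x : κ → W) (u : κ → V),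
      (∀ s, p s = 0 ∧ u s = 0 ∨ ∃ (f : MonicIrr K) (q : ℕ), 0 < q ∧ p s = f.1 ^ q) ∧
      (∀ s, p s • x s = e (u s)) ∧
      (∀ (v : V) (Q : κ → K[X]), e v + ∑ s, Q s • x s = 0 → ∀ s, p s ∣ Q s) ∧
      ∀ i, ∃ (v : V) (Q : κ → K[X]), z i = e v + ∑ s, Q s • x s := by
  classical
  let q := (LinearMap.range e).mkQ
  -- The structure theorem is applied to the span of the `z i` modulo the image of `V`; its
  -- generators are then lifted to `W`.
  let N := Submodule.span K[X] (Set.range fun i => q (z i))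
  have : Module.Finite K[X] N := Module.Finite.span_of_finite K[X] (Set.finite_range _)
  obtain ⟨κ, _, p, g, hp, hker, hsurj⟩ := exists_generators_polynomial (K := K) N
  choose x hx using fun s => Submodule.mkQ_surjective (LinearMap.range e) (g s).1
  have hsum : ∀ Q : κ → K[X], q (∑ s, Q s • x s) = (∑ s, Q s • g s : N) := by
    intro Q
    rw [map_sum, AddSubmonoidClass.coe_finsetSum]
    exact Finset.sum_congr rfl fun s _ => by rw [map_smul, hx]; rfl
  have hrange : ∀ y, q y = 0 → ∃ v, y = e v := by
    intro y hy
    obtain ⟨v, hv⟩ := (Submodule.Quotient.mk_eq_zero _).1 hy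
    exact ⟨v, hv.symm⟩
  have hu : ∀ s, ∃ u, p s • x s = e u ∧ (p s = 0 → u = 0) := by
    intro s
    by_cases h0 : p s = 0
    · exact ⟨0, by rw [h0, zero_smul, map_zero], fun _ => rfl⟩
    · have h1 := (hker (Pi.single s (p s))).2 fun t => by
        rcases eq_or_ne t s with rfl | h
        · simp
        · simp [h]
      have h2 := hsum (Pi.single s (p s))
      rw [h1, Finset.sum_eq_single s (fun t _ ht => by simp [ht]) (by simp), Pi.single_eq_same] at h2
      obtain ⟨v, hv⟩ := hrange _ h2
      exact ⟨v, hv, fun h => absurd h h0⟩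
  choose u hu1 hu2 using hu
  refine ⟨κ, inferInstance, p, x, u, fun s => ?_, hu1, fun v Q h => ?_, fun i => ?_⟩
  · rcases hp s with h | h
    · exact Or.inl ⟨h, hu2 s h⟩
    · exact Or.inr h
  · refine (hker Q).1 (Subtype.ext ?_)
    rw [← hsum, eq_neg_of_add_eq_zero_right h, map_neg, neg_eq_zero.2]
    · rfl
    · exact (Submodule.Quotient.mk_eq_zero _).2 ⟨v, rfl⟩
  · obtain ⟨Q, hQ⟩ := hsurj ⟨q (z i), Submodule.subset_span ⟨i, rfl⟩⟩
    have h1 : q (z i - ∑ s, Q s • x s) = 0 := by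
      rw [map_sub, hsum, ← hQ, sub_self]
    obtain ⟨v, hv⟩ := hrange _ h1
    exact ⟨v, Q, by rw [← hv, sub_add_cancel]⟩

variable {C : KernelConfig K}

/-- Iterating image-completeness divides `f ^ C(f) • v` by every further power of `f`. -/
theorem exists_smul_eq_of_imageComplete (hV : ∀ f : MonicIrr K, C.c f < ⊤ → ∀ v : V, ∃ v',
      f.1 ^ ((C.c f).toNat + 1) • v' = f.1 ^ (C.c f).toNat • v) {f : MonicIrr K} (hf : C.c f < ⊤)
    (n : ℕ) (v : V) : ∃ v', f.1 ^ ((C.c f).toNat + n) • v' = f.1 ^ (C.c f).toNat • v := by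
  induction n with
  | zero => exact ⟨v, rfl⟩
  | succ n ih =>
    obtain ⟨v', hv'⟩ := ih
    obtain ⟨v'', hv''⟩ := hV f hf v'
    refine ⟨v'', ?_⟩
    rw [← hv', show (C.c f).toNat + (n + 1) = n + ((C.c f).toNat + 1) by ring, pow_add, mul_smul,
      hv'', ← mul_smul, ← pow_add, add_comm]

/-- If `V` is `C`-image-complete, then the generators of an extension can be chosen such that those
with `p s = f ^ q` and `C.c f < ⊤` have `q ≤ C.c f` and are annihilated by `f ^ C.c f`. -/
theorem exists_generators_imageComplete (hV : ∀ f : MonicIrr K, C.c f < ⊤ → ∀ v : V, ∃ v',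
      f.1 ^ ((C.c f).toNat + 1) • v' = f.1 ^ (C.c f).toNat • v) (hW : C.IsCModule W)
    (e : V →ₗ[K[X]] W) (he : Function.Injective e) {ι : Type*} [Finite ι] (z : ι → W) :
    ∃ (κ : Type k) (_ : Fintype κ) (p : κ → K[X]) (x : κ → W) (u : κ → V) (f : κ → MonicIrr K)
      (q : κ → ℕ),
      (∀ s, p s = 0 ∧ u s = 0 ∨ 0 < q s ∧ p s = (f s).1 ^ q s) ∧
      (∀ s, p s ≠ 0 → C.c (f s) < ⊤ → q s ≤ (C.c (f s)).toNat ∧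
        (f s).1 ^ ((C.c (f s)).toNat - q s) • u s = 0) ∧
      (∀ s, p s • x s = e (u s)) ∧
      (∀ (v : V) (Q : κ → K[X]), e v + ∑ s, Q s • x s = 0 → ∀ s, p s ∣ Q s) ∧
      ∀ i, ∃ (v : V) (Q : κ → K[X]), z i = e v + ∑ s, Q s • x s := by
  classical
  obtain ⟨κ, _, p, x, u, hp, hpx, hker, hsurj⟩ := exists_generators_extension e z
  have key : ∀ s, ∃ (v : V) (f : MonicIrr K) (q : ℕ),
      (p s = 0 ∧ u s - p s • v = 0 ∨ 0 < q ∧ p s = f.1 ^ q) ∧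
      (p s ≠ 0 → C.c f < ⊤ → q ≤ (C.c f).toNat ∧
        f.1 ^ ((C.c f).toNat - q) • (u s - p s • v) = 0) := by
    intro s
    rcases hp s with ⟨h0, h1⟩ | ⟨f, q, hq, hpf⟩
    · refine ⟨0, ⟨X, monic_X, irreducible_X⟩, 0, Or.inl ⟨h0, by rw [h0, h1]; simp⟩,
        fun h => absurd h0 h⟩
    by_cases hf : C.c f < ⊤
    -- The generator `x s` is replaced by `x s - e v`. By the choice of `v` it is killed by `f ^
    -- (C(f) + q)`, hence by `f ^ C(f)`. As all relations are multiples of `p s = f ^ q`, this also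
    -- gives `q ≤ C(f)`.
    · obtain ⟨v, hv⟩ := exists_smul_eq_of_imageComplete hV hf q (u s)
      have h1 : f.1 ^ (C.c f).toNat • (x s - e v) = 0 := by
        refine hW.smul_eq_zero_of_add hf q ?_
        rw [smul_sub, ← map_smul, hv, pow_add, mul_smul, ← hpf, hpx, map_smul, sub_self]
      have h2 : q ≤ (C.c f).toNat := by
        have h3 := hker (-(f.1 ^ (C.c f).toNat • v)) (Pi.single s (f.1 ^ (C.c f).toNat)) (by
          rw [Finset.sum_eq_single s (fun t _ ht => by simp [ht]) (by simp), Pi.single_eq_same,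
            map_neg, map_smul, neg_add_eq_sub, ← smul_sub, h1]) s
        rw [Pi.single_eq_same, hpf] at h3
        exact (pow_dvd_pow_iff f.2.2.ne_zero f.2.2.not_isUnit).1 h3
      refine ⟨v, f, q, Or.inr ⟨hq, hpf⟩, fun _ _ => ⟨h2, he ?_⟩⟩
      rw [map_smul, map_sub, map_smul, ← hpx, ← smul_sub, hpf, ← mul_smul, ← pow_add,
        Nat.sub_add_cancel h2, h1, map_zero]
    · exact ⟨0, f, q, Or.inr ⟨hq, hpf⟩, fun _ h => absurd h hf⟩
  choose v f q h1 h2 using key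
  have hsum : ∀ Q : κ → K[X], ∑ s, Q s • (x s - e (v s)) =
      ∑ s, Q s • x s - e (∑ s, Q s • v s) := by
    intro Q
    simp only [smul_sub, Finset.sum_sub_distrib, map_sum, map_smul]
  refine ⟨κ, inferInstance, p, fun s => x s - e (v s), fun s => u s - p s • v s, f, q, h1, h2,
    fun s => ?_, fun v' Q h => hker (v' - ∑ s, Q s • v s) Q ?_, fun i => ?_⟩
  · rw [smul_sub, hpx, map_sub, map_smul]
  · rw [← h, hsum, map_sub]
    abel
  · obtain ⟨v', Q, hQ⟩ := hsurj i
    refine ⟨v' + ∑ s, Q s • v s, Q, ?_⟩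
    rw [hQ, hsum, map_add]
    abel

end Structure

/-! ### Sequence-systems satisfied in extensions -/

section System

variable {K : Type k} [Field K] {C : KernelConfig K} {V : Type*} [AddCommGroup V] [Module K V]
  {θ : Module.End K V}

/-- The polynomial that maps a variable of a sequence-system with `P = 0` into `V`; it is zero for
the free variables. -/
noncomputable def SequenceSystem.annih (S : SequenceSystem C θ) : S.Var → K[X] :=
  Sum.elim 0 (Sum.elim S.ξ fun k => (S.f k).1 ^ S.q k)

/-- The right hand sides of a sequence-system with `P = 0`. -/
def SequenceSystem.rhs (S : SequenceSystem C θ) : S.Var → V :=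
  Sum.elim 0 (Sum.elim S.uld S.uke)

/-- Finitely many elements of an extension are generated by elements that satisfy a
sequence-system and no relations apart from it. -/
theorem exists_sequenceSystem (hV : C.ImageComplete θ) {W : Type*} [AddCommGroup W]
    [Module K[X] W] (hW : C.IsCModule W) (e : letI := endoModule θ; V →ₗ[K[X]] W)
    (he : Function.Injective e) {ι : Type*} [Finite ι] (z : ι → W) :
    ∃ (S : SequenceSystem C θ) (x : S.Var → W), S.P = 0 ∧
      (∀ s, S.annih s • x s = e (S.rhs s)) ∧
      (∀ (v : V) (Q : S.Var → K[X]), e v + ∑ s, Q s • x s = 0 → ∀ s, S.annih s ∣ Q s) ∧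
      ∀ i, ∃ (v : V) (Q : S.Var → K[X]), z i = e v + ∑ s, Q s • x s := by
  classical
  let _ := endoModule θ
  have hV' : ∀ f : MonicIrr K, C.c f < ⊤ → ∀ v : V, ∃ v',
      f.1 ^ ((C.c f).toNat + 1) • v' = f.1 ^ (C.c f).toNat • v := by
    intro f hf v
    have : aeval θ (f.1 ^ (C.c f).toNat) v ∈ LinearMap.range (aeval θ (f.1 ^ (C.c f).toNat)) :=
      ⟨v, rfl⟩
    rw [← hV f hf] at this
    exact this
  obtain ⟨κ, _, p, x, u, f, q, hp, hq, hpx, hker, hsurj⟩ :=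
    exists_generators_imageComplete hV' hW e he z
  -- Free generators become the `x_li`, those with `C(f) = ∞` the `x_ld`, and those with `C(f) < ∞`
  -- the `x_ke`.
  let κ₁ := {s // p s = 0}
  let κ₂ := {s // ¬ p s = 0}
  let κ₃ := {s : κ₂ // C.c (f s.1) = ⊤}
  let κ₄ := {s : κ₂ // ¬ C.c (f s.1) = ⊤}
  let e₁ : Fin (Fintype.card κ₁) ≃ κ₁ := (Fintype.equivFin κ₁).symm
  let e₃ : Fin (Fintype.card κ₃) ≃ κ₃ := (Fintype.equivFin κ₃).symm
  let e₄ : Fin (Fintype.card κ₄) ≃ κ₄ := (Fintype.equivFin κ₄).symm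
  let E : Fin (Fintype.card κ₁) ⊕ Fin (Fintype.card κ₃) ⊕ Fin (Fintype.card κ₄) ≃ κ :=
    (e₁.sumCongr ((e₃.sumCongr e₄).trans (Equiv.sumCompl _))).trans (Equiv.sumCompl _)
  have hp' : ∀ s : κ₂, 0 < q s.1 ∧ p s.1 = (f s.1).1 ^ q s.1 := fun s =>
    (hp s.1).resolve_left fun h => s.2 h.1
  have hq' : ∀ s : κ₄, q s.1.1 ≤ (C.c (f s.1.1)).toNat ∧
      (f s.1.1).1 ^ ((C.c (f s.1.1)).toNat - q s.1.1) • u s.1.1 = 0 := fun s =>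
    hq s.1.1 s.1.2 (lt_top_iff_ne_top.2 s.2)
  -- If `C` is algebraic, then `miPo` kills every generator, so none is free; and no `C(f)` is
  -- infinite.
  have halg : C.IsAlgebraic → IsEmpty κ₁ ∧ IsEmpty κ₃ := by
    refine fun hC => ⟨⟨fun s => ?_⟩, ⟨fun s => (hC.c_lt_top _).ne s.2⟩⟩
    have h1 := hker 0 (Pi.single s.1 C.miPo) (by
      rw [Finset.sum_eq_single s.1 (fun t _ ht => by simp [ht]) (by simp), Pi.single_eq_same,
        hW.1 hC, map_zero, add_zero]) s.1
    rw [Pi.single_eq_same, s.2, zero_dvd_iff] at h1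
    exact C.miPo_monic.ne_zero h1
  let S : SequenceSystem C θ :=
    { m := Fintype.card κ₁
      n := Fintype.card κ₃
      r := Fintype.card κ₄
      ξ := fun k => p (e₃ k).1.1
      P := 0
      uld := fun k => u (e₃ k).1.1
      f := fun k => f (e₄ k).1.1
      q := fun k => q (e₄ k).1.1
      uke := fun k => u (e₄ k).1.1
      alg := fun hC => ⟨Fintype.card_eq_zero_iff.2 (halg hC).1,
        Fintype.card_eq_zero_iff.2 (halg hC).2⟩
      ξ_monic := fun k => by
        rw [(hp' (e₃ k).1).2]
        exact (f _).2.1.pow _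
      ξ_deg := fun k => by
        rw [(hp' (e₃ k).1).2, (f _).2.1.natDegree_pow]
        exact Nat.mul_pos (hp' (e₃ k).1).1 (f _).natDegree_pos
      ξ_fac := fun k g hg => by
        rw [(hp' (e₃ k).1).2] at hg
        have h1 : g = f (e₃ k).1.1 := by
          by_contra hne
          exact g.2.2.not_isUnit ((MonicIrr.isCoprime hne).pow_right.isUnit_of_dvd' dvd_rfl hg)
        rw [h1]
        exact (e₃ k).2
      f_pos := fun k => by
        refine pos_iff_ne_zero.2 fun h => ?_
        have h1 := (hq' (e₄ k)).1
        rw [h] at h1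
        exact (hp' (e₄ k).1).1.ne' (Nat.le_zero.1 h1)
      f_lt_top := fun k => lt_top_iff_ne_top.2 (e₄ k).2
      q_pos := fun k => (hp' (e₄ k).1).1
      q_le := fun k => by
        rw [← ENat.natCast_toNat (e₄ k).2, ENat.natCast_le_natCast]
        exact (hq' (e₄ k)).1
      uke_mem := fun k => (hq' (e₄ k)).2 }
  have hannih : ∀ s : S.Var, S.annih s = p (E s) := by
    rintro (l | k | k)
    · exact (e₁ l).2.symm
    · rfl
    · exact (hp' (e₄ k).1).2.symm
  have hrhs : ∀ s : S.Var, S.rhs s = u (E s) := by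
    rintro (l | k | k)
    · rcases hp (e₁ l).1 with h | h
      · exact h.2.symm
      · exact absurd ((e₁ l).2.symm.trans h.2).symm (pow_ne_zero _ (f _).2.2.ne_zero)
    · rfl
    · rfl
  have hsum : ∀ Q : κ → K[X], ∑ s : S.Var, Q (E s) • x (E s) = ∑ s, Q s • x s := fun Q =>
    Fintype.sum_equiv E _ _ fun s => rfl
  refine ⟨S, fun s => x (E s), rfl, fun s => ?_, fun v Q h s => ?_, fun i => ?_⟩
  · rw [hannih, hrhs, hpx]
  · have h1 := hsum fun s => Q (E.symm s)
    simp only [Equiv.symm_apply_apply] at h1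
    rw [h1] at h
    have h2 := hker v (fun s => Q (E.symm s)) h (E s)
    rw [hannih]
    rwa [Equiv.symm_apply_apply] at h2
  · obtain ⟨v, Q, hQ⟩ := hsurj i
    exact ⟨v, fun s => Q (E s), by rw [hQ, hsum]⟩

end System

/-! ### Models of the axioms have the transfer property -/

section Backward

variable {L : FirstOrder.Language.{u, v}} {K : Type k} {d : ℕ} [Field K]

/-- A linear combination of the vectors `θ ^ i (x s)` as the values of polynomials in `θ`. -/
theorem finsupp_sum_eq_sum_aeval {V : Type*} [AddCommGroup V] [Module K V] (θ : Module.End K V)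
    {σ : Type*} [Fintype σ] (a : σ × ℕ →₀ K) :
    ∃ Q : σ → K[X], (∀ s i, (Q s).coeff i = a (s, i)) ∧
      ∀ x : σ → V, (a.sum fun q c => c • (θ ^ q.2) (x q.1)) = ∑ s, aeval θ (Q s) (x s) := by
  classical
  refine ⟨fun s => a.sum fun q c => if q.1 = s then monomial q.2 c else 0, fun s i => ?_,
    fun x => ?_⟩
  · simp only [Finsupp.sum, finsetSum_coeff]
    rw [Finset.sum_eq_single (s, i)]
    · simp
    · rintro ⟨t, j⟩ _ h
      rcases eq_or_ne t s with rfl | hts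
      · have : j ≠ i := fun h' => h (h' ▸ rfl)
        simp [coeff_monomial, this]
      · simp [hts]
    · intro h
      simp [Finsupp.notMem_support_iff.1 h]
  · simp only [Finsupp.sum, map_sum, LinearMap.sum_apply]
    rw [Finset.sum_comm]
    refine Finset.sum_congr rfl fun q _ => ?_
    rw [Finset.sum_eq_single q.1]
    · rw [if_pos rfl, aeval_monomial, Module.End.mul_apply, Module.algebraMap_end_apply]
    · intro s _ hs
      simp [hs.symm]
    · simp

/-- Values of polynomials in `θ` as a linear combination of the vectors `θ ^ i (x s)`. -/
theorem exists_finset_sum_coeff_smul {σ : Type*} [Fintype σ] (B : Set (σ × ℕ)) (Q : σ → K[X])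
    (hQ : ∀ s i, (Q s).coeff i ≠ 0 → (s, i) ∈ B) :
    ∃ F : Finset B, ∀ (V : Type w) [AddCommGroup V] [Module K V] (θ : Module.End K V)
      (x : σ → V), ∑ q ∈ F, (Q q.1.1).coeff q.1.2 • (θ ^ q.1.2) (x q.1.1) =
        ∑ s, aeval θ (Q s) (x s) := by
  classical
  let n := ∑ s, (Q s).natDegree + 1
  have hn : ∀ s, (Q s).natDegree < n := fun s => Nat.lt_succ_of_le
    (Finset.single_le_sum (f := fun s => (Q s).natDegree) (fun _ _ => Nat.zero_le _)
      (Finset.mem_univ s))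
  refine ⟨(Finset.univ ×ˢ Finset.range n).subtype (· ∈ B), fun V _ _ θ x => ?_⟩
  rw [Finset.sum_subtype_eq_sum_filter (f := fun q : σ × ℕ => (Q q.1).coeff q.2 •
    (θ ^ q.2) (x q.1)), Finset.sum_filter_of_ne, Finset.sum_product]
  · exact Finset.sum_congr rfl fun s _ => (aeval_apply_eq_sum θ _ (hn s) (x s)).symm
  · intro q _ h
    exact hQ q.1 q.2 fun h0 => h (by rw [h0, zero_smul])

variable (Ω : VSFormulas L K d)

/-- If `𝕍(M)` were finite, a single formula over `M` could say that a vector differs from all its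
elements; it would hold of `t` in `N` but be unsolvable in `M`. -/
theorem infinite_of_forall_map_ne {M N : Type w} [Nonempty M] [L.Structure M] [L.Structure N]
    [Ω.IsVectorSpace M] [Ω.IsVectorSpace N] (e : M ↪ₑ[L] N) (t : Ω.carrier N)
    (ht : ∀ c, t ≠ Ω.map e c) : Infinite (Ω.carrier M) := by
  by_contra hinf
  have := not_infinite_iff_finite.1 hinf
  choose χ hχ using fun c : Ω.carrier M => exists_formula_sum_smul_eq_const.{u, v, w} Ω
    (Finset.univ : Finset Unit) (1 : Unit → K) c
  obtain ⟨b, hb⟩ := exists_vectors_of_elementary Ω e (BoundedFormula.iInf fun c => (χ c).not)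
    (fun _ : Unit => t) (BoundedFormula.realize_iInf.2 fun c => by
      refine Formula.realize_not.2 fun h => ht c ?_
      simpa using (hχ c N e (Ω.map e c) _ rfl).1 h)
  refine Formula.realize_not.1 (BoundedFormula.realize_iInf.1 hb (b ())) ?_
  exact (hχ (b ()) M id (b ()) b rfl).2 (by simp)

/-- A formula about some of the vectors `x_s^i` as a placeholder formula. -/
noncomputable def placeholderFormula {M : Type*} {σ : Type} {B : Set (σ × ℕ)}
    (Ψ : L.Formula (M ⊕ B × Fin d)) : PlaceholderFormula L M σ d :=
  Ψ.relabel (Sum.map id fun q => (q.1.1.1, q.1.1.2, q.2))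

omit [Field K] in
theorem realize_placeholderFormula {M : Type*} {σ : Type} {B : Set (σ × ℕ)}
    (Ψ : L.Formula (M ⊕ B × Fin d)) {A : Type*} [L.Structure A] (f : M → A)
    (b : σ × ℕ → Ω.carrier A) :
    (placeholderFormula Ψ).Realize (Sum.elim f fun p => (b (p.1, p.2.1)).1 p.2.2) ↔
      Ψ.Realize (Sum.elim f (Ω.coords fun q : B => b q.1)) := by
  rw [placeholderFormula, Formula.realize_relabel]
  refine iff_of_eq (congrArg _ ?_)
  ext (m | p) <;> rfl

theorem mem_of_appears_placeholderFormula {M : Type*} {σ : Type} {B : Set (σ × ℕ)}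
    (Ψ : L.Formula (M ⊕ B × Fin d)) {s : σ} {i : ℕ} (h : Appears (placeholderFormula Ψ) s i) :
    (s, i) ∈ B := by
  classical
  obtain ⟨j, hj⟩ := h
  obtain ⟨a, -, ha⟩ := exists_of_mem_freeVarFinset_relabel
    (Sum.inl ∘ Sum.map id fun q : B × Fin d => (q.1.1.1, q.1.1.2, q.2)) Ψ (b := Sum.inr (s, i, j))
    (by convert hj; rfl)
  rcases a with m | q
  · simp at ha
  · simp only [Function.comp_apply, Sum.map_inr, Sum.inl.injEq, Sum.inr.injEq, Prod.mk.injEq] at ha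
    rw [← ha.1, ← ha.2.1]
    exact q.1.2

/-- A formula that is satisfied by independent vectors in an elementary extension does not imply
dependencies. -/
theorem not_impliesDependencies {M N : Type w} [Nonempty M] [L.Structure M] [L.Structure N]
    [Ω.IsVectorSpace M] [Ω.IsVectorSpace N] (e : M ↪ₑ[L] N) {σ : Type} {B : Set (σ × ℕ)}
    (Ψ : L.Formula (M ⊕ B × Fin d)) (b₀ : σ × ℕ → Ω.carrier N)
    (hΨ : Ψ.Realize (Sum.elim e (Ω.coords fun q : B => b₀ q.1)))
    (hB : ∀ s, (s, 0) ∈ B)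
    (hb₀ : ∀ (a : σ × ℕ →₀ K) (c : Ω.carrier M), a ≠ 0 → (∀ q ∈ a.support, q ∈ B) →
      (a.sum fun q r => r • b₀ q) ≠ Ω.map e c) :
    ¬ ImpliesDependencies Ω (placeholderFormula Ψ) := by
  classical
  rintro ⟨D, hD, hdep⟩
  -- The dependencies in `D` may involve placeholders outside `B`. These do not affect `Ψ`, so their
  -- values can be changed to violate all of `D`; the violation is then pulled back to `M` by
  -- elementarity.
  obtain ⟨b, hb, hbD⟩ : ∃ b : σ × ℕ → Ω.carrier N, (∀ q ∈ B, b q = b₀ q) ∧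
      ∀ f ∈ D, (f.1.sum fun q r => r • b q) ≠ Ω.map e f.2 := by
    rcases isEmpty_or_nonempty σ with hσ | ⟨⟨s⟩⟩
    · exact ⟨b₀, fun _ _ => rfl, fun f hf =>
        absurd (Finsupp.ext fun q => hσ.elim q.1) (hD f hf)⟩
    · have : Infinite (Ω.carrier M) := by
        refine infinite_of_forall_map_ne Ω e (b₀ (s, 0)) fun c h => ?_
        refine hb₀ (Finsupp.single (s, 0) 1) c (by simp) (fun q hq => ?_) (by simpa using h)
        rw [Finset.mem_singleton.1 (Finsupp.support_single_subset hq)]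
        exact hB s
      have : Infinite (Ω.carrier N) := Infinite.of_injective _ (Ω.map_injective e)
      obtain ⟨b, hb1, hb2⟩ := exists_eqOn_forall_sum_ne B (D.image fun f => (f.1, Ω.map e f.2)) b₀
        (by
          intro f hf hfB
          obtain ⟨f, hf', rfl⟩ := Finset.mem_image.1 hf
          exact hb₀ f.1 f.2 (hD f hf') hfB)
      exact ⟨b, hb1, fun f hf => hb2 _ (Finset.mem_image_of_mem _ hf)⟩
  choose χ hχ using fun f : (σ × ℕ →₀ K) × Ω.carrier M =>
    exists_formula_sum_smul_eq_const.{u, v, w} Ω f.1.support f.1 f.2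
  obtain ⟨b', hb'⟩ := exists_vectors_of_elementary Ω e
    (vectorFormula (placeholderFormula Ψ) ⊓ BoundedFormula.iInf fun f : D => (χ f.1).not) b (by
      refine Formula.realize_inf.2 ⟨?_, BoundedFormula.realize_iInf.2 fun f => ?_⟩
      · rw [realize_vectorFormula, realize_placeholderFormula]
        have : (fun q : B => b q.1) = fun q : B => b₀ q.1 := funext fun q => hb q.1 q.2
        rwa [this]
      · exact Formula.realize_not.2 fun h => hbD f.1 f.2 ((hχ f.1 N e (Ω.map e f.1.2) b rfl).1 h))
  obtain ⟨hb'1, hb'2⟩ := Formula.realize_inf.1 hb'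
  rw [realize_vectorFormula] at hb'1
  obtain ⟨f, hf, hfb⟩ := hdep (fun s i => b' (s, i)) hb'1
  exact Formula.realize_not.1 (BoundedFormula.realize_iInf.1 hb'2 ⟨f, hf⟩)
    ((hχ f M id f.2 b' rfl).2 hfb)

/-- It is definable that a tuple of variables is the sum of a vector of the base model and a linear
combination of vectors. -/
theorem exists_formula_comp_eq_add_sum {M : Type*} [L.Structure M] {I J : Type*} (s : Finset I)
    (a : I → K) (c : Ω.carrier M) (p : Fin d → M ⊕ J) :
    ∃ χ : L.Formula ((M ⊕ I × Fin d) ⊕ J), ∀ (A : Type w) [L.Structure A] [Ω.IsVectorSpace A]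
      (f : M → A) (c' : Ω.carrier A) (b : I → Ω.carrier A) (y : J → A), c'.1 = f ∘ c.1 →
      (χ.Realize (Sum.elim (Sum.elim f (Ω.coords b)) y) ↔
        Sum.elim f y ∘ p = (c' + ∑ i ∈ s, a i • b i).1) := by
  classical
  -- The constant `c` enters as an extra summand with index `none` and coefficient `1`.
  obtain ⟨χ, hχ⟩ := Ω.exists_formula_sum_smul_eq.{u, v, w} (Finset.insertNone s)
    fun o => o.elim 1 a
  let r : M ⊕ J → (M ⊕ I × Fin d) ⊕ J := Sum.map Sum.inl id
  have hr : ∀ {A : Type w} (f : M → A) (g : I × Fin d → A) (y : J → A),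
      Sum.elim (Sum.elim f g) y ∘ r = Sum.elim f y := by
    intro A f g y
    ext (m | j) <;> rfl
  refine ⟨Ω.dom.relabel (r ∘ p) ⊓ χ.relabel fun q => Sum.elim
    (fun o => o.elim (Sum.inl (Sum.inl (c.1 q.2))) fun i => Sum.inl (Sum.inr (i, q.2)))
    (fun _ => r (p q.2)) q.1, fun A _ _ f c' b y hc => ?_⟩
  rw [Formula.realize_inf, Formula.realize_relabel, Formula.realize_relabel,
    ← Function.comp_assoc, hr]
  have key : ∀ t : Ω.carrier A, t.1 = Sum.elim f y ∘ p →
      ((χ.Realize (Sum.elim (Sum.elim f (Ω.coords b)) y ∘ fun q => Sum.elim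
        (fun o => o.elim (Sum.inl (Sum.inl (c.1 q.2))) fun i => Sum.inl (Sum.inr (i, q.2)))
        (fun _ => r (p q.2)) q.1)) ↔ c' + ∑ i ∈ s, a i • b i = t) := by
    intro t ht
    have h1 := hχ A (fun o => o.elim c' b) t
    rw [Finset.sum_insertNone] at h1
    simp only [Option.elim_none, Option.elim_some, one_smul] at h1
    rw [← h1]
    refine iff_of_eq (congrArg _ ?_)
    ext ⟨((_ | i) | _), j⟩
    · exact (congrFun hc j).symm
    · rfl
    · exact (congrFun (hr f (Ω.coords b) y) (p j)).trans (congrFun ht j).symm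
  constructor
  · rintro ⟨h1, h2⟩
    rw [(key ⟨_, h1⟩ rfl).1 h2]
  · intro h
    exact ⟨by rw [h]; exact (c' + ∑ i ∈ s, a i • b i).2, (key _ h.symm).2 rfl⟩

end Backward

/-! ### Reduction of polynomials modulo the annihilators of a sequence-system -/

section Reduced

variable {K : Type k} [Field K] {C : KernelConfig K} {V : Type*} [AddCommGroup V] [Module K V]
  {θ : Module.End K V}

theorem SequenceSystem.annih_eq_zero_or_monic (S : SequenceSystem C θ) (s : S.Var) :
    S.annih s = 0 ∨ (S.annih s).Monic ∧ 0 < (S.annih s).natDegree := by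
  rcases s with l | k | k
  · exact Or.inl rfl
  · exact Or.inr ⟨S.ξ_monic k, S.ξ_deg k⟩
  · refine Or.inr ⟨(S.f k).2.1.pow _, ?_⟩
    change 0 < ((S.f k).1 ^ S.q k).natDegree
    rw [(S.f k).2.1.natDegree_pow]
    exact Nat.mul_pos (S.q_pos k) (S.f k).natDegree_pos

/-- The indices of the placeholder variables that may appear in formulas bounded by `S`. -/
def SequenceSystem.bounded (S : SequenceSystem C θ) : Set (S.Var × ℕ) :=
  {q | S.annih q.1 ≠ 0 → q.2 < (S.annih q.1).natDegree}

theorem SequenceSystem.zero_mem_bounded (S : SequenceSystem C θ) (s : S.Var) :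
    (s, 0) ∈ S.bounded :=
  fun h => ((S.annih_eq_zero_or_monic s).resolve_left h).2

theorem SequenceSystem.coeff_modByMonic_mem_bounded (S : SequenceSystem C θ) (s : S.Var)
    (Q : K[X]) {i : ℕ} (h : (Q %ₘ S.annih s).coeff i ≠ 0) : (s, i) ∈ S.bounded := by
  intro h0
  obtain ⟨h1, h2⟩ := (S.annih_eq_zero_or_monic s).resolve_left h0
  refine (le_natDegree_of_ne_zero h).trans_lt (natDegree_modByMonic_lt _ h1 fun h3 => ?_)
  rw [h3, natDegree_one] at h2
  exact h2.false

/-- By degrees, no nonzero multiple of the annihilator is bounded; this makes the bounded powers of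
a generic solution independent over `V`. -/
theorem SequenceSystem.eq_zero_of_annih_dvd (S : SequenceSystem C θ) (s : S.Var)
    {Q : K[X]} (hQ : ∀ i, Q.coeff i ≠ 0 → (s, i) ∈ S.bounded) (h : S.annih s ∣ Q) : Q = 0 := by
  rcases S.annih_eq_zero_or_monic s with h0 | ⟨h1, h2⟩
  · exact zero_dvd_iff.1 (h0 ▸ h)
  · by_contra hQ0
    have h3 := hQ Q.natDegree (leadingCoeff_ne_zero.2 hQ0) h1.ne_zero
    exact absurd (natDegree_le_of_dvd h hQ0) h3.not_ge

theorem SequenceSystem.Holds.aeval_annih {S : SequenceSystem C θ} (hP : S.P = 0)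
    {x : S.Var → V} (h : S.Holds x) (s : S.Var) : aeval θ (S.annih s) (x s) = S.rhs s := by
  rcases s with l | k | k
  · simp [annih, rhs]
  · have := h.1 k
    simp only [hP, Pi.zero_apply, map_zero, LinearMap.zero_apply, Finset.sum_const_zero,
      zero_add] at this
    exact this
  · exact h.2 k

/-- Finitely many elements of an extension are generated by elements that behave like a generic
solution of a sequence-system. -/
theorem exists_sequenceSystem_aeval (hV : C.ImageComplete θ) {W : Type*} [AddCommGroup W]
    [Module K W] {η : Module.End K W} (hη : C.IsCEndo η) (e : V →ₗ[K] W)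
    (he : Function.Injective e) (heη : ∀ v, η (e v) = e (θ v)) {ι : Type*} [Finite ι]
    (z : ι → W) :
    ∃ (S : SequenceSystem C θ) (x : S.Var → W),
      (∀ (a : S.Var × ℕ →₀ K) (c : V), a ≠ 0 → (∀ q ∈ a.support, q ∈ S.bounded) →
        (a.sum fun q r => r • (η ^ q.2) (x q.1)) ≠ e c) ∧
      (∀ x' : S.Var → V, S.Holds x' → ∀ (v : V) (Q : S.Var → K[X]),
        e v + ∑ s, aeval η (Q s) (x s) = 0 → v + ∑ s, aeval θ (Q s) (x' s) = 0) ∧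
      ∀ i, ∃ (v : V) (Q : S.Var → K[X]), (∀ s j, (Q s).coeff j ≠ 0 → (s, j) ∈ S.bounded) ∧
        z i = e v + ∑ s, aeval η (Q s) (x s) := by
  let _ := endoModule θ
  let _ := endoModule η
  have := isScalarTower_endoModule θ
  have := isScalarTower_endoModule η
  have hsmul : ∀ (p : K[X]) (y : W), aeval η p y = p • y := fun _ _ => rfl
  let e' : V →ₗ[K[X]] W :=
    { e with
      map_smul' := fun p v => map_aeval_eq_smul e (fun v => by
        rw [← heη, ← hsmul, aeval_X]) p v }
  have he' : ∀ (p : K[X]) (v : V), e (aeval θ p v) = p • e v := fun p v => e'.map_smul p v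
  obtain ⟨S, x, hP, hx, hker, hz⟩ := exists_sequenceSystem hV
    ((C.isCEndo_iff_isCModule fun p v => rfl).1 hη) e' he z
  refine ⟨S, x, fun a c ha haB h => ha ?_, fun x' hx' v Q h => ?_, fun i => ?_⟩
  · obtain ⟨Q, hQ1, hQ2⟩ := finsupp_sum_eq_sum_aeval η a
    have h1 := hker (-c) Q (by
      rw [map_neg, neg_add_eq_zero]
      exact h.symm.trans (hQ2 x))
    ext ⟨s, i⟩
    rw [← hQ1, S.eq_zero_of_annih_dvd s (fun i hi => ?_) (h1 s), coeff_zero, Finsupp.zero_apply]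
    exact haB _ (Finsupp.mem_support_iff.2 (hQ1 s i ▸ hi))
  -- Each `Q s` is a multiple of `annih s`, so its value at any solution is determined by the right
  -- hand side in `V`. Hence the relation carries over to every solution of `S`.
  · choose c hc using hker v Q h
    have h1 : ∀ s, aeval θ (Q s) (x' s) = aeval θ (c s) (S.rhs s) := fun s => by
      rw [hc, mul_comm, map_mul, Module.End.mul_apply, hx'.aeval_annih hP]
    simp only [h1]
    apply he
    rw [map_add, map_sum, map_zero, ← h]
    refine congrArg (e v + ·) (Finset.sum_congr rfl fun s _ => ?_)
    rw [he', hsmul, hc, mul_comm, mul_smul, hx]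
    rfl
  · obtain ⟨v, Q, h⟩ := hz i
    -- The quotient part acts on `rhs` and is absorbed into `V`. For free variables the annihilator
    -- is `0`, and then `%ₘ` leaves `Q s` unchanged.
    refine ⟨v + ∑ s, aeval θ (Q s /ₘ S.annih s) (S.rhs s), fun s => Q s %ₘ S.annih s,
      fun s j hj => S.coeff_modByMonic_mem_bounded s _ hj, ?_⟩
    rw [h, map_add, map_sum, add_assoc, ← Finset.sum_add_distrib]
    refine congrArg (e v + ·) (Finset.sum_congr rfl fun s _ => ?_)
    conv_lhs => rw [← modByMonic_add_div (Q s) (S.annih s), add_smul, mul_comm, mul_smul, hx]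
    rw [he', hsmul, add_comm]
    rfl

end Reduced

/-! ### From generic solutions of sequence-systems to the transfer property -/

section Backward

variable {L : FirstOrder.Language.{u, v}} {K : Type k} {d : ℕ} [Field K]
  {T : L.Theory} {Ω : VSFormulas L K d} {C : KernelConfig K}

theorem SequenceSystem.bounds_placeholderFormula {V : Type*} [AddCommGroup V] [Module K V]
    {θ : Module.End K V} (S : SequenceSystem C θ) {M : Type*} [L.Structure M]
    (Ψ : L.Formula (M ⊕ S.bounded × Fin d)) : S.Bounds (placeholderFormula Ψ) :=
  ⟨fun k _ h => mem_of_appears_placeholderFormula Ψ h (S.ξ_monic k).ne_zero,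
    fun k _ h => mem_of_appears_placeholderFormula Ψ h (((S.f k).2.1.pow (S.q k)).ne_zero)⟩

/-- An image-complete model in which all sequence-systems can be solved generically has the transfer
property. -/
theorem hasTransfer_of_exists_holds (hT : IsModelComplete.{u, v, w} T) {M : Type (max u v w)}
    [Nonempty M] [L.Structure M] [(thetaLang d).Structure M] [M ⊨ T] [Ω.IsVectorSpace M]
    [Ω.IsEndo M] (hV : C.ImageComplete (Ω.endo M))
    (hS : ∀ (S : SequenceSystem C (Ω.endo M)) (ψ : PlaceholderFormula L M S.Var d),
      S.Bounds ψ → ¬ ImpliesDependencies Ω ψ →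
        ∃ x : S.Var → Ω.carrier M, RealizeTheta Ω ψ x ∧ S.Holds x) :
    HasTransfer.{u, v, max u v w, k, u} T Ω C M := by
  classical
  intro N _ _ hN e J Φ E y hΦ hE
  have := hN.model
  have := hN.isVectorSpace
  have := hN.isEndo
  have : Nonempty N := ‹Nonempty M›.map e
  let e' : M ↪ₑ[L] N := hT.elementary (embeddingReduct e)
  have he : ⇑e' = e := rfl
  -- Where the argument of `θ` is not a vector, the equation only says that the value is zero, which
  -- is an `L`-condition. The equations in `E₁` are the ones that involve the endomorphism.
  let E₁ := {p // p ∈ E ∧ Sum.elim e y ∘ p.1 ∈ Ω.carrier N}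
  let E₂ := {p // p ∈ E ∧ Sum.elim e y ∘ p.1 ∉ Ω.carrier N}
  have : Finite E₁ := (E.finite_toSet.subset fun p hp => hp.1 : Set.Finite
    {p | p ∈ E ∧ Sum.elim e y ∘ p.1 ∈ Ω.carrier N})
  have : Finite E₂ := (E.finite_toSet.subset fun p hp => hp.1 : Set.Finite
    {p | p ∈ E ∧ Sum.elim e y ∘ p.1 ∉ Ω.carrier N})
  let z : E₁ → Ω.carrier N := fun p => ⟨_, p.2.2⟩
  have hz : ∀ p : E₁, Sum.elim e y ∘ p.1.2 = (Ω.endo N (z p)).1 := fun p => by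
    rw [← thetaMap_coe]
    exact (hE p.1 p.2.1).symm
  obtain ⟨S, x, hind, hsol, hgen⟩ := exists_sequenceSystem_aeval hV hN.isCEndo (Ω.map e')
    (Ω.map_injective e') (endo_map Ω e e' he) (Sum.elim z fun p => Ω.endo N (z p))
  choose c Q hQ hcQ using hgen
  choose F hF using fun i => exists_finset_sum_coeff_smul.{max u v w} S.bounded (Q i) (hQ i)
  let t : E₁ ⊕ E₁ → Fin d → M ⊕ J := Sum.elim (fun p => p.1.1) fun p => p.1.2
  choose χ hχ using fun i => exists_formula_comp_eq_add_sum.{u, v, max u v w} Ω (F i)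
    (fun q : S.bounded => (Q i q.1.1).coeff q.1.2) (c i) (t i)
  let r : M ⊕ J → (M ⊕ S.bounded × Fin d) ⊕ J := Sum.map Sum.inl id
  have hr : ∀ {A : Type (max u v w)} (f : M → A) (g : S.bounded × Fin d → A) (y : J → A),
      Sum.elim (Sum.elim f g) y ∘ r = Sum.elim f y := by
    intro A f g y
    ext (m | j) <;> rfl
  -- All unknowns `y` are quantified away. Arguments and values of the `E₁`-equations are expressed
  -- through the generators, so that `Ψ` speaks only about bounded powers.
  obtain ⟨Ψ, -, hΨ⟩ := exists_formula_realize_iff_exists.{u, v, max u v w}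
    ((Φ.relabel r ⊓ BoundedFormula.iInf χ) ⊓ BoundedFormula.iInf fun p : E₂ =>
      (Ω.dom.relabel (r ∘ p.1.1)).not ⊓ (Ω.dom.relabel (r ∘ p.1.2) ⊓
        Ω.zero.relabel (r ∘ p.1.2)))
  have key : ∀ {A : Type (max u v w)} [Nonempty A] [L.Structure A] [Ω.IsVectorSpace A]
      (f : M → A) (θ : Module.End K (Ω.carrier A)) (c' : E₁ ⊕ E₁ → Ω.carrier A)
      (x : S.Var → Ω.carrier A), (∀ i, (c' i).1 = f ∘ (c i).1) →
      (Ψ.Realize (Sum.elim f (Ω.coords fun q : S.bounded => (θ ^ q.1.2) (x q.1.1))) ↔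
        ∃ y : J → A, Φ.Realize (Sum.elim f y) ∧
          (∀ i, Sum.elim f y ∘ t i = (c' i + ∑ s, aeval θ (Q i s) (x s)).1) ∧
          ∀ p : E₂, Sum.elim f y ∘ p.1.1 ∉ Ω.carrier A ∧
            Sum.elim f y ∘ p.1.2 = (0 : Ω.carrier A).1) := by
    intro A _ _ _ f θ c' x hc'
    rw [hΨ]
    refine exists_congr fun y => ?_
    rw [Formula.realize_inf, Formula.realize_inf, Formula.realize_relabel, hr, and_assoc]
    refine and_congr Iff.rfl (and_congr (BoundedFormula.realize_iInf.trans ?_)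
      (BoundedFormula.realize_iInf.trans ?_))
    · refine forall_congr' fun i => ?_
      rw [← hF]
      exact hχ i A f (c' i) _ y (hc' i)
    · refine forall_congr' fun p => ?_
      refine Formula.realize_inf.trans ?_
      rw [Formula.realize_not, Formula.realize_inf, Formula.realize_relabel,
        Formula.realize_relabel, Formula.realize_relabel, ← Function.comp_assoc,
        ← Function.comp_assoc, hr]
      refine and_congr Iff.rfl ⟨fun h => ?_, fun h => ?_⟩
      · exact congrArg Subtype.val ((Ω.realize_zero_iff ⟨_, h.1⟩).1 h.2)
      · rw [h]
        exact ⟨(0 : Ω.carrier A).2, (Ω.realize_zero_iff 0).2 rfl⟩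
  have hΨN : Ψ.Realize (Sum.elim e' (Ω.coords fun q : S.bounded =>
      (Ω.endo N ^ q.1.2) (x q.1.1))) := by
    refine (key e' (Ω.endo N) (fun i => Ω.map e' (c i)) x fun i => rfl).2 ⟨y, hΦ, ?_, ?_⟩
    · rintro (p | p)
      · rw [← hcQ]
        rfl
      · rw [← hcQ]
        exact hz p
    · intro p
      refine ⟨p.2.2, ?_⟩
      rw [← thetaMap_of_notMem Ω p.2.2]
      exact (hE p.1 p.2.1).symm
  obtain ⟨x', hx', hx'S⟩ := hS S (placeholderFormula Ψ) (S.bounds_placeholderFormula Ψ)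
    (not_impliesDependencies Ω e' Ψ (fun q => (Ω.endo N ^ q.2) (x q.1)) hΨN S.zero_mem_bounded
      hind)
  have hΨM := (realize_placeholderFormula Ω Ψ id fun q => (Ω.endo M ^ q.2) (x' q.1)).1 hx'
  obtain ⟨y', hy', hy'1, hy'2⟩ := (key id (Ω.endo M) c x' fun i => rfl).1 hΨM
  refine ⟨y', hy', fun p hp => ?_⟩
  by_cases hpN : Sum.elim e y ∘ p.1 ∈ Ω.carrier N
  · have h1 := hy'1 (Sum.inl ⟨p, hp, hpN⟩)
    have h2 := hy'1 (Sum.inr ⟨p, hp, hpN⟩)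
    change Sum.elim id y' ∘ p.1 = _ at h1
    change Sum.elim id y' ∘ p.2 = _ at h2
    rw [h1, h2, thetaMap_coe]
    refine congrArg Subtype.val (sub_eq_zero.1 ?_)
    set i₁ : E₁ ⊕ E₁ := Sum.inl ⟨p, hp, hpN⟩
    set i₂ : E₁ ⊕ E₁ := Sum.inr ⟨p, hp, hpN⟩
    -- The equation `θ(z) = w` becomes a relation with polynomials `X * Q i₁ - Q i₂`, which may
    -- exceed the bounds. It is therefore not part of `Ψ`, but a consequence of `S` by `hsol`.
    have hpoly : ∀ {V : Type (max u v w)} [AddCommGroup V] [Module K V] (θ : Module.End K V)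
        (v₁ v₂ : V) (x : S.Var → V), θ (v₁ + ∑ s, aeval θ (Q i₁ s) (x s)) -
          (v₂ + ∑ s, aeval θ (Q i₂ s) (x s)) =
          θ v₁ - v₂ + ∑ s, aeval θ (X * Q i₁ s - Q i₂ s) (x s) := by
      intro V _ _ θ v₁ v₂ x
      simp only [map_add, map_sum, map_sub, map_mul, aeval_X, LinearMap.sub_apply,
        Module.End.mul_apply, Finset.sum_sub_distrib]
      abel
    rw [hpoly]
    refine hsol x' hx'S _ _ ?_
    rw [map_sub, ← endo_map Ω e e' he, ← hpoly, ← hcQ, ← hcQ, sub_eq_zero]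
    rfl
  · obtain ⟨h1, h2⟩ := hy'2 ⟨p, hp, hpN⟩
    rw [thetaMap_of_notMem Ω h1]
    exact h2.symm

end Backward

end GenericEndo

theorem theorem3p37 {L : FirstOrder.Language.{u, v}} {K : Type k} [Field K] {d : ℕ}
    (T : L.Theory) (hT : GenericEndo.IsModelComplete.{u, v, w} T)
    (Ω : GenericEndo.VSFormulas L K d)
    (hΩ : ∀ (N : Type (max u v w)) [Nonempty N] [L.Structure N] [N ⊨ T], Ω.IsVectorSpace N)
    (C : GenericEndo.KernelConfig K)
    (M : Type (max u v w)) [L.Structure M] [(GenericEndo.thetaLang d).Structure M]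
    (hM : GenericEndo.IsModel T Ω C M) :
    GenericEndo.IsExistentiallyClosed T Ω C M ↔
      haveI := hM.isVectorSpace
      haveI := hM.isEndo
      C.ImageComplete (Ω.endo M) ∧
        ∀ (S : GenericEndo.SequenceSystem C (Ω.endo M))
          (ψ : GenericEndo.PlaceholderFormula L M S.Var d),
          S.Bounds ψ → ¬ GenericEndo.ImpliesDependencies Ω ψ →
            ∃ x : S.Var → Ω.carrier M, GenericEndo.RealizeTheta Ω ψ x ∧ S.Holds x := by
  have := hM.model
  have := hM.isVectorSpace
  have := hM.isEndo
  -- Two distinct vectors differ in some coordinate, so `M` has an element.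
  have : Nonempty M := by
    have := Ω.nontrivial_carrier M
    obtain ⟨x, y, hxy⟩ := exists_pair_ne (Ω.carrier M)
    obtain ⟨j, -⟩ := Function.ne_iff.1 (Subtype.coe_ne_coe.2 hxy)
    exact ⟨x.1 j⟩
  refine ⟨fun h => ?_, fun h => ?_⟩
  · have h1 := h.hasTransfer hT hM.model
    exact ⟨h1.imageComplete hM.isCEndo hΩ, fun S ψ => h1.exists_holds hM.isCEndo hΩ S ψ⟩
  · exact (GenericEndo.hasTransfer_of_exists_holds hT h.1 h.2).isExistentiallyClosed
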